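/- **Theorem 3.6 (Asymptotic convergence).** Let $f\in\mathbb{R}[x]=\mathbb{R}[x_1,\dots,x_n]$ and, for $l=1,\dots,m$, let $c_{eq}^{(l)}=(c_i^{(l)})_{i\in\mathcal{E}^{(l)}}$ and $c_{in}^{(l)}=(c_j^{(l)})_{j\in\mathcal{I}^{(l)}}$ be finite tuples of polynomials in $\mathbb{R}[x]$. Let $$K_l=\{x\in\mathbb{R}^n : c_i^{(l)}(x)=0\ (i\in\mathcal{E}^{(l)}),\ c_j^{(l)}(x)\ge 0\ (j\in\mathcal{I}^{(l)})\},\qquad K=\bigcup_{l=1}^m K_l,\qquad f_{min}=\inf_{x\in K} f(x).$$ For finite tuples $h=(h_i)$ and $g=(g_j)$ of polynomials, $\mathrm{Ideal}[h]$ is the ideal generated by $h$, and $\mathrm{QM}[g]$ is the set of all $\sigma_0+\sum_j\sigma_j g_j$ with $\sigma_0$ and all $\sigma_j$ sums of squares of polynomials. Their truncations are $\mathrm{Ideal}[h]_{2k}=\sum_i h_i\,\mathbb{R}[x]_{2k-\deg h_i}$, where $\mathbb{R}[x]_d$ is the space of polynomials of degree at most $d$ (it is $\{0\}$ if $d<0$),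 and $\mathrm{QM}[g]_{2k}$, the set of all $\sigma_0+\sum_j\sigma_j g_j$ as above with $\deg\sigma_0\le 2k$ and $\deg(\sigma_jg_j)\le 2k$ for all $j$. A set $M\subseteq\mathbb{R}[x]$ is called archimedean if there is $q\in M$ such that $\{x\in\mathbb{R}^n : q(x)\ge 0\}$ is compact. For $y=(y_\alpha)_{|\alpha|\le 2k}$ and a polynomial $p=\sum_\alpha p_\alpha x^\alpha$, put $\langle p,y\rangle=\sum_{|\alpha|\le 2k}p_\alpha y_\alpha$. Let $\mathscr{V}^{(2k)}_p[y]$ be the vector of all $\langle p\,x^\alpha,y\rangle$ with $|\alpha|\le 2k-\deg p$, let $L^{(k)}_p[y]$ be the matrix with entries $\langle p\,x^{\alpha+\beta},y\rangle$ for $|\alpha|,|\beta|\le k-\lceil\deg(p)/2\rceil$ (both are empty if $\deg p>2k$), and let $M_k[y]=L^{(k)}_1[y]$. For $k\ge 1$ let $f_{sos,k}$ be the optimal value of $$\sup\ \gamma\quad\text{s.t.}\quad f-\gamma\in\bigcap_{l=1}^m\Big[\mathrm{Ideal}[c_{eq}^{(l)}]_{2k}+\mathrm{QM}[c_{in}^{(l)}]_{2k}\Big],\quad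 \gamma\in\mathbb{R},$$ and let $f_{mom,k}$ be the optimal value of $$\inf\ \sum_{l=1}^m\langle f,y^{(l)}\rangle\quad\text{s.t.}\quad \mathscr{V}^{(2k)}_{c_i^{(l)}}[y^{(l)}]=0\ (i\in\mathcal{E}^{(l)}),\quad L^{(k)}_{c_j^{(l)}}[y^{(l)}]\succeq 0\ (j\in\mathcal{I}^{(l)}),\quad M_k[y^{(l)}]\succeq 0,\quad \sum_{l=1}^m y^{(l)}_0=1,$$ over $y^{(l)}\in\mathbb{R}^{\mathbb{N}^n_{2k}}$, $l=1,\dots,m$, where $\mathbb{N}^n_{2k}=\{\alpha\in\mathbb{N}^n:|\alpha|\le 2k\}$. All optimal values are taken in $[-\infty,+\infty]$, with $\inf\emptyset=+\infty$ and $\sup\emptyset=-\infty$. If $\mathrm{Ideal}[c_{eq}^{(l)}]+\mathrm{QM}[c_{in}^{(l)}]$ is archimedean for every $l=1,\dots,m$, then $$\lim_{k\to\infty}f_{sos,k}=\lim_{k\to\infty}f_{mom,k}=f_{min}.$$ -/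

import Mathlib

open MvPolynomial
open scoped Pointwise

namespace UnifiedMomentSOS

noncomputable section

/-- The ring `ℝ[x] = ℝ[x₁, …, xₙ]`. -/
abbrev RPoly (n : ℕ) : Type := MvPolynomial (Fin n) ℝ

/-- The basic closed semialgebraic set `{x ∈ ℝⁿ | c_i(x) = 0 (i ∈ E), c_j(x) ≥ 0 (j ∈ I)}`. -/
def semialgSet {n : ℕ} {E I : Type*} (ceq : E → RPoly n) (cin : I → RPoly n) :
    Set (Fin n → ℝ) :=
  {x | (∀ i, eval x (ceq i) = 0) ∧ (∀ j, 0 ≤ eval x (cin j))}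

/-! ### Ideals, quadratic modules and their truncations -/

/-- The quadratic module `QM[g] = {σ₀ + ∑ j, σ_j g_j | all σ's are sums of squares}`. -/
def quadModule {n : ℕ} {I : Type*} [Fintype I] (g : I → RPoly n) : Set (RPoly n) :=
  {p | ∃ (σ₀ : RPoly n) (σ : I → RPoly n), IsSumSq σ₀ ∧ (∀ j, IsSumSq (σ j)) ∧
    p = σ₀ + ∑ j, σ j * g j}

/-- The truncation `QM[g]_{2k}`: every summand has degree at most `2k`. -/
def quadModuleTrunc {n : ℕ} {I : Type*} [Fintype I] (g : I → RPoly n) (k : ℕ) :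
    Set (RPoly n) :=
  {p | ∃ (σ₀ : RPoly n) (σ : I → RPoly n), IsSumSq σ₀ ∧ (∀ j, IsSumSq (σ j)) ∧
    σ₀.totalDegree ≤ 2 * k ∧ (∀ j, (σ j * g j).totalDegree ≤ 2 * k) ∧
    p = σ₀ + ∑ j, σ j * g j}

/-- The truncation `Ideal[h]_{2k} = ∑ i, h_i ℝ[x]_{2k - deg h_i}`, where `ℝ[x]_d = {0}` for
negative `d`. -/
def idealTrunc {n : ℕ} {E : Type*} [Fintype E] (h : E → RPoly n) (k : ℕ) : Set (RPoly n) :=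
  {p | ∃ q : E → RPoly n,
    (∀ i, q i = 0 ∨ (h i).totalDegree + (q i).totalDegree ≤ 2 * k) ∧ p = ∑ i, h i * q i}

/-- The set `Ideal[ceq] + QM[cin]`. -/
def idealAddQuadModule {n : ℕ} {E I : Type*} [Fintype I] (ceq : E → RPoly n)
    (cin : I → RPoly n) : Set (RPoly n) :=
  (Ideal.span (Set.range ceq) : Set (RPoly n)) + quadModule cin

/-- A set `M` of polynomials is archimedean if there is `q ∈ M` such that
`{x ∈ ℝⁿ | q(x) ≥ 0}` is compact. -/
def IsArchimedean {n : ℕ} (M : Set (RPoly n)) : Prop :=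
  ∃ q ∈ M, IsCompact {x : Fin n → ℝ | 0 ≤ eval x q}

/-! ### Truncated multi-sequences, moment and localizing matrices -/

/-- The set `ℕⁿ_d` of exponents `α` with `|α| ≤ d`. -/
abbrev Expo (n d : ℕ) : Type := {α : Fin n →₀ ℕ // α.degree ≤ d}

instance instFintypeExpo (n d : ℕ) : Fintype (Expo n d) :=
  (Finsupp.finite_of_degree_le (σ := Fin n) d).fintype

/-- Truncated multi-sequences of degree `d`, i.e. vectors in `ℝ^{ℕⁿ_d}`. -/
abbrev Tms (n d : ℕ) : Type := Expo n d → ℝ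

/-- The Riesz functional `⟨p, y⟩ = ∑_{|α| ≤ d} p_α y_α`; it is meant for `deg p ≤ d`. -/
def riesz {n d : ℕ} (y : Tms n d) (p : RPoly n) : ℝ :=
  ∑ α : Expo n d, coeff α.1 p * y α

/-- The localizing vector of `p`, of degree `2k`: its entries are `⟨p · x^α, y⟩` with
`|α| ≤ 2k - deg p` (no entries if `deg p > 2k`). -/
def localizingVector {n : ℕ} (k : ℕ) (p : RPoly n) (y : Tms n (2 * k)) :
    {α : Fin n →₀ ℕ // p.totalDegree + α.degree ≤ 2 * k} → ℝ :=
  fun α => riesz y (p * monomial α.1 1)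

/-- The localizing matrix of `p`, of order `k`: its entries are `⟨p · x^α · x^β, y⟩` with
`|α|, |β| ≤ k - ⌈deg p / 2⌉`, i.e. `deg p + 2|α| ≤ 2k` and `deg p + 2|β| ≤ 2k`
(no entries if `deg p > 2k`). -/
def localizingMatrix {n : ℕ} (k : ℕ) (p : RPoly n) (y : Tms n (2 * k)) :
    Matrix {α : Fin n →₀ ℕ // p.totalDegree + 2 * α.degree ≤ 2 * k}
      {α : Fin n →₀ ℕ // p.totalDegree + 2 * α.degree ≤ 2 * k} ℝ :=
  fun α β => riesz y (p * monomial α.1 1 * monomial β.1 1)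

/-- The moment matrix `M_k[y]`, the localizing matrix of the polynomial `1`. -/
def momentMatrix {n : ℕ} (k : ℕ) (y : Tms n (2 * k)) :=
  localizingMatrix k (1 : RPoly n) y

/-- The entry `y_0`. -/
def Tms.zeroth {n d : ℕ} (y : Tms n d) : ℝ := y ⟨0, by simp⟩

/-! ### The optimization problem and its relaxations

All optimal values are taken in the extended reals, so that the infimum of an empty set is `⊤`
and the supremum of an empty set is `⊥`. -/

section Problem

variable {n m : ℕ} {E I : Fin m → Type*}

/-- The optimal value `f_min` of minimizing `f` over `K = K_1 ∪ ⋯ ∪ K_m`. -/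
def fmin (f : RPoly n) (ceq : ∀ l, E l → RPoly n) (cin : ∀ l, I l → RPoly n) : EReal :=
  ⨅ x ∈ ⋃ l, semialgSet (ceq l) (cin l), ((eval x f : ℝ) : EReal)

variable [∀ l, Fintype (E l)] [∀ l, Fintype (I l)]

/-- The feasible set of the `k`th order SOS relaxation: those `γ` with
`f - γ ∈ ⋂ l, (Ideal[ceq l]_{2k} + QM[cin l]_{2k})`. -/
def sosFeasible (f : RPoly n) (ceq : ∀ l, E l → RPoly n) (cin : ∀ l, I l → RPoly n)
    (k : ℕ) : Set ℝ :=
  {γ | f - C γ ∈ ⋂ l, (idealTrunc (ceq l) k + quadModuleTrunc (cin l) k)}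

/-- The optimal value `f_{sos,k}` of the `k`th order SOS relaxation. -/
def fsos (f : RPoly n) (ceq : ∀ l, E l → RPoly n) (cin : ∀ l, I l → RPoly n)
    (k : ℕ) : EReal :=
  ⨆ γ ∈ sosFeasible f ceq cin k, (γ : EReal)

end Problem

section Moment

variable {n m : ℕ} {E I : Fin m → Type*}

/-- The feasible set of the `k`th order moment relaxation: tuples `y = (y^(1), …, y^(m))` with
vanishing localizing vectors, positive semidefinite localizing and moment matrices, and
`∑ l, y^(l)_0 = 1`. -/
def momFeasible (ceq : ∀ l, E l → RPoly n) (cin : ∀ l, I l → RPoly n) (k : ℕ) :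
    Set (Fin m → Tms n (2 * k)) :=
  {y | (∀ l, (∀ i, localizingVector k (ceq l i) (y l) = 0) ∧
      (∀ j, (localizingMatrix k (cin l j) (y l)).PosSemidef) ∧
      (momentMatrix k (y l)).PosSemidef) ∧
    ∑ l, (y l).zeroth = 1}

/-- The optimal value `f_{mom,k}` of the `k`th order moment relaxation. -/
def fmom (f : RPoly n) (ceq : ∀ l, E l → RPoly n) (cin : ∀ l, I l → RPoly n)
    (k : ℕ) : EReal :=
  ⨅ y ∈ momFeasible ceq cin k, ((∑ l, riesz (y l) f : ℝ) : EReal)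

end Moment

end

end UnifiedMomentSOS

/-! The two relaxations are squeezed. Pairing an SOS certificate with a feasible moment tuple gives
`fsos ≤ fmom` for every order (`fsos_le_fmom`), and evaluation at a point of some `K_l` is a
feasible moment tuple, so `fmom ≤ fmin` once `deg f ≤ 2k` (`fmom_le_fmin`). What remains is that
every real `γ < fmin` is eventually SOS-feasible. On each `K_l` the polynomial `f - γ` is positive,
so Putinar's Positivstellensatz (`IsQuadMod.mem_of_forall_eval_pos`) puts it in the ideal plus the
quadratic module. A representation has finitely many terms, and there are finitely many `l`, so all
of them fit into the truncations for large `k`.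

Putinar's theorem is proved for quadratic modules that bound every polynomial (`IsQuadMod.Bounds`):
a proper module of this kind extends to a total one, which defines a real character by a Dedekind
cut (`IsQuadMod.exists_algHom`). The hypothesis only provides some `q` in the module with `{q ≥ 0}`
compact. To pass from one to the other (`IsQuadMod.bounds_of_isCompact`), note that `p = R - ∑ x_i²`
is positive on `{q ≥ 0}` for large `R`. The Positivstellensatz gives `t p = 1 + s` with `s, t` in
the preordering generated by `q`. This preordering has one generator, hence lies in the module, and
Wörmann's trick extracts some `R' - ∑ x_i²` from it.

The Positivstellensatz rests on two facts. A preordering without `-1` becomes nonnegative under a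
homomorphism to an ordered field whose polynomials have the intermediate value property
(`exists_polyIVT_of_preordering`): extend it to an ordering, then take a maximal subfield of an
algebraic closure on which the ordering survives. Sign conditions over such a field are realised by
real points (`exists_real_point`), by induction on the number of variables. The inductive step is
elimination in the style of Cohen and Hörmander: the pattern of roots and signs of a finite family
of univariate polynomials is controlled by derivatives, remainders and the signs of coefficients
(`eventually_exists_isMatching`). -/

namespace RealAlgebra

open scoped Polynomial

/-! ### Preorderings and orderings of a commutative ring -/

section Preordering

variable {A : Type*} [CommRing A]

/-- A proper preordering is contained in an ordering. -/
theorem exists_isOrdering_of_preordering (T : Subsemiring A) (hsq : ∀ a, a * a ∈ T)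
    (hT : (-1 : A) ∉ T) : ∃ P : RingPreordering A, P.IsOrdering ∧ ∀ t ∈ T, t ∈ P := by
  let 𝒮 : Set (Set A) := {S | ∃ P : RingPreordering A, (P : Set A) = S}
  let P₀ : RingPreordering A := RingPreordering.mk' (T : Set A) (fun hx hy => T.add_mem hx hy)
    (fun hx hy => T.mul_mem hx hy) (fun x => hsq x) hT
  obtain ⟨M, hTM, hM⟩ := zorn_subset_nonempty 𝒮 (by
    intro c hc hchain hne
    refine ⟨⋃₀ c, ?_, fun s hs => Set.subset_sUnion_of_mem hs⟩
    have key : ∀ x y, x ∈ ⋃₀ c → y ∈ ⋃₀ c → ∃ P : RingPreordering A, (P : Set A) ∈ c ∧ x ∈ P ∧ y ∈ P := by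
      rintro x y ⟨s, hs, hx⟩ ⟨t, ht, hy⟩
      rcases hchain.total hs ht with h | h
      · obtain ⟨P, hP⟩ := hc ht
        exact ⟨P, hP ▸ ht, by rw [← SetLike.mem_coe, hP]; exact h hx,
          by rw [← SetLike.mem_coe, hP]; exact hy⟩
      · obtain ⟨P, hP⟩ := hc hs
        exact ⟨P, hP ▸ hs, by rw [← SetLike.mem_coe, hP]; exact hx,
          by rw [← SetLike.mem_coe, hP]; exact h hy⟩
    refine ⟨RingPreordering.mk' (⋃₀ c) ?_ ?_ ?_ ?_, rfl⟩
    · intro x y hx hy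
      obtain ⟨P, hP, h1, h2⟩ := key x y hx hy
      exact ⟨P, hP, add_mem h1 h2⟩
    · intro x y hx hy
      obtain ⟨P, hP, h1, h2⟩ := key x y hx hy
      exact ⟨P, hP, mul_mem h1 h2⟩
    · intro x
      obtain ⟨s, hs⟩ := hne
      obtain ⟨P, hP⟩ := hc hs
      exact ⟨s, hs, hP ▸ P.mul_self_mem x⟩
    · rintro ⟨s, hs, h⟩
      obtain ⟨P, rfl⟩ := hc hs
      exact P.neg_one_notMem h) (T : Set A) ⟨P₀, rfl⟩
  obtain ⟨⟨P, rfl⟩, hmax⟩ := hM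
  refine ⟨P, ?_, fun t ht => hTM ht⟩
  -- Otherwise `P + P a` would be a strictly larger proper preordering.
  have key : ∀ a, a ∉ P → ∃ s ∈ P, ∃ t ∈ P, -1 = s + t * a := by
    intro a ha
    by_contra hcon
    let S : Set A := {x | ∃ s ∈ P, ∃ t ∈ P, x = s + t * a}
    have hS : S ∈ 𝒮 := by
      refine ⟨RingPreordering.mk' S ?_ ?_ ?_ hcon, rfl⟩
      · rintro x y ⟨s, hs, t, ht, rfl⟩ ⟨s', hs', t', ht', rfl⟩
        exact ⟨s + s', add_mem hs hs', t + t', add_mem ht ht', by ring⟩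
      · rintro x y ⟨s, hs, t, ht, rfl⟩ ⟨s', hs', t', ht', rfl⟩
        exact ⟨s * s' + t * t' * (a * a), add_mem (mul_mem hs hs')
          (mul_mem (mul_mem ht ht') (P.mul_self_mem a)), s * t' + t * s',
          add_mem (mul_mem hs ht') (mul_mem ht hs'), by ring⟩
      · intro x
        exact ⟨x * x, P.mul_self_mem x, 0, zero_mem P, by ring⟩
    exact ha (hmax hS (fun x hx => ⟨x, hx, 0, zero_mem P, by ring⟩)
      ⟨0, zero_mem P, 1, one_mem P, by ring⟩)
  rw [RingPreordering.isOrdering_iff]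
  intro a b hab
  by_contra! hcon
  obtain ⟨s, hs, t, ht, h1⟩ := key a hcon.1
  obtain ⟨s', hs', t', ht', h2⟩ := key b hcon.2
  apply P.neg_one_notMem
  -- Multiply `t a = -(1 + s)` by `t' b = -(1 + s')`.
  have : (-1 : A) = s + s' + s * s' + t * t' * (-(a * b)) := by
    linear_combination h1 * (1 + s') - (t * a) * h2
  rw [this]
  exact add_mem (add_mem (add_mem hs hs') (mul_mem hs hs')) (mul_mem (mul_mem ht ht') hab)

end Preordering

/-! ### Weighted sums of squares in subfields of an algebraically closed field -/

section Cone

variable {A Ω : Type*} [CommRing A] [Field Ω] (ι : A →+* Ω) (P : RingPreordering A)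

/-- The additive monoid generated by the products of images of elements of `P` with squares of
elements of `K`. -/
def weightedSq (K : Set Ω) : AddSubmonoid Ω :=
  AddSubmonoid.closure {x | ∃ c ∈ P, ∃ a ∈ K, x = ι c * (a * a)}

variable {ι P}

theorem weightedSq_mono {K L : Set Ω} (h : K ⊆ L) : weightedSq ι P K ≤ weightedSq ι P L :=
  AddSubmonoid.closure_mono (by rintro x ⟨c, hc, a, ha, rfl⟩; exact ⟨c, hc, a, h ha, rfl⟩)

theorem weightedSq_subset {K : Subfield Ω} (h : ∀ a, ι a ∈ K) {x : Ω}
    (hx : x ∈ weightedSq ι P (K : Set Ω)) : x ∈ K := by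
  have : weightedSq ι P (K : Set Ω) ≤ K.toAddSubgroup.toAddSubmonoid := by
    refine (AddSubmonoid.closure_le).2 ?_
    rintro x ⟨c, hc, a, ha, rfl⟩
    exact K.mul_mem (h c) (K.mul_mem ha ha)
  exact this hx

theorem weightedSq_mul {K : Subfield Ω} {x y : Ω} (hx : x ∈ weightedSq ι P (K : Set Ω))
    (hy : y ∈ weightedSq ι P (K : Set Ω)) : x * y ∈ weightedSq ι P (K : Set Ω) := by
  unfold weightedSq at *
  induction hx using AddSubmonoid.closure_induction with
  | zero => simp
  | add x x' _ _ h h' => rw [add_mul]; exact add_mem h h'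
  | mem x hx =>
    obtain ⟨c, hc, a, ha, rfl⟩ := hx
    induction hy using AddSubmonoid.closure_induction with
    | zero => simp
    | add x x' _ _ h h' => rw [mul_add]; exact add_mem h h'
    | mem y hy =>
      obtain ⟨d, hd, b, hb, rfl⟩ := hy
      refine AddSubmonoid.subset_closure ⟨c * d, mul_mem hc hd, a * b, K.mul_mem ha hb, ?_⟩
      rw [map_mul]; ring

theorem weightedSq_sq {K : Subfield Ω} {x : Ω} (hx : x ∈ K) :
    x * x ∈ weightedSq ι P (K : Set Ω) :=
  AddSubmonoid.subset_closure ⟨1, one_mem P, x, hx, by simp⟩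

theorem weightedSq_coe {K : Subfield Ω} {c : A} (hc : c ∈ P) :
    ι c ∈ weightedSq ι P (K : Set Ω) :=
  AddSubmonoid.subset_closure ⟨c, hc, 1, K.one_mem, by simp⟩

/-- The inverse is `x · (x⁻¹)²`, a product of two elements of the cone. -/
theorem weightedSq_inv {K : Subfield Ω} (h : ∀ a, ι a ∈ K) {x : Ω}
    (hx : x ∈ weightedSq ι P (K : Set Ω)) : x⁻¹ ∈ weightedSq ι P (K : Set Ω) := by
  by_cases h0 : x = 0
  · simp [h0]
  have h1 := weightedSq_mul hx (weightedSq_sq (ι := ι) (P := P)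
    (K.inv_mem (weightedSq_subset h hx)))
  have : x * (x⁻¹ * x⁻¹) = x⁻¹ := by field_simp
  rwa [this] at h1

/-- There is a maximal subfield over which `-1` is not a weighted sum of squares. -/
theorem exists_maximal_subfield (K₀ : Subfield Ω) (h₀ : ∀ a, ι a ∈ K₀)
    (h₁ : (-1 : Ω) ∉ weightedSq ι P (K₀ : Set Ω)) :
    ∃ K : Subfield Ω, (∀ a, ι a ∈ K) ∧ (-1 : Ω) ∉ weightedSq ι P (K : Set Ω) ∧
      ∀ L : Subfield Ω, K ≤ L → (-1 : Ω) ∉ weightedSq ι P (L : Set Ω) → L ≤ K := by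
  obtain ⟨K, hK, hmax⟩ := zorn_le_nonempty₀
    {K : Subfield Ω | (-1 : Ω) ∉ weightedSq ι P (K : Set Ω)} (by
    intro c hc hchain K₁ hK₁
    refine ⟨sSup c, ?_, fun s hs => le_sSup hs⟩
    have hdir : DirectedOn (· ≤ ·) c := hchain.directedOn
    have hne : c.Nonempty := ⟨K₁, hK₁⟩
    -- A weighted sum of squares involves finitely many field elements, which already lie in one
    -- member of the chain.
    have key : ∀ x ∈ weightedSq ι P ((sSup c : Subfield Ω) : Set Ω),
        ∃ K ∈ c, x ∈ weightedSq ι P (K : Set Ω) := by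
      intro x hx
      unfold weightedSq at hx
      induction hx using AddSubmonoid.closure_induction with
      | zero => exact ⟨K₁, hK₁, zero_mem _⟩
      | add x y _ _ hx hy =>
        obtain ⟨K, hK, hx⟩ := hx
        obtain ⟨K', hK', hy⟩ := hy
        obtain ⟨L, hL, h, h'⟩ := hdir K hK K' hK'
        exact ⟨L, hL, add_mem (weightedSq_mono h hx) (weightedSq_mono h' hy)⟩
      | mem x hx =>
        obtain ⟨d, hd, a, ha, rfl⟩ := hx
        obtain ⟨K, hK, ha⟩ := (Subfield.mem_sSup_of_directedOn hne hdir).1 ha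
        exact ⟨K, hK, AddSubmonoid.subset_closure ⟨d, hd, a, ha, rfl⟩⟩
    intro h
    obtain ⟨K, hK, h⟩ := key _ h
    exact hc hK h) K₀ h₁
  exact ⟨K, fun a => hK (h₀ a), hmax.1, fun L hKL hL => hmax.2 hL hKL⟩

/-- If `K` is maximal without `-1` being a weighted sum of squares, every irreducible polynomial
over `K` without a root in `K` divides `1 + σ` for a weighted sum of squares `σ` of polynomials of
smaller degree. -/
theorem dvd_one_add_of_irreducible [IsAlgClosed Ω] {K : Subfield Ω} (h : ∀ a, ι a ∈ K)
    (hmax : ∀ L : Subfield Ω, K ≤ L → (-1 : Ω) ∉ weightedSq ι P (L : Set Ω) → L ≤ K)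
    {p : K[X]} (hp : Irreducible p) (hroot : ∀ x, p.eval x ≠ 0) :
    ∃ σ ∈ AddSubmonoid.closure {x : K[X] | ∃ c ∈ P, ∃ f : K[X], f.degree < p.degree ∧
      x = Polynomial.C (⟨ι c, h c⟩ : K) * (f * f)}, p ∣ 1 + σ := by
  have : Fact (Irreducible p) := ⟨hp⟩
  obtain ⟨r, hr⟩ := IsAlgClosed.exists_aeval_eq_zero Ω p
    (fun h0 => by
      have := Polynomial.degree_pos_of_irreducible hp
      exact this.ne' h0)
  let φ : AdjoinRoot p →+* Ω := AdjoinRoot.lift K.subtype r (by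
    rw [Polynomial.aeval_def] at hr; exact hr)
  have hφ : ∀ f : K[X], φ (AdjoinRoot.mk p f) = f.eval₂ K.subtype r := fun f =>
    AdjoinRoot.lift_mk _ f
  have hKL : K ≤ φ.fieldRange := fun x hx => ⟨AdjoinRoot.mk p (Polynomial.C ⟨x, hx⟩), by
    rw [hφ]; simp⟩
  have hr' : r ∉ K := by
    intro hrK
    apply hroot ⟨r, hrK⟩
    apply Subtype.ext
    have : (K.subtype) (p.eval ⟨r, hrK⟩) = p.eval₂ K.subtype r := by
      rw [← Polynomial.eval₂_at_apply]; rfl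
    have h2 : p.eval₂ K.subtype r = 0 := hr
    rw [h2] at this
    simpa using this
  -- The field `K(r)` is strictly larger than `K`, so maximality makes `-1` a weighted sum of
  -- squares there. Lifting this identity to `K[X]` gives `σ`.
  have hneg : (-1 : Ω) ∈ weightedSq ι P (φ.fieldRange : Set Ω) := by
    by_contra hcon
    exact hr' (hmax _ hKL hcon ⟨AdjoinRoot.mk p Polynomial.X, by rw [hφ]; simp⟩)
  have key : ∀ x ∈ weightedSq ι P (φ.fieldRange : Set Ω),
      ∃ σ ∈ AddSubmonoid.closure {x : K[X] | ∃ c ∈ P, ∃ f : K[X], f.degree < p.degree ∧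
      x = Polynomial.C (⟨ι c, h c⟩ : K) * (f * f)}, φ (AdjoinRoot.mk p σ) = x := by
    intro x hx
    unfold weightedSq at hx
    induction hx using AddSubmonoid.closure_induction with
    | zero => exact ⟨0, zero_mem _, by simp⟩
    | add x y _ _ hx hy =>
      obtain ⟨σ, hσ, rfl⟩ := hx
      obtain ⟨τ, hτ, rfl⟩ := hy
      exact ⟨σ + τ, add_mem hσ hτ, by simp⟩
    | mem x hx =>
      obtain ⟨c, hc, a, ⟨a, rfl⟩, rfl⟩ := hx
      obtain ⟨f, rfl⟩ := AdjoinRoot.mk_surjective a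
      -- Reducing `f` modulo `p` keeps its value at `r` and brings its degree below that of `p`.
      refine ⟨_, AddSubmonoid.subset_closure ⟨c, hc, f % p, ?_, rfl⟩, ?_⟩
      · exact EuclideanDomain.mod_lt f hp.ne_zero
      · have hf : AdjoinRoot.mk p (f % p) = AdjoinRoot.mk p f := by
          rw [AdjoinRoot.mk_eq_mk]
          exact ⟨-(f / p), by linear_combination EuclideanDomain.mod_add_div f p⟩
        rw [map_mul, map_mul, map_mul, map_mul, hf, hφ]
        simp
  obtain ⟨σ, hσ, hσ'⟩ := key _ hneg
  refine ⟨σ, hσ, ?_⟩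
  rw [← AdjoinRoot.mk_eq_zero]
  apply φ.injective
  rw [map_add, map_add, hσ']
  simp

end Cone

end RealAlgebra

/-! ### Ordered fields with the intermediate value property for polynomials -/

namespace RealAlgebra

open scoped Polynomial

/-- The intermediate value property for polynomials over an ordered field. -/
def PolyIVT (K : Type*) [Field K] [LinearOrder K] : Prop :=
  ∀ (p : K[X]) (a b : K), a < b → p.eval a * p.eval b < 0 → ∃ c, a < c ∧ c < b ∧ p.eval c = 0

theorem polyIVT_real : PolyIVT ℝ := by
  intro p a b hab h
  have hc : ContinuousOn (fun x => p.eval x) (Set.Icc a b) := p.continuous.continuousOn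
  rcases mul_neg_iff.1 h with ⟨h1, h2⟩ | ⟨h1, h2⟩
  · obtain ⟨c, hc, h0⟩ := intermediate_value_Ioo' hab.le hc ⟨h2, h1⟩
    exact ⟨c, hc.1, hc.2, h0⟩
  · obtain ⟨c, hc, h0⟩ := intermediate_value_Ioo hab.le hc ⟨h1, h2⟩
    exact ⟨c, hc.1, hc.2, h0⟩

/-- Induction on the degree. If `p` factors, one factor changes sign; if `p` is irreducible with a
root, it is linear. An irreducible `p` without roots cannot change sign: in `p g = 1 + σ` the right
side is positive, so `g` changes sign too, and the degree bound on `σ` makes `deg g < deg p`. A root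
of `g` then contradicts `1 + σ > 0`. -/
theorem polyIVT_of_irreducible {K : Type*} [Field K] [LinearOrder K] [IsStrictOrderedRing K]
    (H : ∀ p : K[X], Irreducible p → (∀ x, p.eval x ≠ 0) →
      ∃ σ : K[X], p ∣ 1 + σ ∧ (∀ x, 0 ≤ σ.eval x) ∧ σ.natDegree ≤ 2 * (p.natDegree - 1)) :
    PolyIVT K := by
  have main : ∀ d : ℕ, ∀ p : K[X], p.natDegree = d → ∀ a b : K, a < b →
      p.eval a * p.eval b < 0 → ∃ c, a < c ∧ c < b ∧ p.eval c = 0 := by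
    intro d
    induction d using Nat.strong_induction_on with
    | _ d ih =>
    intro p hpd a b hab hsign
    have hp0 : p ≠ 0 := by rintro rfl; simp at hsign
    have hd : 0 < p.natDegree := by
      rcases Nat.eq_zero_or_pos p.natDegree with h | h
      · rw [Polynomial.eq_C_of_natDegree_eq_zero h] at hsign
        simp only [Polynomial.eval_C] at hsign
        nlinarith [mul_self_nonneg (p.coeff 0)]
      · exact h
    have hunit : ¬ IsUnit p := fun hu => by
      have := Polynomial.natDegree_eq_zero_of_isUnit hu; omega
    by_cases hirr : Irreducible p
    · by_cases hroot : ∃ x, p.eval x = 0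
      · obtain ⟨x, hx⟩ := hroot
        obtain ⟨q, hq⟩ := Polynomial.dvd_iff_isRoot.2 hx
        have hqu : IsUnit q := by
          rcases hirr.isUnit_or_isUnit hq with h | h
          · exact absurd h (Polynomial.not_isUnit_X_sub_C x)
          · exact h
        obtain ⟨u, hu, hu'⟩ := Polynomial.isUnit_iff.1 hqu
        rw [hq, ← hu'] at hsign
        simp only [Polynomial.eval_mul, Polynomial.eval_sub, Polynomial.eval_X,
          Polynomial.eval_C] at hsign
        have hu2 : 0 < u * u := by
          have := hu.ne_zero
          exact mul_self_pos.2 this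
        have h3 : (a - x) * (b - x) < 0 := by
          by_contra hcon
          push Not at hcon
          nlinarith [mul_nonneg hcon hu2.le]
        refine ⟨x, ?_, ?_, hx⟩
        · by_contra hcon
          push Not at hcon
          nlinarith
        · by_contra hcon
          push Not at hcon
          nlinarith
      · push Not at hroot
        obtain ⟨σ, ⟨g, hg⟩, hpos, hdeg⟩ := H p hirr hroot
        have hne : (1 + σ) ≠ 0 := by
          intro h0
          have := congrArg (Polynomial.eval a) h0
          simp at this
          linarith [hpos a]
        have hg0 : g ≠ 0 := by rintro rfl; simp at hg; exact hne hg
        have hdegg : g.natDegree < d := by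
          have h1 : (1 + σ).natDegree ≤ 2 * (p.natDegree - 1) :=
            (Polynomial.natDegree_add_le _ _).trans (by simpa using hdeg)
          rw [hg, Polynomial.natDegree_mul hp0 hg0] at h1
          omega
        have hev : ∀ x, p.eval x * g.eval x = 1 + σ.eval x := fun x => by
          rw [← Polynomial.eval_mul, ← hg]; simp
        have hs : g.eval a * g.eval b < 0 := by
          have h1 : 0 < (p.eval a * p.eval b) * (g.eval a * g.eval b) := by
            have : (p.eval a * p.eval b) * (g.eval a * g.eval b) =
                (1 + σ.eval a) * (1 + σ.eval b) := by rw [← hev, ← hev]; ring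
            rw [this]
            have := hpos a
            have := hpos b
            positivity
          exact (neg_iff_neg_of_mul_pos h1).1 hsign
        obtain ⟨c, _, _, h0⟩ := ih _ hdegg g rfl a b hab hs
        have := hev c
        rw [h0, mul_zero] at this
        linarith [hpos c]
    · rw [irreducible_iff] at hirr
      push Not at hirr
      obtain ⟨q, r, hqr, hq, hr⟩ := hirr hunit
      have hq0 : q ≠ 0 := by rintro rfl; simp at hqr; exact hp0 hqr
      have hr0 : r ≠ 0 := by rintro rfl; simp at hqr; exact hp0 hqr
      have hdq : 0 < q.natDegree := by
        rw [Polynomial.natDegree_pos_iff_degree_pos]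
        exact Polynomial.degree_pos_of_ne_zero_of_nonunit hq0 hq
      have hdr : 0 < r.natDegree := by
        rw [Polynomial.natDegree_pos_iff_degree_pos]
        exact Polynomial.degree_pos_of_ne_zero_of_nonunit hr0 hr
      have hdd : q.natDegree + r.natDegree = d := by
        rw [← hpd, hqr, Polynomial.natDegree_mul hq0 hr0]
      have hprod : (q.eval a * q.eval b) * (r.eval a * r.eval b) < 0 := by
        rw [hqr] at hsign
        simp only [Polynomial.eval_mul] at hsign
        nlinarith
      rcases mul_neg_iff.1 hprod with ⟨_, h⟩ | ⟨h, _⟩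
      · obtain ⟨c, h1, h2, h3⟩ := ih _ (by omega) r rfl a b hab h
        exact ⟨c, h1, h2, by rw [hqr]; simp [h3]⟩
      · obtain ⟨c, h1, h2, h3⟩ := ih _ (by omega) q rfl a b hab h
        exact ⟨c, h1, h2, by rw [hqr]; simp [h3]⟩
  exact fun p a b => main _ p rfl a b

universe u

/-- A ring homomorphism to an algebraically closed field, sending an ordering to weights over
which `-1` is not a sum of squares, gives a homomorphism to an ordered field with the intermediate
value property for polynomials. -/
theorem exists_polyIVT_of_subfield {A : Type u} [CommRing A] {Ω : Type u} [Field Ω]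
    [IsAlgClosed Ω] (ι : A →+* Ω) (P : RingPreordering A) (K₀ : Subfield Ω) (hK₀ : ∀ a, ι a ∈ K₀)
    (hneg₀ : (-1 : Ω) ∉ weightedSq ι P (K₀ : Set Ω)) :
    ∃ (K : Type u) (_ : Field K) (_ : LinearOrder K) (_ : IsStrictOrderedRing K) (ψ : A →+* K),
      PolyIVT K ∧ ∀ t ∈ P, 0 ≤ ψ t := by
  obtain ⟨K, hιK, hneg, hmax⟩ := exists_maximal_subfield K₀ hK₀ hneg₀
  have hdvd := fun {p : K[X]} (hp : Irreducible p) (hr : ∀ x, p.eval x ≠ 0) =>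
    dvd_one_add_of_irreducible (P := P) hιK hmax hp hr
  -- The cone is total: for a nonsquare `k`, apply the divisibility property to the irreducible
  -- polynomial `X² - k`.
  have htotal : ∀ k : K, (k : Ω) ∈ weightedSq ι P (K : Set Ω) ∨
      (-k : Ω) ∈ weightedSq ι P (K : Set Ω) := by
    intro k
    by_cases hk : ∃ x : K, x * x = k
    · obtain ⟨x, rfl⟩ := hk
      exact Or.inl (weightedSq_sq x.2)
    right
    push Not at hk
    let p : K[X] := Polynomial.X ^ 2 - Polynomial.C k
    have hroot : ∀ x, p.eval x ≠ 0 := by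
      intro x hx
      apply hk x
      simp only [p, Polynomial.eval_sub, Polynomial.eval_pow, Polynomial.eval_X,
        Polynomial.eval_C] at hx
      linear_combination hx
    have hdeg : p.natDegree = 2 := by simp [p]
    have hmon : p.Monic := Polynomial.monic_X_pow_sub_C k two_ne_zero
    have hirr : Irreducible p := by
      rw [hmon.irreducible_iff_roots_eq_zero_of_degree_le_three (by omega) (by omega)]
      rw [Multiset.eq_zero_iff_forall_notMem]
      intro x hx
      exact hroot x (Polynomial.isRoot_of_mem_roots hx)
    obtain ⟨σ, hσ, hpσ⟩ := hdvd hirr hroot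
    have hform : ∃ u v w : K, (u : Ω) ∈ weightedSq ι P (K : Set Ω) ∧
        (v : Ω) ∈ weightedSq ι P (K : Set Ω) ∧
        σ = Polynomial.C u + Polynomial.C v * Polynomial.X ^ 2 + Polynomial.C w * Polynomial.X := by
      clear hpσ
      induction hσ using AddSubmonoid.closure_induction with
      | zero => exact ⟨0, 0, 0, zero_mem _, zero_mem _, by simp⟩
      | add x y _ _ hx hy =>
        obtain ⟨u, v, w, hu, hv, rfl⟩ := hx
        obtain ⟨u', v', w', hu', hv', rfl⟩ := hy
        refine ⟨u + u', v + v', w + w', add_mem hu hu', add_mem hv hv', ?_⟩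
        simp only [map_add]; ring
      | mem x hx =>
        obtain ⟨c, hc, f, hf, rfl⟩ := hx
        have hf1 : f.natDegree ≤ 1 := by
          rw [Polynomial.degree_eq_natDegree hirr.ne_zero, hdeg] at hf
          by_cases hf0 : f = 0
          · simp [hf0]
          rw [Polynomial.degree_eq_natDegree hf0] at hf
          have : f.natDegree < 2 := by exact_mod_cast hf
          omega
        obtain ⟨b, a, rfl⟩ := Polynomial.exists_eq_X_add_C_of_natDegree_le_one hf1
        refine ⟨⟨ι c, hιK c⟩ * (a * a), ⟨ι c, hιK c⟩ * (b * b), ⟨ι c, hιK c⟩ * (2 * a * b),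
          AddSubmonoid.subset_closure ⟨c, hc, a, a.2, rfl⟩,
          AddSubmonoid.subset_closure ⟨c, hc, b, b.2, rfl⟩, ?_⟩
        simp only [map_mul, map_ofNat]
        ring
    obtain ⟨u, v, w, hu, hv, rfl⟩ := hform
    -- Replacing `X²` by `k` in `1 + σ` leaves a linear multiple of `p`, hence zero. Its constant
    -- term gives `-k = (1 + u) / v`, where `v ≠ 0` because otherwise `-1 = u` would be in the cone.
    have hrem : p ∣ Polynomial.C w * Polynomial.X + Polynomial.C (1 + u + k * v) := by
      have : Polynomial.C w * Polynomial.X + Polynomial.C (1 + u + k * v) =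
          1 + (Polynomial.C u + Polynomial.C v * Polynomial.X ^ 2 + Polynomial.C w * Polynomial.X)
          - p * Polynomial.C v := by
        simp only [p, map_add, map_mul, map_one]; ring
      rw [this]
      exact dvd_sub hpσ (dvd_mul_right _ _)
    have hzero := Polynomial.eq_zero_of_dvd_of_natDegree_lt hrem (by
      rw [hdeg]; exact lt_of_le_of_lt Polynomial.natDegree_linear_le (by norm_num))
    have h0 : 1 + u + k * v = 0 := by
      have := congrArg (Polynomial.eval 0) hzero
      simpa using this
    have h0' : (1 : Ω) + u + k * v = 0 := by exact_mod_cast congrArg (Subtype.val) h0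
    by_cases hv0 : (v : Ω) = 0
    · exfalso
      apply hneg
      rw [hv0, mul_zero, add_zero] at h0'
      have : (-1 : Ω) = u := by linear_combination -h0'
      rwa [this]
    have : (-k : Ω) = (1 + u) * (v : Ω)⁻¹ := by
      field_simp
      linear_combination -h0'
    rw [this]
    refine weightedSq_mul (add_mem ?_ hu) (weightedSq_inv hιK hv)
    simpa using weightedSq_sq (ι := ι) (P := P) K.one_mem
  let Cn : RingCone K :=
    { carrier := {k | (k : Ω) ∈ weightedSq ι P (K : Set Ω)}
      mul_mem' := fun {a b} ha hb => weightedSq_mul ha hb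
      one_mem' := by simpa using weightedSq_sq (ι := ι) (P := P) K.one_mem
      add_mem' := fun {a b} ha hb => (weightedSq ι P (K : Set Ω)).add_mem ha hb
      zero_mem' := zero_mem (weightedSq ι P (K : Set Ω))
      eq_zero_of_mem_of_neg_mem' := by
        intro a ha hb
        by_contra h0
        apply hneg
        have h1 : (a : Ω) ≠ 0 := fun h => h0 (Subtype.ext h)
        have h2 := weightedSq_mul (weightedSq_inv hιK ha) hb
        -- If `a` and `-a` were both in the cone with `a ≠ 0`, then so would be `a⁻¹ · (-a) = -1`.
        have h3 : (a : Ω)⁻¹ * ((-a : K) : Ω) = -1 := by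
          push_cast; field_simp
        rwa [h3] at h2 }
  have hCn : ∀ k : K, k ∈ Cn ↔ (k : Ω) ∈ weightedSq ι P (K : Set Ω) := fun _ => Iff.rfl
  have : HasMemOrNegMem Cn := ⟨fun k => htotal k⟩
  classical
  let LO : LinearOrder K := LinearOrder.mkOfAddGroupCone Cn
  have OR : IsOrderedRing K := IsOrderedRing.mkOfCone Cn
  have SOR : IsStrictOrderedRing K := IsOrderedRing.toIsStrictOrderedRing K
  have hnn : ∀ k : K, 0 ≤ k ↔ (k : Ω) ∈ weightedSq ι P (K : Set Ω) := by
    intro k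
    rw [← hCn]
    change k - 0 ∈ Cn ↔ _
    rw [sub_zero]
  refine ⟨K, inferInstance, LO, SOR, ι.codRestrict K hιK, polyIVT_of_irreducible ?_, ?_⟩
  · intro p hp hr
    obtain ⟨σ, hσ, hpσ⟩ := hdvd hp hr
    refine ⟨σ, hpσ, ?_, ?_⟩
    · intro x
      clear hpσ
      induction hσ using AddSubmonoid.closure_induction with
      | zero => simp
      | add x y _ _ hx hy => rw [Polynomial.eval_add]; exact add_nonneg hx hy
      | mem y hy =>
        obtain ⟨c, hc, f, _, rfl⟩ := hy
        simp only [Polynomial.eval_mul, Polynomial.eval_C]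
        exact mul_nonneg ((hnn _).2 (weightedSq_coe hc)) (mul_self_nonneg _)
    · clear hpσ
      induction hσ using AddSubmonoid.closure_induction with
      | zero => simp
      | add x y _ _ hx hy => exact (Polynomial.natDegree_add_le _ _).trans (max_le hx hy)
      | mem y hy =>
        obtain ⟨c, hc, f, hf, rfl⟩ := hy
        refine (Polynomial.natDegree_C_mul_le _ _).trans (Polynomial.natDegree_mul_le.trans ?_)
        have hdp := Polynomial.degree_pos_of_irreducible hp
        have : f.natDegree < p.natDegree := by
          by_cases hf0 : f = 0
          · rw [hf0, Polynomial.natDegree_zero]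
            exact Polynomial.natDegree_pos_iff_degree_pos.2 hdp
          · exact Polynomial.natDegree_lt_natDegree hf0 hf
        omega
  · intro t ht
    exact (hnn _).2 (weightedSq_coe ht)

/-- A proper preordering is nonnegative for some homomorphism to an ordered field with the
intermediate value property for polynomials. -/
theorem exists_polyIVT_of_preordering {A : Type u} [CommRing A] (T : Subsemiring A)
    (hsq : ∀ a, a * a ∈ T) (hT : (-1 : A) ∉ T) :
    ∃ (K : Type u) (_ : Field K) (_ : LinearOrder K) (_ : IsStrictOrderedRing K) (ψ : A →+* K),
      PolyIVT K ∧ ∀ t ∈ T, 0 ≤ ψ t := by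
  obtain ⟨P, hP, hTP⟩ := exists_isOrdering_of_preordering T hsq hT
  have hprime : P.support.IsPrime := inferInstance
  let F := FractionRing (A ⧸ P.support)
  let Ω := AlgebraicClosure F
  let ι₀ : A →+* F := (algebraMap (A ⧸ P.support) F).comp (Ideal.Quotient.mk P.support)
  let ι : A →+* Ω := (algebraMap F Ω).comp ι₀
  have hιz : ∀ a, ι a = 0 ↔ a ∈ P ∧ -a ∈ P := by
    intro a
    have h1 : ι a = 0 ↔ Ideal.Quotient.mk P.support a = 0 := by
      simp [ι, ι₀, F]
    rw [h1, Ideal.Quotient.eq_zero_iff_mem, RingPreordering.mem_support]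
  let K₀ : Subfield Ω := (algebraMap F Ω).fieldRange
  have hK₀ : ∀ a, ι a ∈ K₀ := fun a => ⟨ι₀ a, rfl⟩
  -- Clearing denominators by squares: over the residue field every weighted sum of squares is `c /
  -- b²` with `c ∈ P`.
  have hcone : ∀ x ∈ weightedSq ι P (K₀ : Set Ω), ∃ c ∈ P, ∃ b, ι b ≠ 0 ∧
      ι (b * b) * x = ι c := by
    intro x hx
    unfold weightedSq at hx
    induction hx using AddSubmonoid.closure_induction with
    | zero => exact ⟨0, zero_mem P, 1, by simp, by simp⟩
    | add x y _ _ hx hy =>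
      obtain ⟨c, hc, b, hb, h⟩ := hx
      obtain ⟨c', hc', b', hb', h'⟩ := hy
      refine ⟨b' * b' * c + b * b * c', add_mem (mul_mem (P.mul_self_mem _) hc)
        (mul_mem (P.mul_self_mem _) hc'), b * b', by rw [map_mul]; exact mul_ne_zero hb hb', ?_⟩
      simp only [map_mul, map_add] at h h' ⊢
      linear_combination (ι b' * ι b') * h + (ι b * ι b) * h'
    | mem x hx =>
      obtain ⟨c, hc, a, ⟨a, rfl⟩, rfl⟩ := hx
      obtain ⟨n, d, hd, rfl⟩ := IsFractionRing.div_surjective (A := A ⧸ P.support) a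
      obtain ⟨n, rfl⟩ := Ideal.Quotient.mk_surjective n
      obtain ⟨d, rfl⟩ := Ideal.Quotient.mk_surjective d
      have hdn : ι d ≠ 0 := by
        have := nonZeroDivisors.ne_zero hd
        simpa [ι, ι₀, F] using this
      refine ⟨c * (n * n), mul_mem hc (P.mul_self_mem n), d, hdn, ?_⟩
      have hn : (algebraMap F Ω) (algebraMap (A ⧸ P.support) F (Ideal.Quotient.mk P.support n) /
          algebraMap (A ⧸ P.support) F (Ideal.Quotient.mk P.support d)) = ι n / ι d := by
        rw [map_div₀]; rfl
      rw [hn]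
      simp only [map_mul]
      have haux : ∀ x y z : Ω, z ≠ 0 → z * z * (x * (y / z * (y / z))) = x * (y * y) := by
        intro x y z hz
        rw [div_mul_div_comm, mul_left_comm, mul_div_cancel₀ _ (mul_ne_zero hz hz)]
      exact haux _ _ _ hdn
  have hneg₀ : (-1 : Ω) ∉ weightedSq ι P (K₀ : Set Ω) := by
    intro h
    obtain ⟨c, hc, b, hb, h⟩ := hcone _ h
    have h0 : ι (c + b * b) = 0 := by
      rw [map_add, ← h]; ring
    obtain ⟨_, h2⟩ := (hιz _).1 h0
    -- From `-b² = c` modulo the support, both `b²` and `-b²` lie in `P`, so `b` is in the support,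
    -- contrary to `ι b ≠ 0`.
    have h3 : -(b * b) ∈ P := by
      have : -(b * b) = c + -(c + b * b) := by ring
      rw [this]; exact add_mem hc h2
    have h4 : ι (b * b) = 0 := (hιz _).2 ⟨P.mul_self_mem b, h3⟩
    rw [map_mul] at h4
    exact hb (mul_self_eq_zero.1 h4)
  obtain ⟨K, h1, h2, h3, ψ, h4, h5⟩ := exists_polyIVT_of_subfield ι P K₀ hK₀ hneg₀
  exact ⟨K, h1, h2, h3, ψ, h4, fun t ht => h5 t (hTP t ht)⟩

end RealAlgebra

/-! ### Rolle, mean values and signs at infinity -/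

namespace RealAlgebra

open scoped Polynomial

variable {K : Type*} [Field K] [LinearOrder K] [IsStrictOrderedRing K]

theorem PolyIVT.sign_eq (hK : PolyIVT K) {p : K[X]} {a b : K} (hab : a ≤ b)
    (h : ∀ x, a ≤ x → x ≤ b → p.eval x ≠ 0) :
    SignType.sign (p.eval a) = SignType.sign (p.eval b) := by
  rcases hab.eq_or_lt with rfl | hab'
  · rfl
  have ha := h a le_rfl hab
  have hb := h b hab le_rfl
  have hpos : 0 < p.eval a * p.eval b := by
    by_contra hcon
    push Not at hcon
    obtain ⟨c, h1, h2, h3⟩ := hK p a b hab' (lt_of_le_of_ne hcon (mul_ne_zero ha hb))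
    exact h c h1.le h2.le h3
  rcases pos_and_pos_or_neg_and_neg_of_mul_pos hpos with ⟨h1, h2⟩ | ⟨h1, h2⟩
  · rw [sign_pos h1, sign_pos h2]
  · rw [sign_neg h1, sign_neg h2]

/-- Rolle between consecutive roots, done algebraically. With `p = (X - a)^(m+1) (X - b)^(n+1) g`,
the derivative is `(X - a)^m (X - b)^n D`, where `D(a) = (m+1)(a-b)g(a)` and `D(b) =
(n+1)(b-a)g(b)`. Since `g` has no root in `[a, b]`, these have opposite signs. -/
theorem PolyIVT.exists_derivative_eq_zero_of_roots (hK : PolyIVT K) {p : K[X]} {a b : K}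
    (hab : a < b) (hp : p ≠ 0) (ha : p.eval a = 0) (hb : p.eval b = 0)
    (h : ∀ x, a < x → x < b → p.eval x ≠ 0) :
    ∃ c, a < c ∧ c < b ∧ p.derivative.eval c = 0 := by
  obtain ⟨q, hq, hqa⟩ := Polynomial.exists_eq_pow_rootMultiplicity_mul_and_not_dvd p hp a
  have hm : p.rootMultiplicity a ≠ 0 := (Polynomial.rootMultiplicity_pos hp).2 ha |>.ne'
  obtain ⟨m, hm⟩ := Nat.exists_eq_succ_of_ne_zero hm
  rw [hm] at hq
  have hq0 : q ≠ 0 := by rintro rfl; simp at hqa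
  have hqb : q.eval b = 0 := by
    have := hb
    rw [hq] at this
    simpa [sub_ne_zero.2 hab.ne'] using this
  obtain ⟨g, hg, hgb⟩ := Polynomial.exists_eq_pow_rootMultiplicity_mul_and_not_dvd q hq0 b
  have hn : q.rootMultiplicity b ≠ 0 := (Polynomial.rootMultiplicity_pos hq0).2 hqb |>.ne'
  obtain ⟨n, hn⟩ := Nat.exists_eq_succ_of_ne_zero hn
  rw [hn] at hg
  rw [Polynomial.dvd_iff_isRoot, Polynomial.IsRoot.def] at hqa hgb
  have hga : g.eval a ≠ 0 := by
    intro h0; apply hqa; rw [hg]; simp [h0]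
  have hpg : p = (Polynomial.X - Polynomial.C a) ^ (m + 1) *
      ((Polynomial.X - Polynomial.C b) ^ (n + 1) * g) := by
    rw [← Nat.succ_eq_add_one, ← Nat.succ_eq_add_one, ← hg, ← hq]
  have hpos : 0 < g.eval a * g.eval b := by
    by_contra hcon
    push Not at hcon
    obtain ⟨c, h1, h2, h3⟩ := hK g a b hab (lt_of_le_of_ne hcon (mul_ne_zero hga hgb))
    exact h c h1 h2 (by rw [hpg]; simp [h3])
  let D : K[X] := Polynomial.C ((m : K) + 1) * (Polynomial.X - Polynomial.C b) * g +
    Polynomial.C ((n : K) + 1) * (Polynomial.X - Polynomial.C a) * g +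
    (Polynomial.X - Polynomial.C a) * (Polynomial.X - Polynomial.C b) * g.derivative
  have hD : p.derivative = (Polynomial.X - Polynomial.C a) ^ m *
      (Polynomial.X - Polynomial.C b) ^ n * D := by
    rw [hpg]
    simp only [Polynomial.derivative_mul, Polynomial.derivative_X_sub_C_pow, D, Nat.cast_add,
      Nat.cast_one, Nat.add_sub_cancel, map_add, map_natCast, map_one]
    ring
  have hDs : D.eval a * D.eval b < 0 := by
    have : D.eval a * D.eval b =
        -(((m : K) + 1) * ((n : K) + 1) * ((b - a) * (b - a)) * (g.eval a * g.eval b)) := by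
      simp only [D, Polynomial.eval_add, Polynomial.eval_mul, Polynomial.eval_sub,
        Polynomial.eval_X, Polynomial.eval_C]
      ring
    rw [this, neg_lt_zero]
    have : 0 < b - a := sub_pos.2 hab
    positivity
  obtain ⟨c, h1, h2, h3⟩ := hK D a b hab hDs
  exact ⟨c, h1, h2, by rw [hD]; simp [h3]⟩

theorem PolyIVT.exists_derivative_eq_zero (hK : PolyIVT K) {p : K[X]} {a b : K}
    (hab : a < b) (h : p.eval a = p.eval b) :
    ∃ c, a < c ∧ c < b ∧ p.derivative.eval c = 0 := by
  let q := p - Polynomial.C (p.eval a)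
  have hqd : q.derivative = p.derivative := by simp [q]
  by_cases hq : q = 0
  · obtain ⟨c, h1, h2⟩ := exists_between hab
    refine ⟨c, h1, h2, ?_⟩
    rw [← hqd, hq]; simp
  have hqa : q.eval a = 0 := by simp [q]
  have hqb : q.eval b = 0 := by simp [q, h]
  -- The smallest root beyond `a` gives an interval with no root in its interior.
  let s := q.roots.toFinset.filter (fun x => a < x)
  have hs : ∀ x, x ∈ s ↔ q.eval x = 0 ∧ a < x := by
    intro x
    simp [s, hq]
  have hne : s.Nonempty := ⟨b, (hs b).2 ⟨hqb, hab⟩⟩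
  obtain ⟨h1, h2⟩ := (hs _).1 (s.min'_mem hne)
  obtain ⟨c, hc1, hc2, hc3⟩ := hK.exists_derivative_eq_zero_of_roots h2 hq hqa h1
    (fun x hx1 hx2 hx3 => absurd (s.min'_le x ((hs x).2 ⟨hx3, hx1⟩)) (not_le.2 hx2))
  exact ⟨c, hc1, hc2.trans_le (s.min'_le b ((hs b).2 ⟨hqb, hab⟩)), hqd ▸ hc3⟩

/-- The mean value theorem for polynomials. -/
theorem PolyIVT.exists_derivative_eq_slope (hK : PolyIVT K) (p : K[X]) {a b : K} (hab : a < b) :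
    ∃ c, a < c ∧ c < b ∧ p.eval b - p.eval a = p.derivative.eval c * (b - a) := by
  have hba : b - a ≠ 0 := (sub_pos.2 hab).ne'
  let q := p - Polynomial.C ((p.eval b - p.eval a) / (b - a)) * Polynomial.X
  obtain ⟨c, h1, h2, h3⟩ := hK.exists_derivative_eq_zero (p := q) hab (by
    simp only [q, Polynomial.eval_sub, Polynomial.eval_mul, Polynomial.eval_C, Polynomial.eval_X]
    field_simp; ring)
  refine ⟨c, h1, h2, ?_⟩
  simp only [q, Polynomial.derivative_sub, Polynomial.derivative_C_mul, Polynomial.derivative_X,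
    mul_one, Polynomial.eval_sub, Polynomial.eval_C] at h3
  rw [sub_eq_zero.1 h3]
  field_simp

theorem PolyIVT.eval_lt_eval (hK : PolyIVT K) {p : K[X]} {a b : K} (hab : a < b)
    (h : ∀ x, a < x → x < b → 0 < p.derivative.eval x) : p.eval a < p.eval b := by
  obtain ⟨c, h1, h2, h3⟩ := hK.exists_derivative_eq_slope p hab
  have := mul_pos (h c h1 h2) (sub_pos.2 hab)
  linarith

open Filter


theorem exists_le_eval_of_leadingCoeff_pos {p : K[X]} (hd : 0 < p.degree)
    (hp : 0 < p.leadingCoeff) : ∃ B, ∀ y, B ≤ y → 1 ≤ p.eval y := by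
  -- The bound is made arbitrary for the induction, since adding a constant shifts it.
  suffices H : ∀ (p : K[X]), 0 < p.degree → 0 < p.leadingCoeff → ∀ M, ∃ B, ∀ y, B ≤ y → M ≤ p.eval y
    from H p hd hp 1
  clear hd hp p
  intro p hd
  refine Polynomial.degree_pos_induction_on
    (P := fun p => 0 < p.leadingCoeff → ∀ M, ∃ B, ∀ y, B ≤ y → M ≤ p.eval y) p hd ?_ ?_ ?_
  · intro a ha hpos M
    rw [Polynomial.leadingCoeff_mul_X, Polynomial.leadingCoeff_C] at hpos
    refine ⟨M / a, fun y hy => ?_⟩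
    simp only [Polynomial.eval_mul, Polynomial.eval_C, Polynomial.eval_X]
    rw [div_le_iff₀ hpos] at hy
    linarith
  · intro p _ ih hpos M
    rw [Polynomial.leadingCoeff_mul_X] at hpos
    obtain ⟨B, hB⟩ := ih hpos 1
    refine ⟨max B (max M 0), fun y hy => ?_⟩
    simp only [max_le_iff] at hy
    simp only [Polynomial.eval_mul, Polynomial.eval_X]
    nlinarith [hB y hy.1]
  · intro p a hdp ih hpos M
    rw [Polynomial.leadingCoeff_add_of_degree_lt' (by
      exact lt_of_le_of_lt Polynomial.degree_C_le hdp)] at hpos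
    obtain ⟨B, hB⟩ := ih hpos (M - a)
    refine ⟨B, fun y hy => ?_⟩
    simp only [Polynomial.eval_add, Polynomial.eval_C]
    linarith [hB y hy]

theorem eventually_sign_eval_atTop (p : K[X]) :
    ∀ᶠ y in atTop, SignType.sign (p.eval y) = SignType.sign p.leadingCoeff := by
  by_cases hd : 0 < p.degree
  · have hp0 : p ≠ 0 := by rintro rfl; simp at hd
    rcases lt_or_gt_of_ne (Polynomial.leadingCoeff_ne_zero.2 hp0) with h | h
    · obtain ⟨B, hB⟩ := exists_le_eval_of_leadingCoeff_pos (p := -p) (by simpa using hd)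
        (by simpa using h)
      filter_upwards [eventually_ge_atTop B] with y hy
      have := hB y hy
      rw [Polynomial.eval_neg] at this
      rw [sign_neg h, sign_neg (by linarith)]
    · obtain ⟨B, hB⟩ := exists_le_eval_of_leadingCoeff_pos hd h
      filter_upwards [eventually_ge_atTop B] with y hy
      have := hB y hy
      rw [sign_pos h, sign_pos (by linarith)]
  · rw [Polynomial.eq_C_of_degree_le_zero (not_lt.1 hd)]
    simp

theorem eventually_sign_eval_atBot (p : K[X]) :
    ∀ᶠ y in atBot, SignType.sign (p.eval y) =
      SignType.sign p.leadingCoeff * (-1) ^ p.natDegree := by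
  have h := eventually_sign_eval_atTop (p.comp (-Polynomial.X))
  have h2 := (tendsto_neg_atBot_atTop (G := K)).eventually h
  filter_upwards [h2] with y hy
  have hX : (-Polynomial.X : K[X]).leadingCoeff = -1 := by simp
  rw [Polynomial.leadingCoeff_comp (by simp), hX] at hy
  simp only [Polynomial.eval_comp, Polynomial.eval_neg, Polynomial.eval_X, neg_neg] at hy
  rw [hy, sign_mul, sign_pow]
  simp

end RealAlgebra

/-! ### Finite partial isomorphisms and matchings of root patterns -/

namespace RealAlgebra

set_option linter.unusedSectionVars false

open scoped Polynomial

open Filter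

section Compat

variable {α β : Type*} [LinearOrder α] [LinearOrder β]

/-- `(y, z)` can be added to the finite set `S` of pairs without changing the order pattern. -/
def Compat (S : Finset (α × β)) (y : α) (z : β) : Prop :=
  ∀ s ∈ S, cmp s.1 y = cmp s.2 z

/-- `S` is the graph of a finite partial order isomorphism. -/
def IsPartialIso (S : Finset (α × β)) : Prop :=
  ∀ s ∈ S, Compat S s.1 s.2

theorem Compat.lt_iff {S : Finset (α × β)} {y : α} {z : β} (h : Compat S y z) {s : α × β}
    (hs : s ∈ S) : s.1 < y ↔ s.2 < z := by
  rw [← cmp_eq_lt_iff, ← cmp_eq_lt_iff, h s hs]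

theorem Compat.gt_iff {S : Finset (α × β)} {y : α} {z : β} (h : Compat S y z) {s : α × β}
    (hs : s ∈ S) : y < s.1 ↔ z < s.2 := by
  rw [← cmp_eq_gt_iff, ← cmp_eq_gt_iff, h s hs]

theorem Compat.eq_iff {S : Finset (α × β)} {y : α} {z : β} (h : Compat S y z) {s : α × β}
    (hs : s ∈ S) : s.1 = y ↔ s.2 = z := by
  rw [← cmp_eq_eq_iff s.1 y, ← cmp_eq_eq_iff s.2 z, h s hs]

theorem compat_of_iff {S : Finset (α × β)} {y : α} {z : β}
    (h : ∀ s ∈ S, (s.1 < y ↔ s.2 < z) ∧ (y < s.1 ↔ z < s.2)) : Compat S y z := by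
  intro s hs
  obtain ⟨h1, h2⟩ := h s hs
  rcases lt_trichotomy s.1 y with h3 | h3 | h3
  · rw [cmp_eq_lt_iff _ _ |>.2 h3, cmp_eq_lt_iff _ _ |>.2 (h1.1 h3)]
  · have h4 : s.2 = z := le_antisymm (not_lt.1 fun h => (h2.2 h).ne h3.symm)
      (not_lt.1 fun h => (h1.2 h).ne h3)
    rw [cmp_eq_eq_iff _ _ |>.2 h3, cmp_eq_eq_iff _ _ |>.2 h4]
  · rw [cmp_eq_gt_iff _ _ |>.2 h3, cmp_eq_gt_iff _ _ |>.2 (h2.1 h3)]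

theorem Compat.mono {S T : Finset (α × β)} (h : S ⊆ T) {y : α} {z : β} (hc : Compat T y z) :
    Compat S y z := fun s hs => hc s (h hs)

theorem Compat.swap {S : Finset (α × β)} {y : α} {z : β} (h : Compat S y z) :
    Compat (S.map (Equiv.prodComm α β).toEmbedding) z y := by
  intro s hs
  obtain ⟨t, ht, rfl⟩ := Finset.mem_map.1 hs
  exact (h t ht).symm

theorem Compat.of_swap {S : Finset (α × β)} {y : α} {z : β}
    (h : Compat (S.map (Equiv.prodComm α β).toEmbedding) z y) : Compat S y z := by
  intro s hs
  exact (h (s.2, s.1) (Finset.mem_map.2 ⟨s, hs, rfl⟩)).symm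

theorem IsPartialIso.swap {S : Finset (α × β)} (h : IsPartialIso S) :
    IsPartialIso (S.map (Equiv.prodComm α β).toEmbedding) := by
  intro s hs
  obtain ⟨t, ht, rfl⟩ := Finset.mem_map.1 hs
  exact (h t ht).swap

/-- This is the extension step of Cantor's back-and-forth argument. Below, the points in a fixed
position relative to `S` form a cell: a point of `S` or an open interval between neighbours. -/
theorem IsPartialIso.exists_compat [DenselyOrdered β] [NoMinOrder β] [NoMaxOrder β] [Nonempty β]
    {S : Finset (α × β)} (h : IsPartialIso S) (y : α) : ∃ z, Compat S y z :=
  Order.PartialIso.exists_across ⟨S, fun p hp q hq => h q hq p hp⟩ y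

/-- Intermediate points of a cell remain in the cell. -/
theorem Compat.of_between {S : Finset (α × β)} {y : α} {z z' w : β} (h : Compat S y z)
    (h' : Compat S y z') (hw : z ≤ w) (hw' : w ≤ z') : Compat S y w := by
  refine compat_of_iff fun s hs => ⟨⟨fun hlt => ((h.lt_iff hs).1 hlt).trans_le hw, fun hlt => ?_⟩,
    ⟨fun hlt => hw'.trans_lt ((h'.gt_iff hs).1 hlt), fun hlt => ?_⟩⟩
  · exact (h'.lt_iff hs).2 (hlt.trans_le hw')
  · exact (h.gt_iff hs).2 (hw.trans_lt hlt)

/-- Two points compatible with the same point have no point of `S` strictly between them. -/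
theorem Compat.cmp_eq {S : Finset (α × β)} {y : α} {z z' : β} (h : Compat S y z)
    (h' : Compat S y z') {s : α × β} (hs : s ∈ S) : cmp s.2 z = cmp s.2 z' :=
  (h s hs).symm.trans (h' s hs)

end Compat

variable {K₁ K₂ : Type*} [Field K₁] [LinearOrder K₁] [IsStrictOrderedRing K₁]
  [Field K₂] [LinearOrder K₂] [IsStrictOrderedRing K₂]

/-- `S` matches the roots of the first components of `𝒬` with those of the second components,
in such a way that the sign patterns on corresponding cells agree. -/
structure IsMatching (S : Finset (K₁ × K₂)) (𝒬 : Set (K₁[X] × K₂[X])) : Prop where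
  iso : IsPartialIso S
  left : ∀ p ∈ 𝒬, ∀ y, p.1 ≠ 0 → p.1.eval y = 0 → ∃ s ∈ S, s.1 = y
  right : ∀ p ∈ 𝒬, ∀ z, p.2 ≠ 0 → p.2.eval z = 0 → ∃ s ∈ S, s.2 = z
  sign : ∀ y z, Compat S y z → ∀ p ∈ 𝒬,
    SignType.sign (p.1.eval y) = SignType.sign (p.2.eval z)

namespace IsMatching

variable {S : Finset (K₁ × K₂)} {𝒬 : Set (K₁[X] × K₂[X])}

theorem swap (h : IsMatching S 𝒬) :
    IsMatching (S.map (Equiv.prodComm K₁ K₂).toEmbedding) (Prod.swap ⁻¹' 𝒬) where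
  iso := h.iso.swap
  left p hp y h0 h1 := by
    obtain ⟨s, hs, rfl⟩ := h.right _ hp y h0 h1
    exact ⟨(s.2, s.1), Finset.mem_map.2 ⟨s, hs, rfl⟩, rfl⟩
  right p hp y h0 h1 := by
    obtain ⟨s, hs, rfl⟩ := h.left _ hp y h0 h1
    exact ⟨(s.2, s.1), Finset.mem_map.2 ⟨s, hs, rfl⟩, rfl⟩
  sign y z hyz p hp := (h.sign z y hyz.of_swap _ hp).symm

/-- Every `z` has a partner `y`, so the sign condition makes `p.2` vanish at all points of an
infinite field. -/
theorem snd_eq_zero (h : IsMatching S 𝒬) {p : K₁[X] × K₂[X]} (hp : p ∈ 𝒬) (h0 : p.1 = 0) :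
    p.2 = 0 := by
  refine Polynomial.funext fun z => ?_
  obtain ⟨y, hy⟩ := h.iso.swap.exists_compat z
  have := h.sign y z hy.of_swap p hp
  rw [h0, Polynomial.eval_zero, sign_zero] at this
  rw [Polynomial.eval_zero]
  exact sign_eq_zero_iff.1 this.symm

theorem eq_zero_iff (h : IsMatching S 𝒬) {p : K₁[X] × K₂[X]} (hp : p ∈ 𝒬) :
    p.1 = 0 ↔ p.2 = 0 :=
  ⟨h.snd_eq_zero hp, fun h0 => h.swap.snd_eq_zero (p := p.swap) hp h0⟩

theorem eval_eq_zero_iff (h : IsMatching S 𝒬) {p : K₁[X] × K₂[X]} (hp : p ∈ 𝒬) {y : K₁} {z : K₂}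
    (hyz : Compat S y z) : p.1.eval y = 0 ↔ p.2.eval z = 0 := by
  rw [← sign_eq_zero_iff, h.sign y z hyz p hp, sign_eq_zero_iff]

/-- A matching can be restricted to a smaller set of polynomials, keeping only their roots. -/
theorem restrict (h : IsMatching S 𝒬) (h₂ : PolyIVT K₂) {𝒢 : Set (K₁[X] × K₂[X])}
    (hsub : 𝒢 ⊆ 𝒬) : ∃ S' ⊆ S, IsMatching S' 𝒢 ∧
      ∀ s ∈ S', ∃ g ∈ 𝒢, g.1 ≠ 0 ∧ g.2 ≠ 0 ∧ g.1.eval s.1 = 0 ∧ g.2.eval s.2 = 0 := by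
  classical
  let S' := S.filter (fun s => ∃ g ∈ 𝒢, g.1 ≠ 0 ∧ g.2 ≠ 0 ∧ g.1.eval s.1 = 0 ∧ g.2.eval s.2 = 0)
  have hS' : S' ⊆ S := Finset.filter_subset _ _
  have hleft : ∀ p ∈ 𝒢, ∀ y, p.1 ≠ 0 → p.1.eval y = 0 → ∃ s ∈ S', s.1 = y := by
    intro p hp y h0 hy
    obtain ⟨s, hs, rfl⟩ := h.left p (hsub hp) y h0 hy
    exact ⟨s, Finset.mem_filter.2 ⟨hs, p, hp, h0, fun h' => h0 ((h.eq_zero_iff (hsub hp)).2 h'),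
      hy, (h.eval_eq_zero_iff (hsub hp) (h.iso s hs)).1 hy⟩, rfl⟩
  have hright : ∀ p ∈ 𝒢, ∀ y, p.2 ≠ 0 → p.2.eval y = 0 → ∃ s ∈ S', s.2 = y := by
    intro p hp y h0 hy
    obtain ⟨s, hs, rfl⟩ := h.right p (hsub hp) y h0 hy
    exact ⟨s, Finset.mem_filter.2 ⟨hs, p, hp, fun h' => h0 ((h.eq_zero_iff (hsub hp)).1 h'), h0,
      (h.eval_eq_zero_iff (hsub hp) (h.iso s hs)).2 hy, hy⟩, rfl⟩
  refine ⟨S', hS', ⟨fun s hs => (h.iso s (hS' hs)).mono hS', hleft, hright, ?_⟩,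
    fun s hs => (Finset.mem_filter.1 hs).2⟩
  intro y z hyz p hp
  obtain ⟨w, hw⟩ := h.iso.exists_compat y
  rw [h.sign y w hw p (hsub hp)]
  by_cases h0 : p.2 = 0
  · simp [h0]
  by_contra hne
  -- Dropping points of `S` merges cells. All roots of `p.2` were kept, so `p.2` has no sign change
  -- inside a merged cell.
  have key : ∀ x x', Compat S' y x → Compat S' y x' → x ≤ x' →
      SignType.sign (p.2.eval x) = SignType.sign (p.2.eval x') := by
    intro x x' hx hx' hle
    by_contra hne
    have : ∃ c, x ≤ c ∧ c ≤ x' ∧ p.2.eval c = 0 := by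
      by_contra hcon
      push Not at hcon
      exact hne (h₂.sign_eq hle hcon)
    obtain ⟨c, h1, h2, h3⟩ := this
    obtain ⟨s, hs, rfl⟩ := hright p hp c h0 h3
    have h4 := hx.cmp_eq hx' hs
    rcases h1.lt_or_eq with h5 | h5
    · rw [(cmp_eq_gt_iff _ _).2 h5, eq_comm, cmp_eq_gt_iff] at h4
      exact absurd h4 (not_lt.2 h2)
    · rw [(cmp_eq_eq_iff _ _).2 h5.symm, eq_comm, cmp_eq_eq_iff] at h4
      exact hne (by rw [h5, h4])
  rcases le_total w z with hle | hle
  · exact hne (key _ _ (hw.mono hS') hyz hle)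
  · exact hne (key _ _ hyz (hw.mono hS') hle).symm

end IsMatching

/-- The polynomials `p₁` and `p₂` have the same eventual sign along two filters. -/
def SameSign (l₁ : Filter K₁) (l₂ : Filter K₂) (p₁ : K₁[X]) (p₂ : K₂[X]) : Prop :=
  ∃ σ : SignType, (∀ᶠ y in l₁, SignType.sign (p₁.eval y) = σ) ∧
    ∀ᶠ z in l₂, SignType.sign (p₂.eval z) = σ

theorem SameSign.swap {l₁ : Filter K₁} {l₂ : Filter K₂} {p₁ : K₁[X]} {p₂ : K₂[X]}
    (h : SameSign l₁ l₂ p₁ p₂) : SameSign l₂ l₁ p₂ p₁ := by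
  obtain ⟨σ, h1, h2⟩ := h
  exact ⟨σ, h2, h1⟩

theorem SameSign.neg {l₁ : Filter K₁} {l₂ : Filter K₂} {p₁ : K₁[X]} {p₂ : K₂[X]}
    (h : SameSign l₁ l₂ p₁ p₂) : SameSign l₁ l₂ (-p₁) (-p₂) := by
  obtain ⟨σ, h1, h2⟩ := h
  refine ⟨-σ, h1.mono fun y hy => ?_, h2.mono fun y hy => ?_⟩ <;>
  rw [Polynomial.eval_neg, Left.sign_neg, hy]

/-- The sign of an increasing polynomial at a point of a cell is attained on the
corresponding cell. -/
theorem exists_sign_eq_of_derivative_pos (h₁ : PolyIVT K₁) (h₂ : PolyIVT K₂)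
    {S : Finset (K₁ × K₂)} (hS : IsPartialIso S) {p₁ : K₁[X]} {p₂ : K₂[X]}
    (hmatch : ∀ s ∈ S, SignType.sign (p₁.eval s.1) = SignType.sign (p₂.eval s.2))
    (htop : SameSign atTop atTop p₁ p₂) (hbot : SameSign atBot atBot p₁ p₂)
    {y : K₁} {z : K₂} (hyz : Compat S y z) (hy : ∀ s ∈ S, s.1 ≠ y)
    (hd₁ : ∀ y', Compat S y' z → 0 < p₁.derivative.eval y')
    (hd₂ : ∀ z', Compat S y z' → 0 < p₂.derivative.eval z') :
    ∃ z', Compat S y z' ∧ SignType.sign (p₂.eval z') = SignType.sign (p₁.eval y) := by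
  have hmono₁ : ∀ a b, a < b → (∀ x, a < x → x < b → Compat S x z) → p₁.eval a < p₁.eval b :=
    fun a b hab h => h₁.eval_lt_eval hab fun x h1 h2 => hd₁ x (h x h1 h2)
  have hmono₂ : ∀ a b, a < b → (∀ x, a < x → x < b → Compat S y x) → p₂.eval a < p₂.eval b :=
    fun a b hab h => h₂.eval_lt_eval hab fun x h1 h2 => hd₂ x (h x h1 h2)
  -- Since `p₁` increases on the cell, it is negative at the left end, which is a point of `S` or
  -- far out towards `-∞`. Matching of signs there makes `p₂` negative at the corresponding end.
  have hleft : p₁.eval y ≤ 0 →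
      ∃ ζ < z, p₂.eval ζ < 0 ∧ ∀ w, ζ < w → w ≤ z → Compat S y w := by
    intro hle
    by_cases hex : (S.filter (fun s => s.1 < y)).Nonempty
    · obtain ⟨s, hs, hmax⟩ := Finset.exists_max_image _ (fun s : K₁ × K₂ => s.1) hex
      rw [Finset.mem_filter] at hs
      have hcell₁ : ∀ x, s.1 < x → x ≤ y → ∀ t ∈ S, (t.1 < x ↔ t.1 < y) ∧ (x < t.1 ↔ y < t.1) := by
        intro x hx hxy t ht
        refine ⟨⟨fun h => h.trans_le hxy, fun h => ?_⟩, ⟨fun h => ?_, fun h => hxy.trans_lt h⟩⟩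
        · exact (hmax t (Finset.mem_filter.2 ⟨ht, h⟩)).trans_lt hx
        · rcases lt_trichotomy t.1 y with h' | h' | h'
          · exact absurd (hx.trans h) (not_lt.2 (hmax t (Finset.mem_filter.2 ⟨ht, h'⟩)))
          · exact absurd h' (hy t ht)
          · exact h'
      refine ⟨s.2, (hyz.lt_iff hs.1).1 hs.2, ?_, ?_⟩
      · have := hmono₁ s.1 y hs.2 fun x h1 h2 => compat_of_iff fun t ht => by
          rw [(hcell₁ x h1 h2.le t ht).1, (hcell₁ x h1 h2.le t ht).2]
          exact ⟨hyz.lt_iff ht, hyz.gt_iff ht⟩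
        have h4 := hmatch s hs.1
        rw [sign_neg (this.trans_le hle)] at h4
        exact sign_eq_neg_one_iff.1 h4.symm
      · intro w hw hwz
        refine compat_of_iff fun t ht => ⟨⟨fun h => ?_, fun h => ?_⟩, ⟨fun h => ?_, fun h => ?_⟩⟩
        · have h5 := hmax t (Finset.mem_filter.2 ⟨ht, h⟩)
          refine lt_of_le_of_lt ?_ hw
          exact not_lt.1 fun h6 => absurd (((hS t ht).lt_iff hs.1).2 h6) (not_lt.2 h5)
        · exact (hyz.lt_iff ht).2 (h.trans_le hwz)
        · exact hwz.trans_lt ((hyz.gt_iff ht).1 h)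
        · have h5 : s.1 < t.1 := ((hS t ht).lt_iff hs.1).2 (hw.trans h)
          rcases lt_trichotomy t.1 y with h' | h' | h'
          · exact absurd h5 (not_lt.2 (hmax t (Finset.mem_filter.2 ⟨ht, h'⟩)))
          · exact absurd h' (hy t ht)
          · exact h'
    · have hnone : ∀ t ∈ S, y < t.1 := by
        intro t ht
        rcases lt_trichotomy t.1 y with h' | h' | h'
        · exact absurd ⟨t, Finset.mem_filter.2 ⟨ht, h'⟩⟩ hex
        · exact absurd h' (hy t ht)
        · exact h'
      obtain ⟨σ, hσ₁, hσ₂⟩ := hbot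
      obtain ⟨y₀, hy₀, hy₀'⟩ := (hσ₁.and (eventually_lt_atBot y)).exists
      obtain ⟨ζ, hζ, hζ'⟩ := (hσ₂.and (eventually_lt_atBot z)).exists
      have hneg : p₁.eval y₀ < 0 := by
        refine (hmono₁ y₀ y hy₀' fun x h1 h2 => compat_of_iff fun t ht => ?_).trans_le hle
        have h3 := hnone t ht
        have h4 := (hyz.gt_iff ht).1 h3
        exact ⟨iff_of_false (h2.trans h3).not_gt h4.not_gt, iff_of_true (h2.trans h3) h4⟩
      rw [sign_neg hneg] at hy₀
      refine ⟨ζ, hζ', sign_eq_neg_one_iff.1 (by rw [hζ, hy₀]), fun w _ hw => ?_⟩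
      refine compat_of_iff fun t ht => ?_
      have h3 := hnone t ht
      have h4 := hw.trans_lt ((hyz.gt_iff ht).1 h3)
      exact ⟨iff_of_false h3.not_gt h4.not_gt, iff_of_true h3 h4⟩
  have hright : 0 ≤ p₁.eval y →
      ∃ ζ > z, 0 < p₂.eval ζ ∧ ∀ w, w < ζ → z ≤ w → Compat S y w := by
    intro hle
    by_cases hex : (S.filter (fun s => y < s.1)).Nonempty
    · obtain ⟨s, hs, hmin⟩ := Finset.exists_min_image _ (fun s : K₁ × K₂ => s.1) hex
      rw [Finset.mem_filter] at hs
      have hcell₁ : ∀ x, x < s.1 → y ≤ x → ∀ t ∈ S, (t.1 < x ↔ t.1 < y) ∧ (x < t.1 ↔ y < t.1) := by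
        intro x hx hxy t ht
        refine ⟨⟨fun h => ?_, fun h => h.trans_le hxy⟩, ⟨fun h => hxy.trans_lt h, fun h => ?_⟩⟩
        · rcases lt_trichotomy t.1 y with h' | h' | h'
          · exact h'
          · exact absurd h' (hy t ht)
          · exact absurd (h.trans hx) (not_lt.2 (hmin t (Finset.mem_filter.2 ⟨ht, h'⟩)))
        · exact hx.trans_le (hmin t (Finset.mem_filter.2 ⟨ht, h⟩))
      refine ⟨s.2, (hyz.gt_iff hs.1).1 hs.2, ?_, ?_⟩
      · have := hmono₁ y s.1 hs.2 fun x h1 h2 => compat_of_iff fun t ht => by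
          rw [(hcell₁ x h2 h1.le t ht).1, (hcell₁ x h2 h1.le t ht).2]
          exact ⟨hyz.lt_iff ht, hyz.gt_iff ht⟩
        have h4 := hmatch s hs.1
        rw [sign_pos (hle.trans_lt this)] at h4
        exact sign_eq_one_iff.1 h4.symm
      · intro w hw hwz
        refine compat_of_iff fun t ht => ⟨⟨fun h => ?_, fun h => ?_⟩, ⟨fun h => ?_, fun h => ?_⟩⟩
        · exact ((hyz.lt_iff ht).1 h).trans_le hwz
        · have h5 : t.1 < s.1 := ((hS s hs.1).lt_iff ht).2 (h.trans hw)
          rcases lt_trichotomy t.1 y with h' | h' | h'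
          · exact h'
          · exact absurd h' (hy t ht)
          · exact absurd h5 (not_lt.2 (hmin t (Finset.mem_filter.2 ⟨ht, h'⟩)))
        · have h5 := hmin t (Finset.mem_filter.2 ⟨ht, h⟩)
          refine lt_of_lt_of_le hw ?_
          exact not_lt.1 fun h6 => absurd (((hS s hs.1).lt_iff ht).2 h6) (not_lt.2 h5)
        · exact (hyz.gt_iff ht).2 (hwz.trans_lt h)
    · have hnone : ∀ t ∈ S, t.1 < y := by
        intro t ht
        rcases lt_trichotomy t.1 y with h' | h' | h'
        · exact h'
        · exact absurd h' (hy t ht)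
        · exact absurd ⟨t, Finset.mem_filter.2 ⟨ht, h'⟩⟩ hex
      obtain ⟨σ, hσ₁, hσ₂⟩ := htop
      obtain ⟨y₀, hy₀, hy₀'⟩ := (hσ₁.and (eventually_gt_atTop y)).exists
      obtain ⟨ζ, hζ, hζ'⟩ := (hσ₂.and (eventually_gt_atTop z)).exists
      have hpos : 0 < p₁.eval y₀ := by
        refine hle.trans_lt (hmono₁ y y₀ hy₀' fun x h1 h2 => compat_of_iff fun t ht => ?_)
        have h3 := hnone t ht
        have h4 := (hyz.lt_iff ht).1 h3
        exact ⟨iff_of_true (h3.trans h1) h4, iff_of_false (h3.trans h1).not_gt h4.not_gt⟩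
      rw [sign_pos hpos] at hy₀
      refine ⟨ζ, hζ', sign_eq_one_iff.1 (by rw [hζ, hy₀]), fun w _ hw => ?_⟩
      refine compat_of_iff fun t ht => ?_
      have h3 := hnone t ht
      have h4 := ((hyz.lt_iff ht).1 h3).trans_le hw
      exact ⟨iff_of_true h3 h4, iff_of_false h3.not_gt h4.not_gt⟩
  -- `p₂` is negative at the left end and nonnegative at `z`, so it has a root in the cell, and
  -- monotonicity makes it negative just before the root.
  have hlow : p₁.eval y ≤ 0 → 0 ≤ p₂.eval z → ∃ c ≤ z, p₂.eval c = 0 ∧ Compat S y c ∧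
      ∃ w, Compat S y w ∧ p₂.eval w < 0 := by
    intro h h'
    obtain ⟨ζ, hζ, hneg, hcell⟩ := hleft h
    obtain ⟨c, hc1, hc2, hc3⟩ : ∃ c, ζ < c ∧ c ≤ z ∧ p₂.eval c = 0 := by
      rcases h'.eq_or_lt with h0 | h0
      · exact ⟨z, hζ, le_rfl, h0.symm⟩
      · obtain ⟨c, h1, h2, h3⟩ := h₂ p₂ ζ z hζ (mul_neg_of_neg_of_pos hneg h0)
        exact ⟨c, h1, h2.le, h3⟩
    obtain ⟨w, hw1, hw2⟩ := exists_between hc1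
    refine ⟨c, hc2, hc3, hcell c hc1 hc2, w, hcell w hw1 (hw2.le.trans hc2), ?_⟩
    rw [← hc3]
    exact hmono₂ w c hw2 fun x h1 h2 => hcell x (hw1.trans h1) (h2.le.trans hc2)
  have hhigh : 0 ≤ p₁.eval y → p₂.eval z ≤ 0 → ∃ c ≥ z, p₂.eval c = 0 ∧ Compat S y c ∧
      ∃ w, Compat S y w ∧ 0 < p₂.eval w := by
    intro h h'
    obtain ⟨ζ, hζ, hpos, hcell⟩ := hright h
    obtain ⟨c, hc1, hc2, hc3⟩ : ∃ c, c < ζ ∧ z ≤ c ∧ p₂.eval c = 0 := by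
      rcases h'.eq_or_lt with h0 | h0
      · exact ⟨z, hζ, le_rfl, h0⟩
      · obtain ⟨c, h1, h2, h3⟩ := h₂ p₂ z ζ hζ (mul_neg_of_neg_of_pos h0 hpos)
        exact ⟨c, h2, h1.le, h3⟩
    obtain ⟨w, hw1, hw2⟩ := exists_between hc1
    refine ⟨c, hc2, hc3, hcell c hc1 hc2, w, hcell w hw2 (hc2.trans hw1.le), ?_⟩
    rw [← hc3]
    exact hmono₂ c w hw1 fun x h1 h2 => hcell x (h2.trans hw2) (hc2.trans h1.le)
  rcases lt_trichotomy (p₁.eval y) 0 with h | h | h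
  · rcases lt_or_ge (p₂.eval z) 0 with h' | h'
    · exact ⟨z, hyz, by rw [sign_neg h, sign_neg h']⟩
    · obtain ⟨_, _, _, _, w, hw, hneg⟩ := hlow h.le h'
      exact ⟨w, hw, by rw [sign_neg h, sign_neg hneg]⟩
  · rcases le_total 0 (p₂.eval z) with h' | h'
    · obtain ⟨c, _, hc, hcell, _⟩ := hlow h.le h'
      exact ⟨c, hcell, by rw [h, hc, sign_zero, sign_zero]⟩
    · obtain ⟨c, _, hc, hcell, _⟩ := hhigh h.ge h'
      exact ⟨c, hcell, by rw [h, hc, sign_zero, sign_zero]⟩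
  · rcases lt_or_ge 0 (p₂.eval z) with h' | h'
    · exact ⟨z, hyz, by rw [sign_pos h, sign_pos h']⟩
    · obtain ⟨_, _, _, _, w, hw, hpos⟩ := hhigh h.le h'
      exact ⟨w, hw, by rw [sign_pos h, sign_pos hpos]⟩

end RealAlgebra

namespace RealAlgebra

set_option linter.unusedSectionVars false

open scoped Polynomial

open Filter

variable {K₁ K₂ : Type*} [Field K₁] [LinearOrder K₁] [IsStrictOrderedRing K₁]
  [Field K₂] [LinearOrder K₂] [IsStrictOrderedRing K₂]

namespace IsMatching

variable {S : Finset (K₁ × K₂)} {𝒬 : Set (K₁[X] × K₂[X])} {p : K₁[X] × K₂[X]}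

/-- Off `S` the derivative has constant sign on a cell, so up to negating `p` the increasing case
applies. If the derivative vanishes off `S`, it is the zero polynomial, because its roots are
recorded in `S`; then both polynomials are constant, and their signs at infinity agree. -/
theorem exists_sign_eq (h : IsMatching S 𝒬) (h₁ : PolyIVT K₁) (h₂ : PolyIVT K₂)
    (hd : (p.1.derivative, p.2.derivative) ∈ 𝒬)
    (hmatch : ∀ s ∈ S, SignType.sign (p.1.eval s.1) = SignType.sign (p.2.eval s.2))
    (htop : SameSign atTop atTop p.1 p.2) (hbot : SameSign atBot atBot p.1 p.2)
    {y : K₁} {z : K₂} (hyz : Compat S y z) :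
    ∃ z', Compat S y z' ∧ SignType.sign (p.2.eval z') = SignType.sign (p.1.eval y) := by
  by_cases hy : ∃ s ∈ S, s.1 = y
  · obtain ⟨s, hs, rfl⟩ := hy
    have : s.2 = z := (hyz.eq_iff hs).1 rfl
    exact ⟨z, hyz, by rw [hmatch s hs, this]⟩
  push Not at hy
  have hsign : ∀ y' z', Compat S y' z' → SignType.sign (p.1.derivative.eval y') =
      SignType.sign (p.2.derivative.eval z') := fun y' z' h' => h.sign y' z' h' _ hd
  rcases lt_trichotomy (p.1.derivative.eval y) 0 with h0 | h0 | h0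
  · have hz : SignType.sign (p.2.derivative.eval z) = -1 := by rw [← hsign y z hyz, sign_neg h0]
    obtain ⟨z', hz', h'⟩ := exists_sign_eq_of_derivative_pos h₁ h₂ h.iso (p₁ := -p.1) (p₂ := -p.2)
      (fun s hs => by
        rw [Polynomial.eval_neg, Polynomial.eval_neg, Left.sign_neg, Left.sign_neg, hmatch s hs])
      htop.neg hbot.neg hyz hy
      (fun y' hy' => by
        rw [Polynomial.derivative_neg, Polynomial.eval_neg, neg_pos, ← sign_eq_neg_one_iff,
          hsign _ _ hy', hz])
      (fun z' hz' => by
        rw [Polynomial.derivative_neg, Polynomial.eval_neg, neg_pos, ← sign_eq_neg_one_iff,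
          ← hsign _ _ hz', sign_neg h0])
    refine ⟨z', hz', ?_⟩
    rw [Polynomial.eval_neg, Polynomial.eval_neg, Left.sign_neg, Left.sign_neg] at h'
    exact neg_injective h'
  · have hd1 : p.1.derivative = 0 := by
      by_contra hne
      obtain ⟨s, hs, hsy⟩ := h.left _ hd y hne h0
      exact hy s hs hsy
    have hd2 : p.2.derivative = 0 := h.snd_eq_zero hd hd1
    obtain ⟨σ, h3, h4⟩ := htop
    obtain ⟨y', hy'⟩ := h3.exists
    obtain ⟨z', hz'⟩ := h4.exists
    refine ⟨z, hyz, ?_⟩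
    rw [Polynomial.eq_C_of_natDegree_eq_zero (Polynomial.derivative_eq_zero.1 hd1),
      Polynomial.eval_C] at hy' ⊢
    rw [Polynomial.eq_C_of_natDegree_eq_zero (Polynomial.derivative_eq_zero.1 hd2),
      Polynomial.eval_C] at hz' ⊢
    rw [hy', hz']
  · have hz : SignType.sign (p.2.derivative.eval z) = 1 := by rw [← hsign y z hyz, sign_pos h0]
    exact exists_sign_eq_of_derivative_pos h₁ h₂ h.iso hmatch htop hbot hyz hy
      (fun y' hy' => by rw [← sign_eq_one_iff, hsign _ _ hy', hz])
      (fun z' hz' => by rw [← sign_eq_one_iff, ← hsign _ _ hz', sign_pos h0])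

/-- A polynomial whose derivative is already matched has at most one root in each cell, and its
sign in the cell is determined by the position relative to this root. -/
theorem sign_eval_of_root (h : IsMatching S 𝒬) (h₁ : PolyIVT K₁)
    (hd : (p.1.derivative, p.2.derivative) ∈ 𝒬) {y y' : K₁} {z : K₂} (hy : Compat S y z)
    (hy' : Compat S y' z) (hlt : y < y') :
    SignType.sign (p.1.eval y' - p.1.eval y) = SignType.sign (p.2.derivative.eval z) := by
  obtain ⟨c, h1, h2, h3⟩ := h₁.exists_derivative_eq_slope p.1 hlt
  have hc : Compat S c z := by
    intro s hs
    exact (hy.swap.of_between hy'.swap h1.le h2.le).of_swap s hs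
  rw [h3, sign_mul, sign_pos (sub_pos.2 hlt), mul_one]
  exact h.sign c z hc _ hd

/-- Enlarge `S` by the pairs of roots of `p.1` and `p.2` in corresponding cells. By the mean value
theorem a cell holds at most one root of each, and `exists_sign_eq` shows that a root on one side
has a partner on the other. In a cell with a root the sign of `p` is read off from the derivative
and the side; in a cell without one it is constant. -/
theorem exists_insert (h : IsMatching S 𝒬) (h₁ : PolyIVT K₁) (h₂ : PolyIVT K₂)
    (hd : (p.1.derivative, p.2.derivative) ∈ 𝒬)
    (hmatch : ∀ s ∈ S, SignType.sign (p.1.eval s.1) = SignType.sign (p.2.eval s.2))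
    (htop : SameSign atTop atTop p.1 p.2) (hbot : SameSign atBot atBot p.1 p.2) :
    ∃ S', IsMatching S' (insert p 𝒬) := by
  classical
  have hLR : ∀ {y z}, Compat S y z →
      ∃ z', Compat S y z' ∧ SignType.sign (p.2.eval z') = SignType.sign (p.1.eval y) :=
    fun hyz => h.exists_sign_eq h₁ h₂ hd hmatch htop hbot hyz
  have hRL : ∀ {y z}, Compat S y z →
      ∃ y', Compat S y' z ∧ SignType.sign (p.1.eval y') = SignType.sign (p.2.eval z) := by
    intro y z hyz
    obtain ⟨y', h1, h2⟩ := h.swap.exists_sign_eq (p := p.swap) h₂ h₁ hd (by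
      intro s hs
      obtain ⟨t, ht, rfl⟩ := Finset.mem_map.1 hs
      exact (hmatch t ht).symm) htop.swap hbot.swap hyz.swap
    exact ⟨y', h1.of_swap, h2⟩
  have hzero : p.1 = 0 ↔ p.2 = 0 := by
    obtain ⟨σ, h3, h4⟩ := htop
    have h5 := (eventually_sign_eval_atTop p.1).and h3
    have h6 := (eventually_sign_eval_atTop p.2).and h4
    obtain ⟨y, hy, hy'⟩ := h5.exists
    obtain ⟨z, hz, hz'⟩ := h6.exists
    rw [← Polynomial.leadingCoeff_eq_zero, ← Polynomial.leadingCoeff_eq_zero (p := p.2),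
      ← sign_eq_zero_iff, ← sign_eq_zero_iff (a := p.2.leadingCoeff), ← hy, hy', ← hz, hz']
  by_cases hp0 : p.1 = 0
  · have hp0' := hzero.1 hp0
    refine ⟨S, h.iso, ?_, ?_, ?_⟩
    · rintro q (rfl | hq)
      · exact fun y h0 => absurd hp0 h0
      · exact h.left q hq
    · rintro q (rfl | hq)
      · exact fun y h0 => absurd hp0' h0
      · exact h.right q hq
    · rintro y z hyz q (rfl | hq)
      · rw [hp0, hp0']; simp
      · exact h.sign y z hyz q hq
  have hp0' : p.2 ≠ 0 := fun h' => hp0 (hzero.2 h')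
  let R : Finset (K₁ × K₂) := (p.1.roots.toFinset ×ˢ p.2.roots.toFinset).filter
    (fun s => Compat S s.1 s.2)
  have hR : ∀ s, s ∈ R ↔ p.1.eval s.1 = 0 ∧ p.2.eval s.2 = 0 ∧ Compat S s.1 s.2 := by
    intro s
    simp [R, hp0, hp0', and_assoc]
  have hsub : S ⊆ S ∪ R := Finset.subset_union_left
  have hroot : ∀ {y z}, Compat S y z → (∃ y', Compat S y' z ∧ y ≠ y' ∧
      p.1.eval y = p.1.eval y') → p.1.derivative = 0 := by
    rintro y z hy ⟨y', hy', hne, heq⟩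
    have h0 : p.2.derivative.eval z = 0 := by
      rcases lt_or_gt_of_ne hne with hlt | hlt
      · have := h.sign_eval_of_root h₁ hd hy hy' hlt
        rw [heq, sub_self, sign_zero, eq_comm, sign_eq_zero_iff] at this
        exact this
      · have := h.sign_eval_of_root h₁ hd hy' hy hlt
        rw [heq, sub_self, sign_zero, eq_comm, sign_eq_zero_iff] at this
        exact this
    by_contra hd0
    have hd0' : p.2.derivative ≠ 0 := fun h' => hd0 ((h.eq_zero_iff hd).2 h')
    obtain ⟨s, hs, hsz⟩ := h.right _ hd z hd0' h0
    exact hne (((hy.eq_iff hs).2 hsz).symm.trans ((hy'.eq_iff hs).2 hsz))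
  have hdne : ∀ {y}, p.1.eval y = 0 → p.1.derivative ≠ 0 := by
    intro y hy h0
    have h1 := Polynomial.eq_C_of_natDegree_eq_zero
      (Polynomial.derivative_eq_zero.1 h0)
    rw [h1, Polynomial.eval_C] at hy
    rw [hy, map_zero] at h1
    exact hp0 h1
  -- a root in a cell is unique
  have huniq : ∀ {y y' z}, Compat S y z → Compat S y' z → p.1.eval y = 0 → p.1.eval y' = 0 →
      y = y' := by
    intro y y' z hy hy' h0 h0'
    by_contra hne
    exact hdne h0 (hroot hy ⟨y', hy', hne, by rw [h0, h0']⟩)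
  have huniq' : ∀ {y z z'}, Compat S y z → Compat S y z' → p.2.eval z = 0 → p.2.eval z' = 0 →
      z = z' := by
    intro y z z' hz hz' h0 h0'
    by_contra hne
    have hd0 : p.2.derivative ≠ 0 := by
      intro hd0
      have h1 := Polynomial.eq_C_of_natDegree_eq_zero
        (Polynomial.derivative_eq_zero.1 hd0)
      rw [h1, Polynomial.eval_C] at h0
      rw [h0, map_zero] at h1
      exact hp0' h1
    have h3 : p.1.derivative.eval y = 0 := by
      rcases lt_or_gt_of_ne hne with hlt | hlt
      · have := h.swap.sign_eval_of_root (p := p.swap) h₂ hd hz.swap hz'.swap hlt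
        simp only [Prod.fst_swap, Prod.snd_swap, h0, h0', sub_self, sign_zero] at this
        exact sign_eq_zero_iff.1 this.symm
      · have := h.swap.sign_eval_of_root (p := p.swap) h₂ hd hz'.swap hz.swap hlt
        simp only [Prod.fst_swap, Prod.snd_swap, h0, h0', sub_self, sign_zero] at this
        exact sign_eq_zero_iff.1 this.symm
    have hd1 : p.1.derivative ≠ 0 := fun h' => hd0 ((h.eq_zero_iff hd).1 h')
    obtain ⟨s, hs, hsy⟩ := h.left _ hd y hd1 h3
    exact hne (((hz.eq_iff hs).1 hsy).symm.trans ((hz'.eq_iff hs).1 hsy))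
  -- Points of different cells are separated by a point of `S`, or one of them lies in `S`, so their
  -- order is the same on both sides.
  have hcompat_of_cmp : ∀ {y z y' z'}, Compat S y z → Compat S y' z' → ¬ Compat S y z' →
      cmp y y' = cmp z z' := by
    intro y z y' z' hyz hyz' hno
    have : ∃ s ∈ S, cmp s.1 y ≠ cmp s.1 y' := by
      by_contra hcon
      push Not at hcon
      exact hno fun s hs => (hcon s hs).trans (hyz' s hs)
    obtain ⟨s, hs, hne⟩ := this
    rcases lt_trichotomy s.1 y with h3 | h3 | h3
    · have h4 : y' ≤ s.1 := not_lt.1 fun h' => hne (by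
        rw [(cmp_eq_lt_iff _ _).2 h3, (cmp_eq_lt_iff _ _).2 h'])
      have h5 : z' ≤ s.2 := not_lt.1 fun h' => not_lt.2 h4 ((hyz'.lt_iff hs).2 h')
      rw [(cmp_eq_gt_iff _ _).2 (h4.trans_lt h3),
        (cmp_eq_gt_iff _ _).2 (h5.trans_lt ((hyz.lt_iff hs).1 h3))]
    · rw [← h3, ← (hyz.eq_iff hs).1 h3]
      exact hyz' s hs
    · have h4 : s.1 ≤ y' := not_lt.1 fun h' => hne (by
        rw [(cmp_eq_gt_iff _ _).2 h3, (cmp_eq_gt_iff _ _).2 h'])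
      have h5 : s.2 ≤ z' := not_lt.1 fun h' => not_lt.2 h4 ((hyz'.gt_iff hs).2 h')
      rw [(cmp_eq_lt_iff _ _).2 (h3.trans_le h4),
        (cmp_eq_lt_iff _ _).2 (((hyz.gt_iff hs).1 h3).trans_le h5)]
  have hiso : IsPartialIso (S ∪ R) := by
    intro s hs t ht
    rcases Finset.mem_union.1 hs with hs | hs
    · rcases Finset.mem_union.1 ht with ht | ht
      · exact h.iso s hs t ht
      · rw [cmp_eq_cmp_symm]
        exact ((hR t).1 ht).2.2 s hs
    · obtain ⟨h1, h2, h3⟩ := (hR s).1 hs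
      rcases Finset.mem_union.1 ht with ht | ht
      · exact h3 t ht
      · obtain ⟨h1', h2', h3'⟩ := (hR t).1 ht
        by_cases hc : Compat S t.1 s.2
        · have h4 : t.1 = s.1 := huniq hc h3 h1' h1
          have h5 : t.2 = s.2 := huniq' h3' hc h2' h2
          rw [h4, h5, (cmp_eq_eq_iff _ _).2 rfl, (cmp_eq_eq_iff _ _).2 rfl]
        · exact hcompat_of_cmp h3' h3 hc
  refine ⟨S ∪ R, hiso, ?_, ?_, ?_⟩
  · rintro q (rfl | hq) y h0 hy
    · obtain ⟨z, hz⟩ := h.iso.exists_compat y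
      obtain ⟨z', hz', hs⟩ := hLR hz
      rw [hy, sign_zero, sign_eq_zero_iff] at hs
      exact ⟨(y, z'), Finset.mem_union_right _ ((hR _).2 ⟨hy, hs, hz'⟩), rfl⟩
    · obtain ⟨s, hs, rfl⟩ := h.left q hq y h0 hy
      exact ⟨s, hsub hs, rfl⟩
  · rintro q (rfl | hq) z h0 hz
    · obtain ⟨y, hy⟩ := h.iso.swap.exists_compat z
      obtain ⟨y', hy', hs⟩ := hRL hy.of_swap
      rw [hz, sign_zero, sign_eq_zero_iff] at hs
      exact ⟨(y', z), Finset.mem_union_right _ ((hR _).2 ⟨hs, hz, hy'⟩), rfl⟩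
    · obtain ⟨s, hs, rfl⟩ := h.right q hq z h0 hz
      exact ⟨s, hsub hs, rfl⟩
  · rintro y z hyz q (rfl | hq)
    · have hyzS : Compat S y z := hyz.mono hsub
      by_cases hex : ∃ s ∈ R, Compat S s.1 z
      · obtain ⟨s, hs, hsz⟩ := hex
        obtain ⟨h1, h2, h3⟩ := (hR s).1 hs
        have h4 : Compat S y s.2 := fun t ht =>
          (hyzS t ht).trans ((hsz t ht).symm.trans (h3 t ht))
        have h5 := hyz s (Finset.mem_union_right _ hs)
        have h6 : SignType.sign (q.1.derivative.eval y) = SignType.sign (q.2.derivative.eval z) :=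
          h.sign y z hyzS _ hd
        rcases lt_trichotomy s.1 y with h7 | h7 | h7
        · rw [(cmp_eq_lt_iff _ _).2 h7, eq_comm, cmp_eq_lt_iff] at h5
          have h8 := h.sign_eval_of_root h₁ hd hsz hyzS h7
          have h9 := h.swap.sign_eval_of_root (p := q.swap) h₂ hd h4.swap hyzS.swap h5
          simp only [Prod.fst_swap, Prod.snd_swap] at h9
          rw [h1, sub_zero] at h8
          rw [h2, sub_zero] at h9
          rw [h8, h9, h6]
        · rw [(cmp_eq_eq_iff _ _).2 h7, eq_comm, cmp_eq_eq_iff] at h5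
          rw [← h7, ← h5, h1, h2, sign_zero, sign_zero]
        · rw [(cmp_eq_gt_iff _ _).2 h7, eq_comm, cmp_eq_gt_iff] at h5
          have h8 := h.sign_eval_of_root h₁ hd hyzS hsz h7
          have h9 := h.swap.sign_eval_of_root (p := q.swap) h₂ hd hyzS.swap h4.swap h5
          simp only [Prod.fst_swap, Prod.snd_swap] at h9
          rw [h1, zero_sub, Left.sign_neg] at h8
          rw [h2, zero_sub, Left.sign_neg] at h9
          exact neg_injective (by rw [h8, h9, h6])
      · obtain ⟨z', hz', hs⟩ := hLR hyzS
        rw [← hs]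
        have hnoroot : ∀ w, Compat S y w → q.2.eval w ≠ 0 := by
          intro w hw h0
          obtain ⟨y', hy', hs'⟩ := hRL hw
          rw [h0, sign_zero, sign_eq_zero_iff] at hs'
          exact hex ⟨(y', w), (hR _).2 ⟨hs', h0, hy'⟩, fun t ht =>
            (hy' t ht).trans ((hw t ht).symm.trans (hyzS t ht))⟩
        rcases le_total z' z with hle | hle
        · exact h₂.sign_eq hle fun w hw hw' => hnoroot w (hz'.of_between hyzS hw hw')
        · exact (h₂.sign_eq hle fun w hw hw' => hnoroot w (hyzS.of_between hz' hw hw')).symm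
    · exact h.sign y z (hyz.mono hsub) q hq

end IsMatching

end RealAlgebra

/-! ### Pseudo-division and elimination of one variable -/

namespace RealAlgebra

set_option linter.unusedSectionVars false

open scoped Polynomial

open Filter

section PseudoDivision

variable {A : Type*} [CommRing A]

/-- Coefficients cannot be inverted in `A`, so each division step multiplies by the leading
coefficient of `g` instead. -/
theorem exists_pseudo_division (g p : A[X]) :
    ∃ (k : ℕ) (q r : A[X]), r.degree < g.degree ∧
      Polynomial.C (g.leadingCoeff ^ k) * p = q * g + r ∨ g = 0 := by
  by_cases hg : g = 0
  · exact ⟨0, 0, 0, Or.inr hg⟩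
  suffices H : ∀ (N : ℕ) (p : A[X]), p.degree < N → ∃ (k : ℕ) (q r : A[X]), r.degree < g.degree ∧
      Polynomial.C (g.leadingCoeff ^ k) * p = q * g + r by
    obtain ⟨k, q, r, h⟩ := H (p.natDegree + 1) p
      (lt_of_le_of_lt Polynomial.degree_le_natDegree (by exact_mod_cast Nat.lt_succ_self _))
    exact ⟨k, q, r, Or.inl h⟩
  intro N
  induction N with
  | zero =>
    intro p hp
    refine ⟨0, 0, p, ?_, by simp⟩
    have : p = 0 := by
      rw [← Polynomial.degree_eq_bot]
      by_contra h
      have h2 : (0 : WithBot ℕ) ≤ p.degree := Polynomial.zero_le_degree_iff.2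
        (fun h0 => h (by rw [h0, Polynomial.degree_zero]))
      exact absurd hp (not_lt.2 (by exact_mod_cast h2))
    rw [this, Polynomial.degree_zero, bot_lt_iff_ne_bot]
    exact fun h => hg (Polynomial.degree_eq_bot.1 h)
  | succ N ih =>
    intro p hp
    by_cases hlt : p.degree < g.degree
    · exact ⟨0, 0, p, hlt, by simp⟩
    have hN : g.natDegree ≤ N := by
      have h1 : g.degree < ((N + 1 : ℕ) : WithBot ℕ) := (not_lt.1 hlt).trans_lt hp
      rw [Polynomial.degree_eq_natDegree hg] at h1
      have : g.natDegree < N + 1 := by exact_mod_cast h1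
      omega
    let p' := Polynomial.C g.leadingCoeff * p -
      Polynomial.C (p.coeff N) * (g * Polynomial.X ^ (N - g.natDegree))
    have hp' : p'.degree < N := by
      rw [Polynomial.degree_lt_iff_coeff_zero]
      intro j hj
      simp only [p', Polynomial.coeff_sub, Polynomial.coeff_C_mul]
      obtain ⟨i, rfl⟩ : ∃ i, j = g.natDegree + i + (N - g.natDegree) := ⟨j - N, by omega⟩
      rw [Polynomial.coeff_mul_X_pow]
      rcases Nat.eq_zero_or_pos i with rfl | hi
      · rw [add_zero, Nat.add_sub_cancel' hN, Polynomial.coeff_natDegree]; ring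
      · rw [Polynomial.coeff_eq_zero_of_natDegree_lt (p := g) (by omega),
          (Polynomial.degree_lt_iff_coeff_zero _ _).1 hp _ (by omega)]
        ring
    obtain ⟨k, q, r, hr, h⟩ := ih p' hp'
    refine ⟨k + 1, q + Polynomial.C (g.leadingCoeff ^ k * p.coeff N) *
      Polynomial.X ^ (N - g.natDegree), r, hr, ?_⟩
    simp only [p'] at h
    simp only [pow_succ, map_mul] at h ⊢
    linear_combination h

end PseudoDivision

variable {A ι K₁ K₂ : Type*} [CommRing A] [Field K₁] [LinearOrder K₁] [IsStrictOrderedRing K₁]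
  [Field K₂] [LinearOrder K₂] [IsStrictOrderedRing K₂] {ψ : A →+* K₁} {l : Filter ι}
  {e : ι → A →+* K₂}

/-- A polynomial can be trimmed so that its leading coefficient is not killed. -/
theorem exists_trim (hsign : ∀ c, ∀ᶠ i in l, SignType.sign (e i c) = SignType.sign (ψ c))
    (p : A[X]) : ∃ q : A[X], q.map ψ = p.map ψ ∧ (∀ᶠ i in l, q.map (e i) = p.map (e i)) ∧
      (q = 0 ∨ ψ q.leadingCoeff ≠ 0) := by
  suffices H : ∀ (N : ℕ) (p : A[X]), p.support.card = N → ∃ q : A[X], q.map ψ = p.map ψ ∧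
      (∀ᶠ i in l, q.map (e i) = p.map (e i)) ∧ (q = 0 ∨ ψ q.leadingCoeff ≠ 0) from H _ p rfl
  intro N
  induction N using Nat.strong_induction_on with
  | _ N ih =>
  intro p hN
  by_cases hp : p = 0
  · exact ⟨p, rfl, Eventually.of_forall fun _ => rfl, Or.inl hp⟩
  by_cases hlc : ψ p.leadingCoeff = 0
  -- If `ψ` kills the leading coefficient, so does `e i` eventually, because sign `0` is among the
  -- agreeing signs. The leading term can be dropped.
  · obtain ⟨q, h1, h2, h3⟩ := ih _ (hN ▸ Polynomial.eraseLead_support_card_lt hp) p.eraseLead rfl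
    refine ⟨q, ?_, ?_, h3⟩
    · rw [h1]
      conv_rhs => rw [← Polynomial.eraseLead_add_monomial_natDegree_leadingCoeff p]
      rw [Polynomial.map_add, Polynomial.map_monomial, hlc]
      simp
    · filter_upwards [h2, hsign p.leadingCoeff] with i hi hi'
      rw [hlc, sign_zero, sign_eq_zero_iff] at hi'
      rw [hi]
      conv_rhs => rw [← Polynomial.eraseLead_add_monomial_natDegree_leadingCoeff p]
      rw [Polynomial.map_add, Polynomial.map_monomial, hi']
      simp
  · exact ⟨p, rfl, Eventually.of_forall fun _ => rfl, Or.inr hlc⟩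

/-- At a root of `g` one has `c^k p = r`. The remainder is multiplied once more by `c^k` so that
only the positive factor `c^(2k)` appears, whatever the sign of `c`. -/
theorem sign_eval_eq_of_pseudo_division {K : Type*} [Field K] [LinearOrder K]
    [IsStrictOrderedRing K] (φ : A →+* K) {p q g r : A[X]} {k : ℕ} {c : A}
    (h : Polynomial.C (c ^ k) * p = q * g + r) (hφ : φ c ≠ 0) {x : K}
    (hx : (g.map φ).eval x = 0) : SignType.sign ((p.map φ).eval x) =
      SignType.sign (((Polynomial.C (c ^ k) * r).map φ).eval x) := by
  have h1 := congrArg (fun f => (f.map φ).eval x) h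
  simp only [Polynomial.map_mul, Polynomial.map_add, Polynomial.map_C, Polynomial.eval_mul,
    Polynomial.eval_C, Polynomial.eval_add, hx, mul_zero, zero_add] at h1 ⊢
  have h2 : 0 < φ (c ^ k) * φ (c ^ k) := by
    rw [map_pow]
    exact mul_self_pos.2 (pow_ne_zero _ hφ)
  rw [← h1, ← mul_assoc, sign_mul, sign_pos h2, one_mul]

/-- Signs at the roots of `g` are given by a polynomial of smaller degree than `g`. -/
theorem exists_remainder (hsign : ∀ c, ∀ᶠ i in l, SignType.sign (e i c) = SignType.sign (ψ c))
    (p g : A[X]) : ∃ r : A[X], (r = 0 ∨ (r.map ψ).degree < (g.map ψ).degree) ∧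
      (g.map ψ ≠ 0 → ∀ x, (g.map ψ).eval x = 0 →
        SignType.sign ((p.map ψ).eval x) = SignType.sign ((r.map ψ).eval x)) ∧
      (g.map ψ ≠ 0 → ∀ᶠ i in l, ∀ x, (g.map (e i)).eval x = 0 →
        SignType.sign ((p.map (e i)).eval x) = SignType.sign ((r.map (e i)).eval x)) := by
  by_cases hg : g.map ψ = 0
  · exact ⟨0, Or.inl rfl, fun h => absurd hg h, fun h => absurd hg h⟩
  obtain ⟨g', hg1, hg2, hg3⟩ := exists_trim hsign g
  have hg0 : g' ≠ 0 := by
    rintro rfl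
    rw [Polynomial.map_zero] at hg1
    exact hg hg1.symm
  have hlc := hg3.resolve_left hg0
  obtain ⟨k, q, r, h⟩ := exists_pseudo_division g' p
  obtain ⟨hr, h⟩ := h.resolve_right hg0
  set c := g'.leadingCoeff with hc
  refine ⟨Polynomial.C (c ^ k) * r, Or.inr ?_, ?_, ?_⟩
  · rw [← hg1]
    calc ((Polynomial.C (c ^ k) * r).map ψ).degree ≤ (r.map ψ).degree := by
          rw [Polynomial.map_mul, Polynomial.map_C]
          exact (Polynomial.degree_C_mul (by rw [map_pow]; exact pow_ne_zero _ hlc)).le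
      _ ≤ r.degree := Polynomial.degree_map_le
      _ < g'.degree := hr
      _ = (g'.map ψ).degree := (Polynomial.degree_map_eq_of_leadingCoeff_ne_zero ψ hlc).symm
  · intro _ x hx
    exact sign_eval_eq_of_pseudo_division ψ h hlc (hg1 ▸ hx)
  · intro _
    filter_upwards [hg2, hsign c] with i hi hi' x hx
    refine sign_eval_eq_of_pseudo_division (e i) h ?_ (hi ▸ hx)
    intro h0
    rw [h0, sign_zero, eq_comm, sign_eq_zero_iff] at hi'
    exact hlc hi'

/-- After trimming, degree and sign of the leading coefficient agree under `ψ` and eventually under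
`e i`, and they determine the signs at both infinities. -/
theorem eventually_sameSign
    (hsign : ∀ c, ∀ᶠ i in l, SignType.sign (e i c) = SignType.sign (ψ c)) (p : A[X]) :
    ∀ᶠ i in l, SameSign atTop atTop (p.map ψ) (p.map (e i)) ∧
      SameSign atBot atBot (p.map ψ) (p.map (e i)) := by
  obtain ⟨q, h1, h2, h3⟩ := exists_trim hsign p
  rw [← h1]
  filter_upwards [h2, hsign q.leadingCoeff] with i hi hi'
  rw [← hi]
  have h4 := eventually_sign_eval_atTop (q.map ψ)
  have h5 := eventually_sign_eval_atTop (q.map (e i))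
  have h6 := eventually_sign_eval_atBot (q.map ψ)
  have h7 := eventually_sign_eval_atBot (q.map (e i))
  rcases h3 with rfl | h3
  · simp only [Polynomial.map_zero, Polynomial.leadingCoeff_zero, sign_zero, zero_mul]
      at h4 h5 h6 h7 ⊢
    exact ⟨⟨0, h4, h5⟩, ⟨0, h6, h7⟩⟩
  have h3' : e i q.leadingCoeff ≠ 0 := by
    intro h0
    rw [h0, sign_zero, eq_comm, sign_eq_zero_iff] at hi'
    exact h3 hi'
  rw [Polynomial.leadingCoeff_map_of_leadingCoeff_ne_zero _ h3] at h4 h6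
  rw [Polynomial.leadingCoeff_map_of_leadingCoeff_ne_zero _ h3', hi'] at h5 h7
  rw [Polynomial.natDegree_map_of_leadingCoeff_ne_zero _ h3] at h6
  rw [Polynomial.natDegree_map_of_leadingCoeff_ne_zero _ h3'] at h7
  exact ⟨⟨_, h4, h5⟩, ⟨_, h6, h7⟩⟩

variable (ψ e) in
/-- The pairs of images of the elements of `P` under `ψ` and `e i`. -/
def mapPairs (i : ι) (P : Finset A[X]) : Set (K₁[X] × K₂[X]) :=
  (fun p => (p.map ψ, p.map (e i))) '' (P : Set A[X])

theorem mem_mapPairs {i : ι} {P : Finset A[X]} {p : A[X]} (hp : p ∈ P) :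
    (p.map ψ, p.map (e i)) ∈ mapPairs ψ e i P := ⟨p, hp, rfl⟩

theorem mapPairs_mono {i : ι} {P Q : Finset A[X]} (h : P ⊆ Q) :
    mapPairs ψ e i P ⊆ mapPairs ψ e i Q := Set.image_mono (by exact_mod_cast h)

theorem IsMatching.mono {S : Finset (K₁ × K₂)} {𝒬 𝒬' : Set (K₁[X] × K₂[X])}
    (h : IsMatching S 𝒬) (hsub : 𝒬' ⊆ 𝒬) : IsMatching S 𝒬' :=
  ⟨h.iso, fun p hp => h.left p (hsub hp), fun p hp => h.right p (hsub hp),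
    fun y z hyz p hp => h.sign y z hyz p (hsub hp)⟩

/-- If the signs of all coefficients eventually agree, then finite sets of polynomials
eventually have the same pattern of roots and signs. -/
theorem eventually_exists_isMatching (h₁ : PolyIVT K₁) (h₂ : PolyIVT K₂)
    (hsign : ∀ c, ∀ᶠ i in l, SignType.sign (e i c) = SignType.sign (ψ c)) (d : ℕ) :
    ∀ P : Finset A[X], (∀ p ∈ P, (p.map ψ).degree < d) →
      ∀ᶠ i in l, ∃ S, IsMatching S (mapPairs ψ e i P) := by
  classical
  induction d with
  | zero =>
    intro P hP
    have hz : ∀ p ∈ P, p.map ψ = 0 := by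
      intro p hp
      by_contra h
      have := Polynomial.zero_le_degree_iff.2 h
      exact absurd (hP p hp) (not_lt.2 (by exact_mod_cast this))
    have hz' : ∀ᶠ i in l, ∀ p ∈ P, p.map (e i) = 0 := by
      rw [Finset.eventually_all]
      intro p hp
      obtain ⟨q, h1, h2, h3⟩ := exists_trim hsign p
      have hq : q = 0 := by
        rcases h3 with h3 | h3
        · exact h3
        · exfalso
          rw [← Polynomial.leadingCoeff_map_of_leadingCoeff_ne_zero _ h3, h1, hz p hp] at h3
          simp at h3
      filter_upwards [h2] with i hi
      rw [← hi, hq, Polynomial.map_zero]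
    filter_upwards [hz'] with i hi
    refine ⟨∅, by simp [IsPartialIso], ?_, ?_, ?_⟩
    · rintro _ ⟨p, hp, rfl⟩ y h0
      exact absurd (hz p hp) h0
    · rintro _ ⟨p, hp, rfl⟩ y h0
      exact absurd (hi p hp) h0
    · rintro y z _ _ ⟨p, hp, rfl⟩
      simp [hz p hp, hi p hp]
  | succ d ih =>
    -- Inner induction on the set `T` of polynomials of top degree. The set `L` of lower degree
    -- stays arbitrary, since it absorbs derivatives and remainders.
    suffices H : ∀ T : Finset A[X], (∀ p ∈ T, (p.map ψ).degree < (d + 1 : ℕ)) →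
        ∀ L : Finset A[X], (∀ p ∈ L, (p.map ψ).degree < d) →
        ∀ᶠ i in l, ∃ S, IsMatching S (mapPairs ψ e i (L ∪ T)) by
      intro P hP
      simpa using H P hP ∅ (by simp)
    intro T
    induction T using Finset.induction_on with
    | empty =>
      intro _ L hL
      simpa using ih L hL
    | insert p T _ ihT =>
      intro hT L hL
      have hpd := hT p (Finset.mem_insert_self _ _)
      have hT' : ∀ q ∈ T, (q.map ψ).degree < (d + 1 : ℕ) :=
        fun q hq => hT q (Finset.mem_insert_of_mem hq)
      have hle : ∀ {x : WithBot ℕ}, x < (d + 1 : ℕ) → x ≤ d := by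
        intro x hx
        induction x using WithBot.recBotCoe with
        | bot => exact bot_le
        | coe n =>
          have : n < d + 1 := WithBot.coe_lt_coe.1 hx
          exact WithBot.coe_le_coe.2 (Nat.lt_succ_iff.1 this)
      have hbot : (⊥ : WithBot ℕ) < d := WithBot.bot_lt_coe d
      have hder : (p.derivative.map ψ).degree < d := by
        rw [← Polynomial.derivative_map]
        by_cases h0 : p.map ψ = 0
        · rw [h0, Polynomial.derivative_zero, Polynomial.degree_zero]; exact hbot
        · exact (Polynomial.degree_derivative_lt h0).trans_le (hle hpd)
      let G := insert p.derivative (L ∪ T)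
      have hG : ∀ g ∈ G, (g.map ψ).degree ≤ d := by
        intro g hg
        rcases Finset.mem_insert.1 hg with rfl | hg
        · exact hder.le
        rcases Finset.mem_union.1 hg with hg | hg
        · exact (hL g hg).le
        · exact hle (hT' g hg)
      choose r hr hr₁ hr₂ using fun g => exists_remainder hsign p g
      -- The sign of `p` at a root of `g ∈ G` is that of the remainder `r g`, whose degree is below
      -- `d`. Thus `p` is traded for polynomials already covered by the induction.
      let L' := insert p.derivative L ∪ G.image r
      have hL' : ∀ q ∈ L', (q.map ψ).degree < d := by
        intro q hq
        rcases Finset.mem_union.1 hq with hq | hq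
        · rcases Finset.mem_insert.1 hq with rfl | hq
          · exact hder
          · exact hL q hq
        · obtain ⟨g, hg, rfl⟩ := Finset.mem_image.1 hq
          rcases hr g with h0 | h0
          · rw [h0, Polynomial.map_zero, Polynomial.degree_zero]; exact hbot
          · exact h0.trans_le (hG g hg)
      have hr₂' : ∀ᶠ i in l, ∀ g ∈ G, g.map ψ ≠ 0 → ∀ x, (g.map (e i)).eval x = 0 →
          SignType.sign ((p.map (e i)).eval x) = SignType.sign (((r g).map (e i)).eval x) := by
        rw [Finset.eventually_all]
        intro g _
        by_cases h0 : g.map ψ = 0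
        · exact Eventually.of_forall fun i h => absurd h0 h
        · exact (hr₂ g h0).mono fun i hi _ => hi
      filter_upwards [ihT hT' L' hL', hr₂', eventually_sameSign hsign p] with i hi hri hends
      obtain ⟨S, hS⟩ := hi
      have hGsub : G ⊆ L' ∪ T := by
        intro g hg
        simp only [G, L', Finset.mem_insert, Finset.mem_union] at hg ⊢
        tauto
      -- The matching also contains roots of the remainders, where the sign of `p` is not known.
      -- Restricting to `G` removes them.
      obtain ⟨S', hS', hM, hroots⟩ := hS.restrict h₂ (mapPairs_mono hGsub)
      obtain ⟨S'', hS''⟩ := hM.exists_insert (p := (p.map ψ, p.map (e i))) h₁ h₂ (by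
          simp only [Polynomial.derivative_map]
          exact mem_mapPairs (Finset.mem_insert_self _ _)) (by
          intro s hs
          obtain ⟨_, ⟨g, hg, rfl⟩, h3, h4, h5, h6⟩ := hroots s hs
          have hg' : g ∈ G := hg
          simp only at h3 h4 h5 h6 ⊢
          rw [hr₁ g h3 _ h5, hri g hg' h3 _ h6]
          refine hS.sign s.1 s.2 (hS.iso s (hS' hs)) (_, _) (mem_mapPairs (p := r g) ?_)
          exact Finset.mem_union_left _ (Finset.mem_union_right _ (Finset.mem_image_of_mem r hg')))
        hends.1 hends.2
      refine ⟨S'', hS''.mono ?_⟩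
      rintro _ ⟨q, hq, rfl⟩
      have hq' : q = p ∨ q ∈ G := by
        have hq : q ∈ L ∪ insert p T := hq
        simp only [G, Finset.mem_insert, Finset.mem_union] at hq ⊢
        tauto
      rcases hq' with rfl | hq'
      · exact Set.mem_insert _ _
      · exact Set.mem_insert_of_mem _ (mem_mapPairs hq')

end RealAlgebra

/-! ### Tarski transfer to real points -/

namespace RealAlgebra

open scoped Polynomial

open Filter

/-- Positive reals are nonzero squares, so every homomorphism to an ordered field preserves signs.
-/
theorem sign_map_real {K : Type*} [Field K] [LinearOrder K] [IsStrictOrderedRing K]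
    (φ : ℝ →+* K) (c : ℝ) : SignType.sign (φ c) = SignType.sign c := by
  have hpos : ∀ c : ℝ, 0 < c → 0 < φ c := by
    intro c hc
    have h1 : φ c = φ (Real.sqrt c) * φ (Real.sqrt c) := by
      rw [← map_mul, Real.mul_self_sqrt hc.le]
    rw [h1]
    exact mul_self_pos.2 ((map_ne_zero φ).2 (Real.sqrt_pos.2 hc).ne')
  rcases lt_trichotomy c 0 with h | h | h
  · have := hpos (-c) (neg_pos.2 h)
    rw [map_neg, neg_pos] at this
    rw [sign_neg h, sign_neg this]
  · simp [h]
  · rw [sign_pos h, sign_pos (hpos c h)]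

/-- Tarski transfer: a sign condition on finitely many real polynomials which is realised over an
ordered field with the intermediate value property for polynomials is realised by a real point. -/
theorem exists_real_point {K : Type*} [Field K] [LinearOrder K] [IsStrictOrderedRing K]
    (hK : PolyIVT K) (n : ℕ) (ψ : MvPolynomial (Fin n) ℝ →+* K)
    (Q : Finset (MvPolynomial (Fin n) ℝ)) :
    ∃ x : Fin n → ℝ, ∀ q ∈ Q, SignType.sign (eval x q) = SignType.sign (ψ q) := by
  classical
  induction n with
  | zero =>
    refine ⟨Fin.elim0, fun q _ => ?_⟩
    rw [MvPolynomial.eq_C_of_isEmpty q, eval_C]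
    exact (sign_map_real (ψ.comp C) _).symm
  | succ n ih =>
    let Φ := finSuccEquiv ℝ n
    let ψ' : MvPolynomial (Fin n) ℝ →+* K :=
      ψ.comp ((Φ.symm : _ →+* _).comp Polynomial.C)
    -- For each finite set of coefficients there is a real point with the right signs. Along `atTop`
    -- on finite sets, every single coefficient eventually gets the sign prescribed by `ψ'`.
    choose a ha using fun Q => ih ψ' Q
    have hev := eventually_exists_isMatching (l := atTop) (ψ := ψ') (e := fun Q => eval (a Q))
      hK polyIVT_real (by
        intro c
        filter_upwards [eventually_ge_atTop {c}] with Q hQ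
        exact ha Q c (hQ (Finset.mem_singleton_self c)))
    let P := Q.image Φ
    obtain ⟨d, hd⟩ : ∃ d : ℕ, ∀ p ∈ P, (p.map ψ').degree < d := by
      refine ⟨P.sup Polynomial.natDegree + 1, fun p hp => ?_⟩
      have h1 : p.natDegree ≤ P.sup Polynomial.natDegree := Finset.le_sup hp
      refine lt_of_le_of_lt (Polynomial.degree_map_le.trans Polynomial.degree_le_natDegree) ?_
      exact_mod_cast Nat.lt_succ_of_le h1
    obtain ⟨Q', S, hS⟩ := (hev d P hd).exists
    -- The value of the remaining variable in `K` is replaced by a real number in the corresponding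
    -- cell.
    obtain ⟨z, hz⟩ := hS.iso.exists_compat (ψ (X 0))
    refine ⟨Fin.cons z (a Q'), fun q hq => ?_⟩
    have h1 := hS.sign _ _ hz _ (mem_mapPairs (Finset.mem_image_of_mem Φ hq))
    simp only at h1
    rw [eval_eq_eval_mv_eval', ← h1]
    congr 1
    rw [Polynomial.eval_map]
    have hhom : Polynomial.eval₂RingHom ψ' (ψ (X 0)) = ψ.comp (Φ.symm : _ →+* _) := by
      apply Polynomial.ringHom_ext
      · intro c
        simp [ψ']
      · have : Φ.symm Polynomial.X = X 0 := by
          rw [AlgEquiv.symm_apply_eq]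
          exact finSuccEquiv_X_zero.symm
        simp [this]
    have h2 := congrArg (fun φ : _ →+* K => φ (Φ q)) hhom
    simpa using h2

end RealAlgebra

/-! ### Archimedean quadratic modules and real characters -/

namespace RealAlgebra

/-- A quadratic module of a commutative ring, given as a set. -/
structure IsQuadMod {A : Type*} [CommRing A] (Q : Set A) : Prop where
  one_mem : (1 : A) ∈ Q
  add_mem : ∀ {a b}, a ∈ Q → b ∈ Q → a + b ∈ Q
  sq_mul_mem : ∀ (a) {b}, b ∈ Q → a * a * b ∈ Q

namespace IsQuadMod

variable {A : Type*} [CommRing A] {Q : Set A}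

theorem zero_mem (hQ : IsQuadMod Q) : (0 : A) ∈ Q := by
  simpa using hQ.sq_mul_mem 0 hQ.one_mem

theorem sumSq_mul_mem (hQ : IsQuadMod Q) {s a : A} (hs : IsSumSq s) (ha : a ∈ Q) :
    s * a ∈ Q := by
  induction hs with
  | zero => simpa using hQ.zero_mem
  | sq_add b _ ih => rw [add_mul]; exact hQ.add_mem (hQ.sq_mul_mem b ha) ih

theorem sumSq_mem (hQ : IsQuadMod Q) {s : A} (hs : IsSumSq s) : s ∈ Q := by
  simpa using hQ.sumSq_mul_mem hs hQ.one_mem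

variable [Algebra ℝ A]

theorem isSumSq_algebraMap {c : ℝ} (hc : 0 ≤ c) : IsSumSq (algebraMap ℝ A c) := by
  rw [← Real.mul_self_sqrt hc, map_mul]
  exact IsSumSq.mul_self _

theorem const_mul_mem (hQ : IsQuadMod Q) {c : ℝ} (hc : 0 ≤ c) {a : A} (ha : a ∈ Q) :
    algebraMap ℝ A c * a ∈ Q := hQ.sumSq_mul_mem (isSumSq_algebraMap hc) ha

theorem const_mem (hQ : IsQuadMod Q) {c : ℝ} (hc : 0 ≤ c) : algebraMap ℝ A c ∈ Q :=
  hQ.sumSq_mem (isSumSq_algebraMap hc)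

theorem mem_of_const_mul_mem (hQ : IsQuadMod Q) {c : ℝ} (hc : 0 < c) {a : A}
    (ha : algebraMap ℝ A c * a ∈ Q) : a ∈ Q := by
  have := hQ.const_mul_mem (inv_nonneg.2 hc.le) ha
  rwa [← mul_assoc, ← map_mul, inv_mul_cancel₀ hc.ne', map_one, one_mul] at this

theorem nonneg_of_const_mem (hQ : IsQuadMod Q) (hneg : (-1 : A) ∉ Q) {c : ℝ}
    (hc : algebraMap ℝ A c ∈ Q) : 0 ≤ c := by
  by_contra h
  push Not at h
  apply hneg
  apply hQ.mem_of_const_mul_mem (neg_pos.2 h)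
  rwa [map_neg, neg_mul_neg, mul_one]

/-- The bound `N² - a²` follows from `-N ≤ a ≤ N`. -/
theorem sq_sub_sq_mem (hQ : IsQuadMod Q) {a : A} {N : ℝ} (hN : 0 < N)
    (h₁ : algebraMap ℝ A N - a ∈ Q) (h₂ : algebraMap ℝ A N + a ∈ Q) :
    algebraMap ℝ A (N * N) - a * a ∈ Q := by
  apply hQ.mem_of_const_mul_mem (c := 2 * N) (by positivity)
  -- The identity is `2N(N² - a²) = (N - a)²(N + a) + (N + a)²(N - a)`.
  have := hQ.add_mem (hQ.sq_mul_mem (algebraMap ℝ A N - a) h₂)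
    (hQ.sq_mul_mem (algebraMap ℝ A N + a) h₁)
  convert this using 1
  simp only [map_mul, map_ofNat]
  ring

/-- A proper quadratic module is contained in a proper one which contains `a` or `-a` for
every `a`. -/
theorem exists_total (hQ : IsQuadMod Q) (hneg : (-1 : A) ∉ Q) :
    ∃ Q' : Set A, Q ⊆ Q' ∧ IsQuadMod Q' ∧ (-1 : A) ∉ Q' ∧ ∀ a, a ∈ Q' ∨ -a ∈ Q' := by
  obtain ⟨M, hQM, ⟨hM, hMneg⟩, hmax⟩ := zorn_subset_nonempty
    {S : Set A | IsQuadMod S ∧ (-1 : A) ∉ S} (by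
    intro c hc hchain hne
    obtain ⟨s₀, hs₀⟩ := hne
    refine ⟨⋃₀ c, ⟨⟨⟨s₀, hs₀, (hc hs₀).1.one_mem⟩, ?_, ?_⟩, ?_⟩,
      fun s hs => Set.subset_sUnion_of_mem hs⟩
    · rintro a b ⟨s, hs, ha⟩ ⟨t, ht, hb⟩
      rcases hchain.total hs ht with h | h
      · exact ⟨t, ht, (hc ht).1.add_mem (h ha) hb⟩
      · exact ⟨s, hs, (hc hs).1.add_mem ha (h hb)⟩
    · rintro a b ⟨s, hs, hb⟩
      exact ⟨s, hs, (hc hs).1.sq_mul_mem a hb⟩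
    · rintro ⟨s, hs, h⟩
      exact (hc hs).2 h) Q ⟨hQ, hneg⟩
  have key : ∀ a, a ∉ M → ∃ m ∈ M, ∃ σ : A, IsSumSq σ ∧ -1 = m + σ * a := by
    intro a ha
    by_contra hcon
    let S : Set A := {x | ∃ m ∈ M, ∃ σ : A, IsSumSq σ ∧ x = m + σ * a}
    have hS : IsQuadMod S := by
      refine ⟨⟨1, hM.one_mem, 0, IsSumSq.zero, by ring⟩, ?_, ?_⟩
      · rintro _ _ ⟨m, hm, σ, hσ, rfl⟩ ⟨m', hm', σ', hσ', rfl⟩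
        exact ⟨m + m', hM.add_mem hm hm', σ + σ', hσ.add hσ', by ring⟩
      · rintro b _ ⟨m, hm, σ, hσ, rfl⟩
        exact ⟨b * b * m, hM.sq_mul_mem b hm, b * b * σ, (IsSumSq.mul_self b).mul hσ, by ring⟩
    exact ha (hmax ⟨hS, hcon⟩ (fun x hx => ⟨x, hx, 0, IsSumSq.zero, by ring⟩)
      ⟨0, hM.zero_mem, 1, IsSumSq.one, by ring⟩)
  refine ⟨M, hQM, hM, hMneg, fun a => ?_⟩
  by_contra! hcon
  obtain ⟨m, hm, σ, hσ, h1⟩ := key a hcon.1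
  obtain ⟨m', hm', σ', hσ', h2⟩ := key (-a) hcon.2
  -- Eliminating `a` from `-1 = m + σ a` and `-1 = m' - σ' a` leaves minus a sum of squares in `M`.
  have h3 : -(σ + σ') ∈ M := by
    have : -(σ + σ') = σ' * m + σ * m' := by linear_combination σ' * h1 + σ * h2
    rw [this]
    exact hM.add_mem (hM.sumSq_mul_mem hσ' hm) (hM.sumSq_mul_mem hσ hm')
  have h4 : -σ ∈ M := by
    have : -σ = -(σ + σ') + σ' := by ring
    rw [this]
    exact hM.add_mem h3 (hM.sumSq_mem hσ')
  -- Both `σ` and `-σ` are in `M`, and `4σa = (a + 1)²σ - (a - 1)²σ`.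
  have h5 : σ * a ∈ M := by
    apply hM.mem_of_const_mul_mem (c := 4) (by norm_num)
    have : algebraMap ℝ A 4 * (σ * a) = (a + 1) * (a + 1) * σ + (a - 1) * (a - 1) * (-σ) := by
      rw [map_ofNat]; ring
    rw [this]
    exact hM.add_mem (hM.sq_mul_mem _ (hM.sumSq_mem hσ)) (hM.sq_mul_mem _ h4)
  exact hMneg (h1 ▸ hM.add_mem hm h5)

/-- `Q` is archimedean in the sense that every element is bounded. -/
def Bounds (Q : Set A) : Prop := ∀ a : A, ∃ N : ℝ, algebraMap ℝ A N - a ∈ Q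

/-- `a` is infinitely close to the real number `r` modulo `Q`. -/
def Near (Q : Set A) (a : A) (r : ℝ) : Prop :=
  ∀ ε : ℝ, 0 < ε → algebraMap ℝ A (r + ε) - a ∈ Q ∧ a - algebraMap ℝ A (r - ε) ∈ Q

theorem Near.add (hQ : IsQuadMod Q) {a b : A} {r s : ℝ} (ha : Near Q a r) (hb : Near Q b s) :
    Near Q (a + b) (r + s) := by
  intro ε hε
  obtain ⟨h1, h2⟩ := ha (ε / 2) (by positivity)
  obtain ⟨h3, h4⟩ := hb (ε / 2) (by positivity)
  have e1 : r + s + ε = (r + ε / 2) + (s + ε / 2) := by ring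
  have e2 : r + s - ε = (r - ε / 2) + (s - ε / 2) := by ring
  rw [e1, e2]
  simp only [map_add, map_sub] at h1 h2 h3 h4 ⊢
  constructor
  · convert hQ.add_mem h1 h3 using 1; ring
  · convert hQ.add_mem h2 h4 using 1; ring

theorem near_const (hQ : IsQuadMod Q) (r : ℝ) : Near Q (algebraMap ℝ A r) r := by
  intro ε hε
  rw [← map_sub, ← map_sub]
  exact ⟨hQ.const_mem (by linarith), hQ.const_mem (by linarith)⟩

theorem Near.const_mul (hQ : IsQuadMod Q) {a : A} {r : ℝ} (ha : Near Q a r) (c : ℝ) :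
    Near Q (algebraMap ℝ A c * a) (c * r) := by
  intro ε hε
  rcases lt_trichotomy c 0 with hc | hc | hc
  · have hc0 : c ≠ 0 := hc.ne
    obtain ⟨h1, h2⟩ := ha (ε / (-c)) (div_pos hε (neg_pos.2 hc))
    have e1 : c * r + ε = (-c) * -(r - ε / (-c)) := by rw [div_neg]; field_simp; ring
    have e2 : c * r - ε = (-c) * -(r + ε / (-c)) := by rw [div_neg]; field_simp; ring
    have h3 := hQ.const_mul_mem (neg_pos.2 hc).le h1
    have h4 := hQ.const_mul_mem (neg_pos.2 hc).le h2
    rw [e1, e2]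
    simp only [map_mul, map_neg] at h3 h4 ⊢
    constructor
    · convert h4 using 1; ring
    · convert h3 using 1; ring
  · subst hc
    simp only [zero_mul, map_zero, sub_zero, zero_add, zero_sub, map_neg, neg_neg]
    exact ⟨hQ.const_mem hε.le, hQ.const_mem hε.le⟩
  · obtain ⟨h1, h2⟩ := ha (ε / c) (div_pos hε hc)
    have e1 : c * r + ε = c * (r + ε / c) := by field_simp
    have e2 : c * r - ε = c * (r - ε / c) := by field_simp
    rw [e1, e2, map_mul, map_mul, ← mul_sub, ← mul_sub]
    exact ⟨hQ.const_mul_mem hc.le h1, hQ.const_mul_mem hc.le h2⟩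

/-- Write `a² = (a - r)² + 2r(a - r) + r²`; the first term is infinitely small by `sq_sub_sq_mem`
with `N = √ε`. -/
theorem Near.sq (hQ : IsQuadMod Q) {a : A} {r : ℝ} (ha : Near Q a r) :
    Near Q (a * a) (r * r) := by
  have hd : Near Q (a + algebraMap ℝ A (-r)) 0 := by
    simpa using ha.add hQ (near_const hQ (-r))
  have hd2 : Near Q ((a + algebraMap ℝ A (-r)) * (a + algebraMap ℝ A (-r))) 0 := by
    intro ε hε
    have hs := Real.sqrt_pos.2 hε
    obtain ⟨h1, h2⟩ := hd (Real.sqrt ε) hs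
    rw [zero_add] at h1 ⊢
    rw [zero_sub] at h2 ⊢
    rw [map_neg _ (Real.sqrt ε), sub_neg_eq_add] at h2
    rw [map_neg _ ε, sub_neg_eq_add]
    constructor
    · have := hQ.sq_sub_sq_mem hs h1 (by rwa [add_comm] at h2)
      rwa [Real.mul_self_sqrt hε.le] at this
    · exact hQ.add_mem (hQ.sumSq_mem (IsSumSq.mul_self _)) (hQ.const_mem hε.le)
  have := (hd2.add hQ (hd.const_mul hQ (2 * r))).add hQ (near_const hQ (r * r))
  convert this using 1
  · simp only [map_mul, map_neg, map_ofNat]; ring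
  · ring

/-- Polarization: `4ab = (a + b)² - (a - b)²`. -/
theorem Near.mul (hQ : IsQuadMod Q) {a b : A} {r s : ℝ} (ha : Near Q a r) (hb : Near Q b s) :
    Near Q (a * b) (r * s) := by
  have h1 := (ha.add hQ hb).sq hQ
  have h2 := (ha.add hQ (hb.const_mul hQ (-1))).sq hQ
  have h3 := (h1.const_mul hQ (1 / 4)).add hQ (h2.const_mul hQ (-1 / 4))
  have e : algebraMap ℝ A (1 / 4) * 4 = 1 := by
    rw [← map_ofNat (algebraMap ℝ A) 4, ← map_mul]; norm_num
  have e' : algebraMap ℝ A (-1 / 4) = - algebraMap ℝ A (1 / 4) := by rw [← map_neg]; norm_num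
  convert h3 using 1
  · rw [e', map_neg, map_one]
    linear_combination (-(a * b)) * e
  · ring

theorem Near.le (hQ : IsQuadMod Q) (hneg : (-1 : A) ∉ Q) {a : A} {r s : ℝ} (ha : Near Q a r)
    (hb : Near Q a s) : r ≤ s := by
  refine le_of_forall_pos_le_add fun ε hε => ?_
  have h1 := (ha (ε / 2) (by positivity)).2
  have h2 := (hb (ε / 2) (by positivity)).1
  have h3 := hQ.add_mem h2 h1
  rw [sub_add_sub_cancel, ← map_sub] at h3
  have := hQ.nonneg_of_const_mem hneg h3
  linarith

theorem Near.unique (hQ : IsQuadMod Q) (hneg : (-1 : A) ∉ Q) {a : A} {r s : ℝ} (ha : Near Q a r)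
    (hb : Near Q a s) : r = s := le_antisymm (ha.le hQ hneg hb) (hb.le hQ hneg ha)

/-- A proper archimedean quadratic module is nonnegative for some real character. -/
theorem exists_algHom (hQ : IsQuadMod Q) (hneg : (-1 : A) ∉ Q) (hb : Bounds Q) :
    ∃ φ : A →ₐ[ℝ] ℝ, ∀ q ∈ Q, 0 ≤ φ q := by
  obtain ⟨M, hQM, hM, hMneg, htot⟩ := hQ.exists_total hneg
  have hex : ∀ a, ∃ r, Near M a r := by
    intro a
    -- The value of the character at `a` is the infimum of its upper bounds modulo `M`. Totality of
    -- `M` turns every number that is not an upper bound into a lower bound.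
    let S : Set ℝ := {r | algebraMap ℝ A r - a ∈ M}
    have hne : S.Nonempty := by
      obtain ⟨N, hN⟩ := hb a
      exact ⟨N, hQM hN⟩
    have hbdd : BddBelow S := by
      obtain ⟨N, hN⟩ := hb (-a)
      refine ⟨-N, fun r hr => ?_⟩
      have h1 := hM.add_mem (hQM hN) hr
      have h2 : algebraMap ℝ A (N + r) ∈ M := by
        convert h1 using 1
        rw [map_add]; ring
      have := hM.nonneg_of_const_mem hMneg h2
      linarith
    refine ⟨sInf S, fun ε hε => ⟨?_, ?_⟩⟩
    · obtain ⟨r, hr, hlt⟩ := exists_lt_of_csInf_lt hne (lt_add_of_pos_right (sInf S) hε)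
      have := hM.add_mem hr (hM.const_mem (sub_nonneg.2 hlt.le))
      convert this using 1
      rw [map_sub]; ring
    · have h1 : sInf S - ε ∉ S := fun h => by
        have := csInf_le hbdd h
        linarith
      have := (htot (algebraMap ℝ A (sInf S - ε) - a)).resolve_left h1
      rwa [neg_sub] at this
  choose φ hφ using hex
  have huniq : ∀ {a r}, Near M a r → φ a = r := fun h => (hφ _).unique hM hMneg h
  refine ⟨{ toFun := φ
            map_one' := huniq (by simpa using near_const hM 1)
            map_mul' := fun a b => huniq ((hφ a).mul hM (hφ b))
            map_zero' := huniq (by simpa using near_const hM 0)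
            map_add' := fun a b => huniq ((hφ a).add hM (hφ b))
            commutes' := fun r => huniq (near_const hM r) }, fun q hq => ?_⟩
  change 0 ≤ φ q
  refine le_of_forall_pos_le_add fun ε hε => ?_
  have h1 := hM.add_mem (hφ q ε hε).1 (hQM hq)
  rw [sub_add_cancel] at h1
  exact hM.nonneg_of_const_mem hMneg h1

/-- In an archimedean quadratic module, `f σ - 1 ∈ Q` forces `f + r ∈ Q` for all `r > 0`. -/
theorem add_const_mem_of_mul_sub_one_mem (hQ : IsQuadMod Q) (hb : Bounds Q) {f σ : A}
    (hσ : IsSumSq σ) (h : σ * f - 1 ∈ Q) {r₀ : ℝ} (hr₀ : 0 < r₀) :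
    f + algebraMap ℝ A r₀ ∈ Q := by
  obtain ⟨N₁, hN₁⟩ := hb (σ * f)
  obtain ⟨N₂, hN₂⟩ := hb σ
  have hmono : ∀ {N N' : ℝ} {a : A}, N ≤ N' → algebraMap ℝ A N - a ∈ Q →
      algebraMap ℝ A N' - a ∈ Q := by
    intro N N' a hle ha
    have := hQ.add_mem ha (hQ.const_mem (sub_nonneg.2 hle))
    convert this using 1
    rw [map_sub]; ring
  set N := max 1 (max N₁ N₂) with hN
  have hN1 : 1 ≤ N := le_max_left _ _
  replace hN₁ : algebraMap ℝ A N - σ * f ∈ Q :=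
    hmono ((le_max_left _ _).trans (le_max_right _ _)) hN₁
  replace hN₂ : algebraMap ℝ A N - σ ∈ Q :=
    hmono ((le_max_right _ _).trans (le_max_right _ _)) hN₂
  let S : Set ℝ := {r | f + algebraMap ℝ A r ∈ Q}
  have hup : ∀ {r r' : ℝ}, r ≤ r' → r ∈ S → r' ∈ S := by
    intro r r' hle hr
    have := hQ.add_mem hr (hQ.const_mem (sub_nonneg.2 hle))
    change f + algebraMap ℝ A r' ∈ Q
    convert this using 1
    rw [map_sub]; ring
  by_contra hno
  have hlow : ∀ r ∈ S, r₀ ≤ r := fun r hr => not_lt.1 fun hlt => hno (hup hlt.le hr)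
  have hne : S.Nonempty := by
    obtain ⟨r, hr⟩ := hb (-f)
    refine ⟨r, ?_⟩
    change f + algebraMap ℝ A r ∈ Q
    rwa [sub_neg_eq_add, add_comm] at hr
  have hbdd : BddBelow S := ⟨r₀, hlow⟩
  -- This choice ensures `2kr ≥ N + rN` for all `r ≥ r₀`, so one step size `2 / k` serves all such
  -- `r`. A fixed decrease from every element of `S` contradicts the existence of its infimum.
  set k : ℝ := N / r₀ + N with hk
  have hkpos : 0 < k := by positivity
  have hstep : ∀ r ∈ S, r - 2 / k ∈ S := by
    intro r hr
    have hr0 := hlow r hr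
    have hrpos : 0 < r := hr₀.trans_le hr0
    change f + algebraMap ℝ A (r - 2 / k) ∈ Q
    apply hQ.mem_of_const_mul_mem (c := k * k) (by positivity)
    have hconst : 0 ≤ 2 * k * r - N - r * N := by
      have h1 : N ≤ r * (N / r₀) := by
        rw [mul_div_assoc', le_div_iff₀ hr₀, mul_comm]
        exact mul_le_mul_of_nonneg_right hr0 (by linarith)
      have h2 : 0 ≤ N / r₀ := by positivity
      have : 2 * k * r - N - r * N = (r * (N / r₀) - N) + r * (N / r₀) + r * N := by
        rw [hk]; ring
      rw [this]
      have h3 : 0 ≤ r * (N / r₀) := by positivity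
      have h4 : 0 ≤ r * N := by positivity
      linarith
    have hb' : algebraMap ℝ A (2 * k * r) - σ * (f + algebraMap ℝ A r) ∈ Q := by
      have := hQ.add_mem (hQ.add_mem hN₁ (hQ.const_mul_mem hrpos.le hN₂)) (hQ.const_mem hconst)
      convert this using 1
      simp only [map_sub, map_mul]; ring
    -- The identity is `k²(f + r - 2/k) = (k - σ)²(f + r) + 2k(σf - 1) + σ(2kr - σ(f + r))`.
    have := hQ.add_mem (hQ.add_mem (hQ.sq_mul_mem (algebraMap ℝ A k - σ) hr)
      (hQ.const_mul_mem (c := 2 * k) (by positivity) h)) (hQ.sumSq_mul_mem hσ hb')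
    convert this using 1
    have hkk : algebraMap ℝ A k * algebraMap ℝ A (2 / k) = 2 := by
      rw [← map_mul, mul_div_cancel₀ _ hkpos.ne', map_ofNat]
    simp only [map_sub, map_mul, map_ofNat]
    linear_combination (-algebraMap ℝ A k) * hkk
  obtain ⟨r, hr, hlt⟩ := exists_lt_of_csInf_lt hne
    (lt_add_of_pos_right (sInf S) (div_pos two_pos hkpos))
  have := csInf_le hbdd (hstep r hr)
  linarith

/-- An archimedean quadratic module contains every element which is positive for all real
characters that are nonnegative on the module. -/
theorem mem_of_forall_algHom_pos (hQ : IsQuadMod Q) (hb : Bounds Q) {f : A}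
    (hf : ∀ φ : A →ₐ[ℝ] ℝ, (∀ q ∈ Q, 0 ≤ φ q) → 0 < φ f) : f ∈ Q := by
  -- Adjoining `-f` leaves no real character that is nonnegative on the module, so `-1` enters,
  -- which means `σ f = 1 + m`.
  let S : Set A := {x | ∃ m ∈ Q, ∃ σ : A, IsSumSq σ ∧ x = m - σ * f}
  have hQS : Q ⊆ S := fun x hx => ⟨x, hx, 0, IsSumSq.zero, by ring⟩
  have hS : IsQuadMod S := by
    refine ⟨hQS hQ.one_mem, ?_, ?_⟩
    · rintro _ _ ⟨m, hm, σ, hσ, rfl⟩ ⟨m', hm', σ', hσ', rfl⟩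
      exact ⟨m + m', hQ.add_mem hm hm', σ + σ', hσ.add hσ', by ring⟩
    · rintro b _ ⟨m, hm, σ, hσ, rfl⟩
      exact ⟨b * b * m, hQ.sq_mul_mem b hm, b * b * σ, (IsSumSq.mul_self b).mul hσ, by ring⟩
  have hneg : (-1 : A) ∈ S := by
    by_contra hcon
    obtain ⟨φ, hφ⟩ := hS.exists_algHom hcon fun a => (hb a).imp fun N hN => hQS hN
    have h1 := hf φ fun q hq => hφ q (hQS hq)
    have h2 := hφ (-f) ⟨0, hQ.zero_mem, 1, IsSumSq.one, by ring⟩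
    rw [map_neg] at h2
    linarith
  obtain ⟨m, hm, σ, hσ, h⟩ := hneg
  obtain ⟨N, hN⟩ := hb σ
  have hNpos : 0 < max 1 N := lt_max_of_lt_left one_pos
  replace hN : algebraMap ℝ A (max 1 N) - σ ∈ Q := by
    have := hQ.add_mem hN (hQ.const_mem (sub_nonneg.2 (le_max_right 1 N)))
    convert this using 1
    rw [map_sub]; ring
  -- The slack in `σ f = 1 + m` allows `f` to be lowered by `ε`: with `N` the bound on `σ`, `2σ(f -
  -- ε) - 1 = 2m + 2ε(N - σ)`. The preceding lemma for `f - ε` then gives `f` itself.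
  set ε : ℝ := 1 / (2 * max 1 N) with hε
  have hεpos : 0 < ε := by positivity
  have hmem : algebraMap ℝ A 2 * σ * (f - algebraMap ℝ A ε) - 1 ∈ Q := by
    have := hQ.add_mem (hQ.const_mul_mem (c := 2) (by norm_num) hm)
      (hQ.const_mul_mem (c := 2 * ε) (by positivity) hN)
    convert this using 1
    have h2 : algebraMap ℝ A ε * (2 * algebraMap ℝ A (max 1 N)) = 1 := by
      rw [← map_ofNat (algebraMap ℝ A) 2, ← map_mul, ← map_mul, hε,
        one_div_mul_cancel (by positivity), map_one]
    simp only [map_mul, map_ofNat]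
    linear_combination (2 : A) * h - h2
  have := hQ.add_const_mem_of_mul_sub_one_mem hb
    ((isSumSq_algebraMap (A := A) (c := 2) (by norm_num)).mul hσ) hmem hεpos
  simpa using this

end IsQuadMod

end RealAlgebra

/-! ### Compactness implies boundedness; Putinar's theorem -/

namespace RealAlgebra

/-- The preordering `T + T p` generated by a preordering `T` and an element `p`. -/
def adjoinPreordering {A : Type*} [CommRing A] (T : Subsemiring A) (hT : ∀ a, a * a ∈ T) (p : A) :
    Subsemiring A where
  carrier := {x | ∃ s ∈ T, ∃ t ∈ T, x = s + t * p}
  zero_mem' := ⟨0, T.zero_mem, 0, T.zero_mem, by ring⟩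
  one_mem' := ⟨1, T.one_mem, 0, T.zero_mem, by ring⟩
  add_mem' := by
    rintro _ _ ⟨s, hs, t, ht, rfl⟩ ⟨s', hs', t', ht', rfl⟩
    exact ⟨s + s', T.add_mem hs hs', t + t', T.add_mem ht ht', by ring⟩
  mul_mem' := by
    rintro _ _ ⟨s, hs, t, ht, rfl⟩ ⟨s', hs', t', ht', rfl⟩
    exact ⟨s * s' + t * t' * (p * p), T.add_mem (T.mul_mem hs hs')
      (T.mul_mem (T.mul_mem ht ht') (hT p)), s * t' + t * s',
      T.add_mem (T.mul_mem hs ht') (T.mul_mem ht hs'), by ring⟩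

section Adjoin

variable {A : Type*} [CommRing A] {T : Subsemiring A} {hT : ∀ a, a * a ∈ T} {p : A}

theorem le_adjoinPreordering : T ≤ adjoinPreordering T hT p :=
  fun x hx => ⟨x, hx, 0, T.zero_mem, by ring⟩

theorem mem_adjoinPreordering_self : p ∈ adjoinPreordering T hT p :=
  ⟨0, T.zero_mem, 1, T.one_mem, by ring⟩

theorem mul_self_mem_adjoinPreordering (a : A) : a * a ∈ adjoinPreordering T hT p :=
  le_adjoinPreordering (hT a)

end Adjoin

theorem isQuadMod_of_preordering {A : Type*} [CommRing A] {T : Subsemiring A}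
    (hT : ∀ a, a * a ∈ T) : IsQuadMod (T : Set A) :=
  ⟨T.one_mem, fun ha hb => T.add_mem ha hb, fun a _ hb => T.mul_mem (hT a) hb⟩

namespace IsQuadMod

variable {n : ℕ} {Q : Set (MvPolynomial (Fin n) ℝ)}

/-- A quadratic module containing `R - ∑ x_i²` is archimedean. -/
theorem bounds_of_const_sub_sum_sq_mem (hQ : IsQuadMod Q) {R : ℝ}
    (hR : C R - ∑ i, X i * X i ∈ Q) : Bounds Q := by
  suffices H : ∀ p : MvPolynomial (Fin n) ℝ, ∃ N : ℝ, 0 < N ∧ C N - p ∈ Q ∧ C N + p ∈ Q from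
    fun p => (H p).imp fun N hN => hN.2.1
  have hconst : ∀ {c : ℝ}, 0 ≤ c → (C c : MvPolynomial (Fin n) ℝ) ∈ Q := fun hc => hQ.const_mem hc
  have hcmul : ∀ {c : ℝ} {a : MvPolynomial (Fin n) ℝ}, 0 ≤ c → a ∈ Q → C c * a ∈ Q :=
    fun hc ha => hQ.const_mul_mem hc ha
  have hsq : ∀ {p : MvPolynomial (Fin n) ℝ} {N : ℝ}, 0 < N → C N - p ∈ Q → C N + p ∈ Q →
      C (N * N) - p * p ∈ Q := fun hN h1 h2 => hQ.sq_sub_sq_mem hN h1 h2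
  have hadd : ∀ {p q : MvPolynomial (Fin n) ℝ}, (∃ N : ℝ, 0 < N ∧ C N - p ∈ Q ∧ C N + p ∈ Q) →
      (∃ N : ℝ, 0 < N ∧ C N - q ∈ Q ∧ C N + q ∈ Q) →
      ∃ N : ℝ, 0 < N ∧ C N - (p + q) ∈ Q ∧ C N + (p + q) ∈ Q := by
    rintro p q ⟨N, hN, h1, h2⟩ ⟨M, hM, h3, h4⟩
    refine ⟨N + M, by positivity, ?_, ?_⟩
    · convert hQ.add_mem h1 h3 using 1
      rw [C_add]; ring
    · convert hQ.add_mem h2 h4 using 1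
      rw [C_add]; ring
  have hneg : ∀ {p : MvPolynomial (Fin n) ℝ}, (∃ N : ℝ, 0 < N ∧ C N - p ∈ Q ∧ C N + p ∈ Q) →
      ∃ N : ℝ, 0 < N ∧ C N - (-p) ∈ Q ∧ C N + (-p) ∈ Q := by
    rintro p ⟨N, hN, h1, h2⟩
    exact ⟨N, hN, by rwa [sub_neg_eq_add], by rwa [← sub_eq_add_neg]⟩
  have hmul : ∀ {p q : MvPolynomial (Fin n) ℝ}, (∃ N : ℝ, 0 < N ∧ C N - p ∈ Q ∧ C N + p ∈ Q) →
      (∃ N : ℝ, 0 < N ∧ C N - q ∈ Q ∧ C N + q ∈ Q) →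
      ∃ N : ℝ, 0 < N ∧ C N - (p * q) ∈ Q ∧ C N + (p * q) ∈ Q := by
    intro p q hp hq
    obtain ⟨N, hN, h1, h2⟩ := hadd hp hq
    obtain ⟨M, hM, h3, h4⟩ := hadd hp (hneg hq)
    have h5 := hsq hN h1 h2
    have h6 := hsq hM h3 h4
    have h7 : (p + q) * (p + q) ∈ Q := hQ.sumSq_mem (IsSumSq.mul_self _)
    have h8 : (p + -q) * (p + -q) ∈ Q := hQ.sumSq_mem (IsSumSq.mul_self _)
    have e : (C (1 / 4) : MvPolynomial (Fin n) ℝ) * 4 = 1 := by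
      rw [← map_ofNat C 4, ← C_mul]; norm_num
    -- With `N` bounding `p + q` and `M` bounding `p - q`, this comes from `4pq = (p + q)² - (p -
    -- q)²`.
    refine ⟨1 / 4 * (N * N) + 1 / 4 * (M * M), by positivity, ?_, ?_⟩
    · convert hcmul (c := 1 / 4) (by norm_num)
        (hQ.add_mem (hQ.add_mem h5 h8) (hconst (mul_self_nonneg M))) using 1
      simp only [C_add, C_mul]
      linear_combination (p * q) * e
    · convert hcmul (c := 1 / 4) (by norm_num)
        (hQ.add_mem (hQ.add_mem h6 h7) (hconst (mul_self_nonneg N))) using 1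
      simp only [C_add, C_mul]
      linear_combination -(p * q) * e
  have hX : ∀ i : Fin n, ∃ N : ℝ, 0 < N ∧ C N - X i ∈ Q ∧ C N + X i ∈ Q := by
    intro i
    have hi : C R - X i * X i ∈ Q := by
      have h1 : ∑ j ∈ Finset.univ.erase i, X j * X j ∈ Q :=
        hQ.sumSq_mem (IsSumSq.sum_mul_self _ _)
      have h2 := Finset.add_sum_erase Finset.univ
        (fun j => (X j * X j : MvPolynomial (Fin n) ℝ)) (Finset.mem_univ i)
      convert hQ.add_mem hR h1 using 1
      rw [← h2]; ring
    have e : (C (1 / 2) : MvPolynomial (Fin n) ℝ) * 2 = 1 := by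
      rw [← map_ofNat C 2, ← C_mul]; norm_num
    have hi' : C (|R| + 1) - X i * X i ∈ Q := by
      convert hQ.add_mem hi (hconst (c := |R| + 1 - R) (by linarith [le_abs_self R])) using 1
      rw [C_sub]; ring
    -- Completing the square: `x_i² ∓ x_i + 1/4` is a square.
    refine ⟨|R| + 1 + 1 / 2 * (1 / 2), by positivity, ?_, ?_⟩
    · convert hQ.add_mem hi' (hQ.sumSq_mem (IsSumSq.mul_self (X i - C (1 / 2)))) using 1
      rw [C_add, C_mul]
      linear_combination (X i) * e
    · convert hQ.add_mem hi' (hQ.sumSq_mem (IsSumSq.mul_self (X i + C (1 / 2)))) using 1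
      rw [C_add, C_mul]
      linear_combination -(X i) * e
  intro p
  induction p using MvPolynomial.induction_on with
  | C a =>
    refine ⟨|a| + 1, by positivity, ?_, ?_⟩
    · rw [← C_sub]; exact hconst (by linarith [le_abs_self a])
    · rw [← C_add]; exact hconst (by linarith [neg_abs_le a])
  | add p q hp hq => exact hadd hp hq
  | mul_X p i hp => exact hmul hp (hX i)

/-- A quadratic module containing some `q` with `{q ≥ 0}` compact is archimedean. -/
theorem bounds_of_isCompact (hQ : IsQuadMod Q) {q : MvPolynomial (Fin n) ℝ} (hq : q ∈ Q)
    (hcomp : IsCompact {x : Fin n → ℝ | 0 ≤ eval x q}) : Bounds Q := by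
  classical
  obtain ⟨R, hRpos, hR⟩ : ∃ R : ℝ, 0 < R ∧ ∀ x : Fin n → ℝ, 0 ≤ eval x q → ∑ i, x i * x i < R := by
    obtain ⟨B, hB⟩ := hcomp.exists_bound_of_continuousOn (f := fun x : Fin n → ℝ => ∑ i, x i * x i)
      (by fun_prop)
    refine ⟨|B| + 1, by positivity, fun x hx => ?_⟩
    have h1 := hB x hx
    have h2 := le_abs_self (∑ i, x i * x i)
    have h3 := le_abs_self B
    rw [Real.norm_eq_abs] at h1
    linarith
  let u : MvPolynomial (Fin n) ℝ := ∑ i, X i * X i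
  have hu : IsSumSq u := IsSumSq.sum_mul_self _ _
  let p : MvPolynomial (Fin n) ℝ := C R - u
  let T₀ : Subsemiring (MvPolynomial (Fin n) ℝ) := Subsemiring.sumSq _
  have hT₀ : ∀ a, a * a ∈ T₀ := fun a => by simp [T₀]
  -- With a single generator `q`, the preordering `Σ + Σ q` is no larger than the quadratic module,
  -- hence lies in `Q`.
  let T := adjoinPreordering T₀ hT₀ q
  have hT : ∀ a, a * a ∈ T := mul_self_mem_adjoinPreordering
  have hTQ : ∀ t ∈ T, t ∈ Q := by
    rintro _ ⟨s, hs, t, ht, rfl⟩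
    exact hQ.add_mem (hQ.sumSq_mem (Subsemiring.mem_sumSq.1 hs))
      (hQ.sumSq_mul_mem (Subsemiring.mem_sumSq.1 ht) hq)
  -- The Positivstellensatz for `p > 0` on `{q ≥ 0}`: otherwise transfer would produce a real point
  -- with `q ≥ 0` and `p ≤ 0`.
  have hneg : (-1 : MvPolynomial (Fin n) ℝ) ∈ adjoinPreordering T hT (-p) := by
    by_contra hcon
    obtain ⟨K, _, _, _, ψ, hK, hψ⟩ := exists_polyIVT_of_preordering
      (adjoinPreordering T hT (-p)) mul_self_mem_adjoinPreordering hcon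
    have h1 := hψ q (le_adjoinPreordering mem_adjoinPreordering_self)
    have h2 := hψ (-p) mem_adjoinPreordering_self
    obtain ⟨x, hx⟩ := exists_real_point hK n ψ {q, -p}
    have h3 := hx q (by simp)
    have h4 := hx (-p) (by simp)
    rw [← sign_nonneg_iff, ← h3, sign_nonneg_iff] at h1
    rw [← sign_nonneg_iff, ← h4, sign_nonneg_iff] at h2
    have h5 := hR x h1
    have h6 : eval x p = R - ∑ i, x i * x i := by simp [p, u]
    rw [map_neg, h6] at h2
    linarith
  obtain ⟨s, hs, t, ht, h⟩ := hneg
  have htp : t * p = 1 + s := by linear_combination h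
  have hTM := isQuadMod_of_preordering hT
  have h1 : (1 + s) * p ∈ T := by
    rw [← htp, mul_assoc]
    exact T.mul_mem ht (hT p)
  have hs1 : 1 + s ∈ T := T.add_mem T.one_mem hs
  -- Wörmann's trick. Adjoining `p` gives a preordering that bounds `s`; the factor `1 + s` brings
  -- the bound back to `T`, because `(1 + s) p = t p²` is in `T`.
  let M := adjoinPreordering T hT p
  have hM : IsQuadMod (M : Set (MvPolynomial (Fin n) ℝ)) :=
    isQuadMod_of_preordering mul_self_mem_adjoinPreordering
  have hMb : Bounds (M : Set (MvPolynomial (Fin n) ℝ)) :=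
    hM.bounds_of_const_sub_sum_sq_mem (R := R) mem_adjoinPreordering_self
  obtain ⟨N', hN'⟩ := hMb s
  obtain ⟨N, hN, hNs⟩ : ∃ N : ℝ, 0 < N ∧ C N - s ∈ M := by
    refine ⟨|N'| + 1, by positivity, ?_⟩
    have := hM.add_mem hN' (hM.const_mem (c := |N'| + 1 - N') (by linarith [le_abs_self N']))
    rw [algebraMap_eq] at this
    change C (|N'| + 1) - s ∈ (M : Set _)
    convert this using 1
    rw [C_sub]; ring
  obtain ⟨a, ha, b, hb, hab⟩ := hNs
  have h2 : (1 + s) * (C N - s) ∈ T := by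
    have : (1 + s) * (C N - s) = (1 + s) * a + b * ((1 + s) * p) := by rw [hab]; ring
    rw [this]
    exact T.add_mem (T.mul_mem hs1 ha) (T.mul_mem hb h1)
  have h3 : C N - s ∈ T := by
    refine hTM.mem_of_const_mul_mem (c := N + 1) (by positivity) ?_
    -- The factor `1 + s` is removed by adding `(N - s)²`, since `(1 + s) + (N - s)` is the constant
    -- `N + 1`.
    have : algebraMap ℝ _ (N + 1) * (C N - s) =
        (1 + s) * (C N - s) + (s - C N) * (s - C N) := by
      rw [algebraMap_eq, C_add, C_1]; ring
    rw [this]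
    exact T.add_mem h2 (hT _)
  have h4 : C (R + R * N) - u ∈ T := by
    have : C (R + R * N) - u = (1 + s) * p + s * u + C R * (C N - s) := by
      simp only [p, C_add, C_mul]; ring
    rw [this]
    refine T.add_mem (T.add_mem h1 (T.mul_mem hs (le_adjoinPreordering ?_)))
      (hTM.const_mul_mem hRpos.le h3)
    exact Subsemiring.mem_sumSq.2 hu
  exact hQ.bounds_of_const_sub_sum_sq_mem (hTQ _ h4)

/-- Putinar's Positivstellensatz. -/
theorem mem_of_forall_eval_pos (hQ : IsQuadMod Q) (hb : Bounds Q) {f : MvPolynomial (Fin n) ℝ}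
    (hf : ∀ x : Fin n → ℝ, (∀ q ∈ Q, 0 ≤ eval x q) → 0 < eval x f) : f ∈ Q := by
  refine hQ.mem_of_forall_algHom_pos hb fun φ hφ => ?_
  -- Real characters of the polynomial ring are point evaluations.
  have h : ∀ p, φ p = eval (fun i => φ (X i)) p := by
    intro p
    have : φ = aeval (fun i => φ (X i)) := by
      apply MvPolynomial.algHom_ext
      intro i
      simp
    conv_lhs => rw [this]
    rfl
  rw [h]
  exact hf _ fun q hq => by rw [← h]; exact hφ q hq

end IsQuadMod

end RealAlgebra

namespace UnifiedMomentSOS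

open RealAlgebra Filter

/-! ### Degrees of sums of squares -/

section SumSqDegree

variable {n : ℕ}

/-- Positive leading terms for a degree-compatible monomial order cannot cancel. This is how a
degree bound on a sum of squares passes to each square, as the moment pairing requires. -/
theorem totalDegree_le_of_leadingCoeff_pos {s t : RPoly n}
    (hs : s = 0 ∨ 0 < MonomialOrder.degLex.leadingCoeff s)
    (ht : t = 0 ∨ 0 < MonomialOrder.degLex.leadingCoeff t) :
    s.totalDegree ≤ (s + t).totalDegree ∧
      (s + t = 0 ∨ 0 < MonomialOrder.degLex.leadingCoeff (s + t)) := by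
  rcases hs with rfl | hs
  · simpa using ht
  rcases ht with rfl | ht
  · simpa using Or.inr hs
  rcases lt_trichotomy (MonomialOrder.degLex.toSyn (MonomialOrder.degLex.degree s))
    (MonomialOrder.degLex.toSyn (MonomialOrder.degLex.degree t)) with h | h | h
  · refine ⟨?_, Or.inr ?_⟩
    · apply degLex_totalDegree_monotone
      rw [MonomialOrder.degree_add_eq_right_of_lt h]
      exact h.le
    · rwa [add_comm, MonomialOrder.leadingCoeff_add_of_lt h]
  · have h' := MonomialOrder.degLex.toSyn.injective h
    have hc : coeff (MonomialOrder.degLex.degree s) (s + t) =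
        MonomialOrder.degLex.leadingCoeff s + MonomialOrder.degLex.leadingCoeff t := by
      rw [coeff_add, MonomialOrder.leadingCoeff, MonomialOrder.leadingCoeff, h']
    have hmem : MonomialOrder.degLex.degree s ∈ (s + t).support := by
      rw [mem_support_iff, hc]
      positivity
    have h1 := MonomialOrder.degLex.le_degree hmem
    have h2 : MonomialOrder.degLex.toSyn (MonomialOrder.degLex.degree (s + t)) ≤
        MonomialOrder.degLex.toSyn (MonomialOrder.degLex.degree s) := by
      refine MonomialOrder.degree_add_le.trans ?_
      rw [← h, sup_idem]
    have h3 := MonomialOrder.degLex.toSyn.injective (le_antisymm h1 h2)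
    refine ⟨degLex_totalDegree_monotone h1, Or.inr ?_⟩
    rw [MonomialOrder.leadingCoeff, ← h3, hc]
    positivity
  · refine ⟨?_, Or.inr ?_⟩
    · apply degLex_totalDegree_monotone
      rw [MonomialOrder.degree_add_of_lt h]
    · rwa [MonomialOrder.leadingCoeff_add_of_lt h]

theorem leadingCoeff_pos_of_isSumSq {s : RPoly n} (hs : IsSumSq s) :
    s = 0 ∨ 0 < MonomialOrder.degLex.leadingCoeff s := by
  induction hs with
  | zero => exact Or.inl rfl
  | sq_add a _ ih =>
    refine (totalDegree_le_of_leadingCoeff_pos ?_ ih).2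
    by_cases ha : a = 0
    · simp [ha]
    · right
      rw [MonomialOrder.leadingCoeff_mul]
      exact mul_self_pos.2 (MonomialOrder.leadingCoeff_ne_zero_iff.2 ha)

theorem totalDegree_le_add_of_isSumSq {s t : RPoly n} (hs : IsSumSq s) (ht : IsSumSq t) :
    s.totalDegree ≤ (s + t).totalDegree :=
  (totalDegree_le_of_leadingCoeff_pos (leadingCoeff_pos_of_isSumSq hs)
    (leadingCoeff_pos_of_isSumSq ht)).1

end SumSqDegree

/-! ### The pairing of truncated certificates with moment sequences -/

section Riesz

variable {n d : ℕ}

/-- The Riesz functional as a linear map. -/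
noncomputable def rieszₗ (y : Tms n d) : RPoly n →ₗ[ℝ] ℝ where
  toFun := riesz y
  map_add' p q := by simp [riesz, add_mul, Finset.sum_add_distrib]
  map_smul' c p := by simp [riesz, Finset.mul_sum, mul_assoc]

theorem rieszₗ_apply (y : Tms n d) (p : RPoly n) : rieszₗ y p = riesz y p := rfl

theorem riesz_C (y : Tms n d) (c : ℝ) : riesz y (C c) = c * y.zeroth := by
  classical
  unfold riesz Tms.zeroth
  rw [Finset.sum_eq_single ⟨0, by simp⟩]
  · simp
  · intro b _ hb
    have : (0 : Fin n →₀ ℕ) ≠ b.1 := fun h => hb (Subtype.ext h.symm)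
    rw [coeff_C, if_neg this, zero_mul]
  · simp

theorem sum_monomial_subtype {P : (Fin n →₀ ℕ) → Prop} [Fintype {α // P α}] {p : RPoly n}
    (h : ∀ α ∈ p.support, P α) : ∑ a : {α // P α}, coeff a.1 p • monomial a.1 (1 : ℝ) = p := by
  classical
  ext β
  rw [coeff_sum]
  simp only [coeff_smul, coeff_monomial, smul_eq_mul, mul_ite, mul_one, mul_zero]
  by_cases hβ : P β
  · rw [Finset.sum_eq_single ⟨β, hβ⟩]
    · simp
    · intro b _ hb
      exact if_neg fun h => hb (Subtype.ext h)
    · simp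
  · rw [Finset.sum_eq_zero]
    · by_contra h0
      exact hβ (h β (mem_support_iff.2 (Ne.symm h0)))
    · intro b _
      exact if_neg (fun h : b.1 = β => hβ (by rw [← h]; exact b.2))

theorem degree_le_totalDegree {p : RPoly n} {α : Fin n →₀ ℕ} (h : α ∈ p.support) :
    α.degree ≤ p.totalDegree := le_totalDegree h

/-- The truncated multi-sequence of moments of the point evaluation at `x`. -/
noncomputable def evalTms (d : ℕ) (x : Fin n → ℝ) : Tms n d := fun α => eval x (monomial α.1 1)

theorem riesz_evalTms {x : Fin n → ℝ} {p : RPoly n} (hp : p.totalDegree ≤ d) :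
    riesz (evalTms d x) p = eval x p := by
  conv_rhs => rw [← sum_monomial_subtype (P := fun α => α.degree ≤ d) (p := p)
    fun α hα => (degree_le_totalDegree hα).trans hp]
  rw [map_sum]
  simp only [riesz, evalTms, smul_eval]

theorem totalDegree_mul_monomial_le (p : RPoly n) (α : Fin n →₀ ℕ) :
    (p * monomial α 1).totalDegree ≤ p.totalDegree + α.degree :=
  (totalDegree_mul _ _).trans (Nat.add_le_add_left (totalDegree_monomial_le α 1) _)

instance instFiniteLocalizingIndex (n k e : ℕ) :
    Finite {α : Fin n →₀ ℕ // e + 2 * α.degree ≤ 2 * k} :=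
  Finite.of_injective (β := Expo n (2 * k)) (fun α => ⟨α.1, by have := α.2; omega⟩)
    fun a b h => Subtype.ext (congrArg (fun c : Expo n (2 * k) => c.1) h)

/-- The matrix is `p(x) v vᵀ`, with `v` the vector of monomials at `x`. -/
theorem posSemidef_localizingMatrix_evalTms {x : Fin n → ℝ} {k : ℕ} {p : RPoly n}
    (hp : 0 ≤ eval x p) : (localizingMatrix k p (evalTms (2 * k) x)).PosSemidef := by
  have hL : ∀ a b, localizingMatrix k p (evalTms (2 * k) x) a b =
      eval x p * eval x (monomial a.1 1) * eval x (monomial b.1 1) := by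
    intro a b
    unfold localizingMatrix
    rw [riesz_evalTms, map_mul, map_mul]
    have h1 := totalDegree_mul_monomial_le (p * monomial a.1 1) b.1
    have h2 := totalDegree_mul_monomial_le p a.1
    have := a.2
    have := b.2
    omega
  refine ⟨?_, fun v => ?_⟩
  · ext a b
    rw [Matrix.conjTranspose_apply, hL, hL, star_trivial]
    ring
  · have : (v.sum fun i vi => v.sum fun j vj =>
        star vi * localizingMatrix k p (evalTms (2 * k) x) i j * vj) =
        eval x p * ((v.sum fun i vi => vi * eval x (monomial i.1 1)) *
          (v.sum fun i vi => vi * eval x (monomial i.1 1))) := by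
      simp only [Finsupp.sum, hL, star_trivial]
      rw [Finset.sum_mul_sum, Finset.mul_sum]
      refine Finset.sum_congr rfl fun i _ => ?_
      rw [Finset.mul_sum]
      refine Finset.sum_congr rfl fun j _ => ?_
      ring
    rw [this]
    exact mul_nonneg hp (mul_self_nonneg _)

/-- The pairing is the quadratic form of the localizing matrix at the coefficient vector of `p`. The
degree bound says exactly that this vector is indexed by the rows. -/
theorem riesz_mul_sq_nonneg {k : ℕ} {g p : RPoly n} {y : Tms n (2 * k)}
    (hg : (localizingMatrix k g y).PosSemidef)
    (hp : g.totalDegree + (p * p).totalDegree ≤ 2 * k) : 0 ≤ riesz y (g * (p * p)) := by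
  classical
  have := Fintype.ofFinite {α : Fin n →₀ ℕ // g.totalDegree + 2 * α.degree ≤ 2 * k}
  by_cases hp0 : p = 0
  · rw [hp0, ← rieszₗ_apply]; simp
  rw [totalDegree_mul_of_isDomain hp0 hp0] at hp
  have hsum := sum_monomial_subtype (P := fun α => g.totalDegree + 2 * α.degree ≤ 2 * k) (p := p)
    fun α hα => by have := degree_le_totalDegree hα; omega
  have h := hg.2 (Finsupp.equivFunOnFinite.symm fun a => coeff a.1 p)
  rw [Finsupp.sum_fintype _ _ (by simp)] at h
  refine h.trans_eq (Eq.symm ?_)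
  have hpp : p * p = (∑ a : {α : Fin n →₀ ℕ // g.totalDegree + 2 * α.degree ≤ 2 * k},
      coeff a.1 p • monomial a.1 (1 : ℝ)) *
      ∑ b : {α : Fin n →₀ ℕ // g.totalDegree + 2 * α.degree ≤ 2 * k},
        coeff b.1 p • monomial b.1 (1 : ℝ) := by
    rw [hsum]
  rw [hpp, Finset.sum_mul_sum, Finset.mul_sum, ← rieszₗ_apply, map_sum]
  refine Finset.sum_congr rfl fun a _ => ?_
  rw [Finsupp.sum_fintype _ _ (by simp), Finset.mul_sum, map_sum]
  refine Finset.sum_congr rfl fun b _ => ?_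
  have e : g * (coeff a.1 p • monomial a.1 (1 : ℝ) * coeff b.1 p • monomial b.1 (1 : ℝ)) =
      (coeff a.1 p * coeff b.1 p) • (g * monomial a.1 1 * monomial b.1 1) := by
    simp only [smul_eq_C_mul, C_mul]; ring
  rw [e, map_smul, rieszₗ_apply, smul_eq_mul]
  simp only [localizingMatrix, Finsupp.equivFunOnFinite_symm_apply_apply, star_trivial]
  ring

theorem riesz_mul_sumSq_nonneg {k : ℕ} {g σ : RPoly n} {y : Tms n (2 * k)}
    (hg : (localizingMatrix k g y).PosSemidef) (hσ : IsSumSq σ)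
    (hdeg : g.totalDegree + σ.totalDegree ≤ 2 * k) : 0 ≤ riesz y (g * σ) := by
  induction hσ with
  | zero => rw [← rieszₗ_apply]; simp
  | sq_add a hs ih =>
    have h1 := totalDegree_le_add_of_isSumSq (IsSumSq.mul_self a) hs
    have h2 := totalDegree_le_add_of_isSumSq hs (IsSumSq.mul_self a)
    rw [add_comm] at h2
    rw [mul_add, ← rieszₗ_apply, map_add]
    exact add_nonneg (riesz_mul_sq_nonneg hg (by omega)) (ih (by omega))

theorem riesz_mul_eq_zero {k : ℕ} {h q : RPoly n} {y : Tms n (2 * k)}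
    (hv : localizingVector k h y = 0) (hdeg : q = 0 ∨ h.totalDegree + q.totalDegree ≤ 2 * k) :
    riesz y (h * q) = 0 := by
  rcases hdeg with rfl | hdeg
  · rw [← rieszₗ_apply]; simp
  have hq := q.support_sum_monomial_coeff
  conv_lhs => rw [← hq]
  rw [Finset.mul_sum, ← rieszₗ_apply, map_sum]
  refine Finset.sum_eq_zero fun α hα => ?_
  have hα' := degree_le_totalDegree hα
  have h1 := congrFun hv ⟨α, by omega⟩
  have h2 : h * monomial α (coeff α q) = coeff α q • (h * monomial α 1) := by
    rw [smul_eq_C_mul, mul_left_comm, C_mul_monomial, mul_one]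
  rw [h2, map_smul, rieszₗ_apply]
  have h3 : riesz y (h * monomial α 1) = 0 := h1
  rw [h3, smul_zero]

variable {E I : Type*} [Fintype E] [Fintype I]

theorem riesz_idealTrunc {k : ℕ} {ceq : E → RPoly n} {y : Tms n (2 * k)}
    (hv : ∀ i, localizingVector k (ceq i) y = 0) {p : RPoly n} (hp : p ∈ idealTrunc ceq k) :
    riesz y p = 0 := by
  obtain ⟨q, hq, rfl⟩ := hp
  rw [← rieszₗ_apply, map_sum]
  exact Finset.sum_eq_zero fun i _ => riesz_mul_eq_zero (hv i) (hq i)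

theorem riesz_quadModuleTrunc_nonneg {k : ℕ} {cin : I → RPoly n} {y : Tms n (2 * k)}
    (hL : ∀ j, (localizingMatrix k (cin j) y).PosSemidef) (hM : (momentMatrix k y).PosSemidef)
    {p : RPoly n} (hp : p ∈ quadModuleTrunc cin k) : 0 ≤ riesz y p := by
  obtain ⟨σ₀, σ, h₀, hσ, hd₀, hd, rfl⟩ := hp
  rw [← rieszₗ_apply, map_add, map_sum]
  refine add_nonneg ?_ (Finset.sum_nonneg fun j _ => ?_)
  · have := riesz_mul_sumSq_nonneg (g := 1) hM h₀ (by simpa using hd₀)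
    rwa [one_mul] at this
  · rw [mul_comm (σ j) (cin j)]
    -- Degrees are additive only for nonzero factors, so a zero factor is treated apart.
    by_cases hz : σ j = 0 ∨ cin j = 0
    · rcases hz with hz | hz <;> simp [hz]
    · push Not at hz
      refine riesz_mul_sumSq_nonneg (hL j) (hσ j) ?_
      have := hd j
      rw [totalDegree_mul_of_isDomain hz.1 hz.2] at this
      omega

end Riesz

/-! ### The module of one piece and its truncations -/

section QuadModule

variable {n : ℕ} {E I : Type*} [Fintype E] [Fintype I]

omit [Fintype E] in
theorem mem_idealAddQuadModule_iff {ceq : E → RPoly n} {cin : I → RPoly n} {p : RPoly n} :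
    p ∈ idealAddQuadModule ceq cin ↔ ∃ a ∈ Ideal.span (Set.range ceq), ∃ b ∈ quadModule cin,
      a + b = p := Set.mem_add

omit [Fintype E] in
theorem isQuadMod_idealAddQuadModule (ceq : E → RPoly n) (cin : I → RPoly n) :
    IsQuadMod (idealAddQuadModule ceq cin) := by
  refine ⟨?_, ?_, ?_⟩
  · exact mem_idealAddQuadModule_iff.2 ⟨0, zero_mem _, 1,
      ⟨1, 0, IsSumSq.one, fun _ => IsSumSq.zero, by simp⟩, by simp⟩
  · intro p q hp hq
    obtain ⟨a, ha, _, ⟨σ₀, σ, h₀, hσ, rfl⟩, rfl⟩ := mem_idealAddQuadModule_iff.1 hp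
    obtain ⟨b, hb, _, ⟨τ₀, τ, h₀', hτ, rfl⟩, rfl⟩ := mem_idealAddQuadModule_iff.1 hq
    refine mem_idealAddQuadModule_iff.2 ⟨a + b, add_mem ha hb, _, ⟨σ₀ + τ₀, fun j => σ j + τ j,
      h₀.add h₀', fun j => (hσ j).add (hτ j), rfl⟩, ?_⟩
    simp only [add_mul, Finset.sum_add_distrib]
    ring
  · intro c p hp
    obtain ⟨a, ha, _, ⟨σ₀, σ, h₀, hσ, rfl⟩, rfl⟩ := mem_idealAddQuadModule_iff.1 hp
    refine mem_idealAddQuadModule_iff.2 ⟨c * c * a, Ideal.mul_mem_left _ _ ha, _,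
      ⟨c * c * σ₀, fun j => c * c * σ j, (IsSumSq.mul_self c).mul h₀,
        fun j => (IsSumSq.mul_self c).mul (hσ j), rfl⟩, ?_⟩
    rw [mul_add, mul_add, Finset.mul_sum]
    simp only [mul_assoc]

omit [Fintype E] in
-- The ideal contains both `c_i` and `-c_i`, which forces equality; each `c_j` is in the module with
-- multiplier `1`.
theorem mem_semialgSet_of_forall_nonneg {ceq : E → RPoly n} {cin : I → RPoly n} {x : Fin n → ℝ}
    (hx : ∀ q ∈ idealAddQuadModule ceq cin, 0 ≤ eval x q) : x ∈ semialgSet ceq cin := by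
  classical
  have hideal : ∀ a ∈ Ideal.span (Set.range ceq), 0 ≤ eval x a := fun a ha =>
    hx a (mem_idealAddQuadModule_iff.2 ⟨a, ha, 0,
      ⟨0, 0, IsSumSq.zero, fun _ => IsSumSq.zero, by simp⟩, by simp⟩)
  refine ⟨fun i => ?_, fun j => ?_⟩
  · have hi : ceq i ∈ Ideal.span (Set.range ceq) := Ideal.subset_span ⟨i, rfl⟩
    have h1 := hideal _ hi
    have h2 := hideal _ (neg_mem hi)
    rw [map_neg] at h2
    linarith
  · refine hx _ (mem_idealAddQuadModule_iff.2 ⟨0, zero_mem _, cin j, ⟨0, Pi.single j 1,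
      IsSumSq.zero, fun i => ?_, ?_⟩, by simp⟩)
    · by_cases hij : i = j
      · subst hij; rw [Pi.single_eq_same]; exact IsSumSq.one
      · rw [Pi.single_eq_of_ne hij]; exact IsSumSq.zero
    · rw [Finset.sum_eq_single j] <;> simp +contextual

theorem eventually_mem_trunc {ceq : E → RPoly n} {cin : I → RPoly n} {p : RPoly n}
    (hp : p ∈ idealAddQuadModule ceq cin) :
    ∀ᶠ k in atTop, p ∈ idealTrunc ceq k + quadModuleTrunc cin k := by
  obtain ⟨a, ha, _, ⟨σ₀, σ, h₀, hσ, rfl⟩, rfl⟩ := mem_idealAddQuadModule_iff.1 hp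
  obtain ⟨q, rfl⟩ := Ideal.mem_span_range_iff_exists_fun.1 ha
  have h1 : ∀ᶠ k in atTop, ∀ i, (ceq i).totalDegree + (q i).totalDegree ≤ 2 * k :=
    eventually_all.2 fun i => (eventually_ge_atTop _).mono fun k hk =>
      (show _ ≤ k from hk).trans (by omega)
  have h2 : ∀ᶠ k in atTop, ∀ j, (σ j * cin j).totalDegree ≤ 2 * k :=
    eventually_all.2 fun j => (eventually_ge_atTop _).mono fun k hk =>
      (show _ ≤ k from hk).trans (by omega)
  filter_upwards [h1, h2, eventually_ge_atTop σ₀.totalDegree] with k hk1 hk2 hk3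
  refine Set.mem_add.2 ⟨_, ⟨q, fun i => Or.inr (hk1 i), ?_⟩, _,
    ⟨σ₀, σ, h₀, hσ, by omega, hk2, rfl⟩, rfl⟩
  exact Finset.sum_congr rfl fun i _ => mul_comm _ _

end QuadModule

/-! ### Weak duality, upper bound and asymptotic feasibility -/

section Hierarchy

variable {n m : ℕ} {E I : Fin m → Type*} [∀ l, Fintype (E l)] [∀ l, Fintype (I l)]
  (f : RPoly n) (ceq : ∀ l, E l → RPoly n) (cin : ∀ l, I l → RPoly n)

/-- Weak duality: pairing the `l`th certificate with `y^(l)` gives `γ y^(l)_0 ≤ ⟨f, y^(l)⟩`, and the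
zeroth moments sum to `1`. -/
theorem fsos_le_fmom (k : ℕ) : fsos f ceq cin k ≤ fmom f ceq cin k := by
  refine iSup₂_le fun γ hγ => le_iInf₂ fun y hy => ?_
  obtain ⟨hfeas, hone⟩ := hy
  rw [EReal.coe_le_coe_iff]
  have h : ∀ l, γ * (y l).zeroth ≤ riesz (y l) f := by
    intro l
    obtain ⟨hv, hL, hM⟩ := hfeas l
    obtain ⟨a, ha, b, hb, hab⟩ := Set.mem_add.1 (Set.mem_iInter.1 hγ l)
    have h1 := riesz_idealTrunc hv ha
    have h2 := riesz_quadModuleTrunc_nonneg hL hM hb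
    have h3 : riesz (y l) f - γ * (y l).zeroth = riesz (y l) a + riesz (y l) b := by
      rw [← riesz_C, ← rieszₗ_apply, ← rieszₗ_apply, ← rieszₗ_apply, ← rieszₗ_apply, ← map_sub,
        ← map_add, hab]
    linarith
  calc γ = ∑ l, γ * (y l).zeroth := by rw [← Finset.mul_sum, hone, mul_one]
    _ ≤ ∑ l, riesz (y l) f := Finset.sum_le_sum fun l _ => h l

omit [∀ l, Fintype (E l)] [∀ l, Fintype (I l)] in
theorem fmom_le_fmin {k : ℕ} (hk : f.totalDegree ≤ 2 * k) :
    fmom f ceq cin k ≤ fmin f ceq cin := by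
  classical
  refine le_iInf₂ fun x hx => ?_
  obtain ⟨l, hl⟩ := Set.mem_iUnion.1 hx
  -- All mass sits in one piece that contains `x`; the other sequences are zero.
  let y : Fin m → Tms n (2 * k) := Pi.single l (evalTms (2 * k) x)
  have hyl : y l = evalTms (2 * k) x := Pi.single_eq_same _ _
  have hyne : ∀ l', l' ≠ l → y l' = 0 := fun l' h => Pi.single_eq_of_ne h _
  have hr0 : ∀ p : RPoly n, riesz (0 : Tms n (2 * k)) p = 0 := fun p => by simp [riesz]
  have hmat0 : ∀ p : RPoly n, (localizingMatrix k p (0 : Tms n (2 * k))).PosSemidef := by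
    intro p
    have : localizingMatrix k p (0 : Tms n (2 * k)) = 0 := by
      ext a b
      exact hr0 _
    rw [this]
    exact Matrix.PosSemidef.zero
  have hy : y ∈ momFeasible ceq cin k := by
    refine ⟨fun l' => ?_, ?_⟩
    · by_cases h : l' = l
      · subst h
        rw [hyl]
        refine ⟨fun i => ?_, fun j => posSemidef_localizingMatrix_evalTms (hl.2 j),
          posSemidef_localizingMatrix_evalTms (by simp)⟩
        ext α
        unfold localizingVector
        rw [riesz_evalTms ((totalDegree_mul_monomial_le _ _).trans α.2), map_mul, hl.1 i, zero_mul]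
        rfl
      · rw [hyne l' h]
        refine ⟨fun i => ?_, fun j => hmat0 _, hmat0 _⟩
        ext α
        exact hr0 _
    · rw [Finset.sum_eq_single l]
      · rw [hyl]
        simp [Tms.zeroth, evalTms]
      · intro l' _ h
        rw [hyne l' h]
        rfl
      · simp
  refine (iInf₂_le y hy).trans ?_
  rw [EReal.coe_le_coe_iff, Finset.sum_eq_single l]
  · rw [hyl, riesz_evalTms hk]
  · intro l' _ h
    rw [hyne l' h, hr0]
  · simp

/-- Putinar's theorem is applied to each piece separately. An empty `K_l` needs no special care,
since positivity on it is vacuous. -/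
theorem eventually_mem_sosFeasible
    (harch : ∀ l, IsArchimedean (idealAddQuadModule (ceq l) (cin l))) {γ : ℝ}
    (hγ : (γ : EReal) < fmin f ceq cin) : ∀ᶠ k in atTop, γ ∈ sosFeasible f ceq cin k := by
  have h : ∀ l, ∀ᶠ k in atTop, f - C γ ∈ idealTrunc (ceq l) k + quadModuleTrunc (cin l) k := by
    intro l
    obtain ⟨q, hq, hcomp⟩ := harch l
    have hQ := isQuadMod_idealAddQuadModule (ceq l) (cin l)
    refine eventually_mem_trunc (hQ.mem_of_forall_eval_pos (hQ.bounds_of_isCompact hq hcomp) ?_)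
    intro x hx
    have h1 : fmin f ceq cin ≤ ((eval x f : ℝ) : EReal) :=
      iInf₂_le x (Set.mem_iUnion.2 ⟨l, mem_semialgSet_of_forall_nonneg hx⟩)
    have h2 := EReal.coe_lt_coe_iff.1 (hγ.trans_le h1)
    rw [map_sub, eval_C]
    linarith
  filter_upwards [eventually_all.2 h] with k hk
  exact Set.mem_iInter.2 hk

end Hierarchy

end UnifiedMomentSOS

theorem theorem3p6 {n m : ℕ} {E I : Fin m → Type*}
    [∀ l, Fintype (E l)] [∀ l, Fintype (I l)]
    (f : MvPolynomial (Fin n) ℝ)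
    (ceq : ∀ l, E l → MvPolynomial (Fin n) ℝ)
    (cin : ∀ l, I l → MvPolynomial (Fin n) ℝ)
    (harch : ∀ l, UnifiedMomentSOS.IsArchimedean
      (UnifiedMomentSOS.idealAddQuadModule (ceq l) (cin l))) :
    Filter.Tendsto (fun k : ℕ => UnifiedMomentSOS.fsos f ceq cin k) Filter.atTop
        (nhds (UnifiedMomentSOS.fmin f ceq cin)) ∧
      Filter.Tendsto (fun k : ℕ => UnifiedMomentSOS.fmom f ceq cin k) Filter.atTop
        (nhds (UnifiedMomentSOS.fmin f ceq cin)) := by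
  have hle : ∀ k, UnifiedMomentSOS.fsos f ceq cin k ≤ UnifiedMomentSOS.fmom f ceq cin k :=
    UnifiedMomentSOS.fsos_le_fmom f ceq cin
  have hupper : ∀ᶠ k in Filter.atTop,
      UnifiedMomentSOS.fmom f ceq cin k ≤ UnifiedMomentSOS.fmin f ceq cin := by
    filter_upwards [Filter.eventually_ge_atTop f.totalDegree] with k hk
    exact UnifiedMomentSOS.fmom_le_fmin f ceq cin (by omega)
  have hlower : ∀ a < UnifiedMomentSOS.fmin f ceq cin,
      ∀ᶠ k in Filter.atTop, a < UnifiedMomentSOS.fsos f ceq cin k := by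
    intro a ha
    -- Feasible values are real while `a` may be `⊥`, so a real number strictly between is inserted.
    obtain ⟨γ, h1, h2⟩ := EReal.lt_iff_exists_real_btwn.1 ha
    filter_upwards [UnifiedMomentSOS.eventually_mem_sosFeasible f ceq cin harch h2] with k hk
    exact h1.trans_le (le_iSup₂ (f := fun (γ : ℝ) (_ : γ ∈ UnifiedMomentSOS.sosFeasible f ceq cin k)
      => (γ : EReal)) γ hk)
  constructor
  · refine tendsto_order.2 ⟨hlower, fun a ha => ?_⟩
    filter_upwards [hupper] with k hk
    exact ((hle k).trans hk).trans_lt ha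
  · refine tendsto_order.2 ⟨fun a ha => ?_, fun a ha => ?_⟩
    · filter_upwards [hlower a ha] with k hk
      exact hk.trans_le (hle k)
    · filter_upwards [hupper] with k hk
      exact hk.trans_lt ha
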